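/- **Setting.** Fix $M>0$ and $\Lambda=[-M,M]$; write points of $\mathbb R^2$ as $(\alpha,u)$ and let $e=(1,0)$. Let $\mathfrak E$ be the set of open $A\subset\Lambda$ such that for some $n\ge 1$ any two distinct points of $\partial A$ are at distance larger than $1/n$, with the distance $|A\triangle B|$ (Lebesgue measure), and let $\Omega$ be the space of continuous paths $\omega=(\omega_\alpha)_{\alpha\in\mathbb R}$ in $\mathfrak E$ with the $\sigma$-algebra generated by the cylinder sets. Write also $\omega=\{(\alpha,u)\in\mathbb R^2: u\in\omega_\alpha\}$ for the tube; since sets at distance $0$ are not distinguished by the $\sigma$-algebra, a path is represented by the version whose tube is a regular open set (equal to the interior of its closure). Let $\mathbb P$ be a probability measure on $\Omega$, stationary and ergodic under the shifts $(\theta_a\omega)_\alpha=\omega_{\alpha+a}$, such that $\mathbb P$-a.s. the tube is connected. Let $\nu^\omega$ be the one-dimensional Hausdorff measure on $\partial\omega$, $\mu^\omega_0$ the counting measure on $\partial\omega_0$, $\mathbf n_\omega(x)$ the inner unit normal of $\partial\omega$ at $x$ where it exists, $\kappa_x=|\mathbf n_\omega(x)\cdot(0,1)|$, and $\mathcal R_\omega$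 the set of $x\in\partial\omega$ at which $\partial\omega$ is continuously differentiable and $|\mathbf n_\omega(x)\cdot e|\ne1$. Assume: * (L) there are nonrandom $\varepsilon>0$ and $L$ such that $\mathbb P$-a.s. $\partial\omega$ is $(\varepsilon,L)$-Lipschitz: for every $x\in\partial\omega$ an isometry of the plane takes $x$ to $0$ and the part of $\omega$ within distance $\varepsilon$ of $x$ to $\{z:\|z\|<\varepsilon,\ z_2>f(z_1)\}$ for some $L$-Lipschitz $f:\mathbb R\to\mathbb R$ with $f(0)=0$; * (R) $\nu^\omega(\partial\omega\setminus\mathcal R_\omega)=0$, $\mathbb P$-a.s. For $x,y\in\partial\omega$ let $$K(x,y)=\frac12\,\frac{\big((y-x)\cdot\mathbf n_\omega(x)\big)\big((x-y)\cdot\mathbf n_\omega(y)\big)}{\|x-y\|^{3}}$$ if $x,y\in\mathcal R_\omega$ and the open segment between the distinct points $x,y$ lies in $\omega$, and $K(x,y)=0$ otherwise: this is the transition density, with respect to $\nu^\omega$, of the Knudsen random walk (cosine reflection law). Let $$b(\omega,u)=\int_{\partial\omega}(x\cdot e)^2K\big((0,u),x\big)\,d\nu^\omega(x)\in[0,\infty]$$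 be the second moment of the horizontal component of the first jump from $(0,u)$, and $$\langle b\rangle_{\mathbb Q}=\frac1{\mathcal Z}\int_\Omega d\mathbb P(\omega)\int\kappa_{(0,u)}^{-1}\,b(\omega,u)\,d\mu_0^\omega(u),\qquad \mathcal Z=\int_\Omega d\mathbb P(\omega)\int\kappa_{(0,u)}^{-1}\,d\mu_0^\omega(u).$$ **Proposition.** Suppose that there is a nonrandom nondegenerate interval $S\subset\Lambda$ (that is, with more than one point) such that $\mathbb R\times S\subset\omega$ for $\mathbb P$-almost every $\omega$. Then $\langle b\rangle_{\mathbb Q}=\infty$. -/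

import Mathlib

open MeasureTheory Set Filter Topology
open scoped ENNReal NNReal RealInnerProductSpace symmDiff

noncomputable section

namespace RandomTube

/-- The Euclidean plane. Coordinate `0` is the horizontal one (along the tube), coordinate `1`
the transverse one. -/
abbrev Plane : Type := EuclideanSpace ℝ (Fin 2)

/-- The point `(α, u)`. -/
def pt (α u : ℝ) : Plane := !₂[α, u]

/-- The first coordinate vector. -/
def e : Plane := pt 1 0

/-- The orthogonal projection of the plane onto the subspace perpendicular to `e`. -/
def transProj (x : Plane) : Plane := pt 0 (x 1)

/-- The set of admissible transverse coordinates. -/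
def Lam (M : ℝ) : Set ℝ := {u | ‖u‖ ≤ M}

/-! ### Lipschitz and continuously differentiable boundaries -/

/-- After the affine isometry `I`, which sends `x` to the origin, the set `A` is near `x` (within
distance `ε`) the part of the plane strictly above the graph of `f`. -/
def IsLocalEpigraph (A : Set Plane) (x : Plane) (ε : ℝ) (I : Plane ≃ᵃⁱ[ℝ] Plane)
    (f : ℝ → ℝ) : Prop :=
  I x = 0 ∧ f 0 = 0 ∧
    I '' (A ∩ Metric.ball x ε) = {z | z ∈ Metric.ball (0 : Plane) ε ∧ f (z 0) < z 1}

/-- The boundary of the planar set `A` is `(ε, L)`-Lipschitz. -/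
def HasLipschitzBoundary (ε : ℝ) (L : ℝ≥0) (A : Set Plane) : Prop :=
  ∀ x ∈ frontier A, ∃ (I : Plane ≃ᵃⁱ[ℝ] Plane) (f : ℝ → ℝ),
    LipschitzWith L f ∧ IsLocalEpigraph A x ε I f

/-- The boundary of `A` is continuously differentiable in `x`: near `x` the set `A` is the
region above the graph of a function which is `C¹` near the base point. -/
def HasC1BoundaryAt (A : Set Plane) (x : Plane) : Prop :=
  ∃ (ε : ℝ) (I : Plane ≃ᵃⁱ[ℝ] Plane) (f : ℝ → ℝ),
    0 < ε ∧ ContDiffAt ℝ 1 f 0 ∧ IsLocalEpigraph A x ε I f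

/-- `n` is the unit normal of `∂A` at `x`, pointing into `A`: seen from `x`, and up to an
arbitrarily small angle, `A` is near `x` the half-plane in the direction `n`. There is at most
one such `n` for given `A` and `x`; where `A` is locally the region above the graph of a
differentiable function, it is the usual normal of the graph. -/
def IsInnerNormal (A : Set Plane) (x n : Plane) : Prop :=
  ‖n‖ = 1 ∧ ∀ c > 0, ∀ᶠ y in 𝓝 x,
    (c * ‖y - x‖ < ⟪y - x, n⟫ → y ∈ A) ∧ (⟪y - x, n⟫ < -(c * ‖y - x‖) → y ∉ A)

open Classical in
/-- The inner unit normal of `∂A` at `x` (the zero vector where there is none). -/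
def normal (A : Set Plane) (x : Plane) : Plane :=
  if h : ∃ n, IsInnerNormal A x n then h.choose else 0

/-! ### Sections, environments, tubes -/

/-- The space of admissible sections: open subsets of `Lam M` for which, for some `n ≥ 1`, any
two distinct boundary points are at distance larger than `1 / n`. -/
structure Sec (M : ℝ) where
  carrier : Set ℝ
  isOpen : IsOpen carrier
  subset : carrier ⊆ Lam M
  lipschitz : ∃ n : ℕ, 1 ≤ n ∧ (frontier carrier).Pairwise fun u v => 1 / (n : ℝ) < dist u v

theorem Sec.volume_ne_top {M : ℝ} (A : Sec M) : volume A.carrier ≠ ∞ := by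
  refine ne_top_of_le_ne_top ?_ (measure_mono (A.subset.trans
    (fun u hu => abs_le.1 hu : Lam M ⊆ Icc (-M) M)))
  exact isCompact_Icc.measure_ne_top

/-- The distance of two sections is the length of their symmetric difference. -/
instance (M : ℝ) : PseudoMetricSpace (Sec M) where
  dist A B := volume.real (A.carrier ∆ B.carrier)
  dist_self A := by simp
  dist_comm A B := by rw [symmDiff_comm]
  dist_triangle A B C :=
    (measureReal_symmDiff_le C.carrier A.volume_ne_top B.volume_ne_top)

instance (M : ℝ) : MeasurableSpace (Sec M) := borel _

instance (M : ℝ) : BorelSpace (Sec M) := ⟨rfl⟩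

/-- The planar set with sections `A α`. -/
def tubeOf {M : ℝ} (A : ℝ → Sec M) : Set Plane := {x | x 1 ∈ (A (x 0)).carrier}

/-- The space of environments: continuous paths `α ↦ ω_α` of sections.

The distance of two sections that differ by finitely many points is zero, so a path is given by
its class modulo such changes; it is represented here by the path whose tube is a regular open
set (the interior of its closure). There is at most one such path in each class, and it is the
relevant one, because an open set with Lipschitz boundary is regular open. -/
structure Env (M : ℝ) where
  sec : ℝ → Sec M
  continuous_sec : Continuous sec
  regular : interior (closure (tubeOf sec)) = tubeOf sec

/-- The sigma-algebra generated by the cylinder sets. -/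
instance (M : ℝ) : MeasurableSpace (Env M) :=
  ⨆ α : ℝ, MeasurableSpace.comap (fun ω : Env M => ω.sec α) inferInstance

namespace Env

variable {M : ℝ}

/-- The section `ω_α`. -/
def slice (ω : Env M) (α : ℝ) : Set ℝ := (ω.sec α).carrier

/-- The tube `ω = {(α, u) : u ∈ ω_α}`. -/
def tube (ω : Env M) : Set Plane := {x | x 1 ∈ ω.slice (x 0)}

end Env

theorem tubeOf_shift {M : ℝ} (A : ℝ → Sec M) (a : ℝ) :
    tubeOf (fun α => A (α + a)) = Homeomorph.addRight (pt a 0) ⁻¹' tubeOf A := by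
  ext x
  simp [tubeOf, pt]

/-- The spatial shift `θ_a`, `(θ_a ω)_α = ω_{α + a}`. -/
def shift {M : ℝ} (a : ℝ) (ω : Env M) : Env M where
  sec α := ω.sec (α + a)
  continuous_sec := ω.continuous_sec.comp (continuous_id.add continuous_const)
  regular := by
    rw [tubeOf_shift, ← Homeomorph.preimage_closure, ← Homeomorph.preimage_interior, ω.regular]

/-- The law of the environment is stationary with respect to the shifts. -/
def IsStationary {M : ℝ} (P : Measure (Env M)) : Prop :=
  ∀ a : ℝ, MeasurePreserving (shift a) P P

/-- Events that are invariant under all shifts have probability zero or one. -/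
def IsShiftErgodic {M : ℝ} (P : Measure (Env M)) : Prop :=
  ∀ s : Set (Env M), MeasurableSet s → (∀ a : ℝ, shift a ⁻¹' s = s) → P s = 0 ∨ P sᶜ = 0

/-! ### The geometry of a tube -/

section Geometry

variable {M : ℝ} (ω : Env M)

/-- The measure `μ^ω_α`: the zero-dimensional Hausdorff (that is, counting) measure on
`∂ω_α`. -/
def sectionMeasure (α : ℝ) : Measure ℝ := Measure.count.restrict (frontier (ω.slice α))

/-- The measure `ν^ω`: the one-dimensional Hausdorff measure on `∂ω`. -/
def boundaryMeasure : Measure Plane :=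
  (Measure.hausdorffMeasure 1).restrict (frontier ω.tube)

/-- The inner normal of the section, as a vector of the plane: the normalized projection of the
inner normal of the tube. -/
def sectionNormal (x : Plane) : Plane :=
  ‖transProj (normal ω.tube x)‖⁻¹ • transProj (normal ω.tube x)

/-- The cosine `κ_x` of the angle between the normal of the tube and that of the section. -/
def kappa (x : Plane) : ℝ := ⟪normal ω.tube x, sectionNormal ω x⟫

/-- The set of regular boundary points. -/
def regularPoints : Set Plane :=
  {x | x ∈ frontier ω.tube ∧ HasC1BoundaryAt ω.tube x ∧ |⟪normal ω.tube x, e⟫| ≠ 1}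

/-- `y` is seen from `x` inside the tube. -/
def Seen (x y : Plane) : Prop :=
  ∃ (h : Plane) (t₀ : ℝ), ‖h‖ = 1 ∧ 0 < t₀ ∧ (∀ t ∈ Ioo 0 t₀, x + t • h ∈ ω.tube) ∧
    x + t₀ • h = y

/-- The normalizing constant of the cosine law: the inverse of the integral of `h ↦ h · e` over
the half-circle `{h : ‖h‖ = 1, h · e > 0}`, parametrized by `h = (cos φ, sin φ)`. -/
def gammaTwo : ℝ := (∫ φ in (-(Real.pi / 2))..(Real.pi / 2), ⟪pt (Real.cos φ) (Real.sin φ), e⟫)⁻¹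

open Classical in
/-- The transition density of the Knudsen random walk in the plane. -/
def K (x y : Plane) : ℝ :=
  if x ∈ regularPoints ω ∧ y ∈ regularPoints ω ∧ Seen ω x y then
    gammaTwo * (⟪y - x, normal ω.tube x⟫ * ⟪x - y, normal ω.tube y⟫) / ‖x - y‖ ^ 3
  else 0

/-- The second moment of the horizontal component of the first jump from `(β, u)`. The integrand
is nonnegative and the value may be infinite. -/
def bAt (β u : ℝ) : ℝ≥0∞ :=
  ∫⁻ x, ENNReal.ofReal ((⟪x, e⟫ - β) ^ 2 * K ω (pt β u) x) ∂(boundaryMeasure ω)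

end Geometry

/-- The second moment of the horizontal component of the first jump from `(0, u)`. -/
def b {M : ℝ} (ω : Env M) (u : ℝ) : ℝ≥0∞ := bAt ω 0 u

/-! ### The measure `Q` and the standing conditions -/

section Law

variable {M : ℝ} (P : Measure (Env M))

/-- The normalizing constant `Z`. -/
def Z : ℝ≥0∞ :=
  ∫⁻ ω, ∫⁻ u, ENNReal.ofReal (kappa ω (pt 0 u))⁻¹ ∂(sectionMeasure ω 0) ∂P

/-- The expectation of a nonnegative function of the environment and the boundary point with
respect to `dQ(ω, u) = Z⁻¹ κ⁻¹ dμ^ω_0(u) dP(ω)`. -/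
def expQ (f : Env M → ℝ → ℝ≥0∞) : ℝ≥0∞ :=
  (Z P)⁻¹ *
    ∫⁻ ω, ∫⁻ u, ENNReal.ofReal (kappa ω (pt 0 u))⁻¹ * f ω u ∂(sectionMeasure ω 0) ∂P

/-- The boundary of the tube is almost surely Lipschitz, with nonrandom constants. -/
def ConditionL : Prop :=
  ∃ (ε : ℝ) (L : ℝ≥0), 0 < ε ∧ ∀ᵐ ω ∂P, HasLipschitzBoundary ε L ω.tube

/-- Almost surely, almost every boundary point is regular. -/
def ConditionR : Prop :=
  ∀ᵐ ω ∂P, boundaryMeasure ω (frontier ω.tube \ regularPoints ω) = 0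

end Law

end RandomTube

end

/-! Nearly horizontal jumps make the second moment infinite. A ray of slope s in (0,1) that crosses
the strip from height p to height q covers a horizontal distance of at least (q - p)/s, so its
squared jump is of order s⁻². From a boundary point (0,u) with inner normal n, the cosine law gives
the slopes near s a weight comparable to n·(1,s) ds. It remains to see that the points over the
vertical axis send enough such rays through the strip, and this follows from stationarity.

Fix s and follow the line of slope s through (t,p) backwards until it meets the boundary. By mass
transport, since shifting the environment by t preserves the law, these starting points have mean
density one per unit length of the tube, for every s (`lintegral_startDensity`). Near (0,u) their
density in the abscissa is at most n·(1,s)/(sκ), and (0,u) contributes only if its own ray of slope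
s runs through the strip (`startDensity_le`). The change of variables from boundary points to slopes
bounds b from below (`le_b`), and the factor κ⁻¹ of Q turns the cosine weight into s times the
density of starting points (`lintegral_startDensity_le`). By Tonelli the unnormalized second moment
is at least the integral over (0,1) of C s⁻² · s = C/s, which diverges.

The normalizing constant is finite (`Z_ne_top`): by a coarea inequality, the integral over a unit
interval of abscissas of the sum of κ⁻¹ is at most twice a boundary length, and Lipschitz boundaries
have locally bounded length.

All changes of variables are one-sided inequalities obtained from local Lipschitz constants
(`lintegral_image_le_lintegral`, `volume_image_le_of_dist_le`), so images need not be measurable.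
Regularity of every boundary point over the axis itself is carried over from almost every abscissa
by stationarity. This needs a measurable event, which `SectionFlat` provides through countably many
cone conditions. -/

section AreaInequality

/-! ### One-sided area inequalities for real functions on metric spaces. -/

variable {X : Type*} [MetricSpace X] [MeasurableSpace X] [BorelSpace X]

/-- Countable partitions into Borel sets of small diameter. -/
theorem exists_partition_dist_lt [SecondCountableTopology X] [Nonempty X] {r : ℝ} (hr : 0 < r) :
    ∃ C : ℕ → Set X, (∀ j, MeasurableSet (C j)) ∧ Pairwise (Function.onFun Disjoint C) ∧
      (⋃ j, C j) = univ ∧ ∀ j, ∀ x ∈ C j, ∀ y ∈ C j, dist x y < r := by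
  refine ⟨disjointed fun j => Metric.ball (TopologicalSpace.denseSeq X j) (r / 2),
    fun j => MeasurableSet.disjointed (fun i => measurableSet_ball) j, disjoint_disjointed _, ?_, ?_⟩
  · rw [iUnion_disjointed, eq_univ_iff_forall]
    intro x
    obtain ⟨j, hj⟩ := (TopologicalSpace.denseRange_denseSeq X).exists_dist_lt x (half_pos hr)
    exact mem_iUnion.2 ⟨j, Metric.mem_ball.2 hj⟩
  · intro j x hx y hy
    have h1 := disjointed_subset _ j hx
    have h2 := disjointed_subset _ j hy
    rw [Metric.mem_ball] at h1 h2
    linarith [dist_triangle_right x y (TopologicalSpace.denseSeq X j)]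

theorem volume_image_le_mul_hausdorffMeasure {f : X → ℝ} {s : Set X} {K : ℝ≥0}
    (h : LipschitzOnWith K f s) : volume (f '' s) ≤ K * μH[1] s := by
  have := h.hausdorffMeasure_image_le (d := 1) zero_le_one
  rwa [hausdorffMeasure_real, ENNReal.rpow_one] at this

/-- `Y` is exhausted by the sets `Yn n` on which the local bound holds at scale 1/(n+1), and each is
cut along a Borel partition into pieces that are small and on which J varies by less than η. On such
a piece f is genuinely Lipschitz, with a constant at most J + 2η. Only the partition has to be
measurable, not `Y`. -/
theorem volume_image_le_lintegral_add [SecondCountableTopology X] {f : X → ℝ} {Y : Set X}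
    {J : X → ℝ≥0} (hJ : Measurable J) {η : ℝ≥0} (hη : 0 < η)
    (h : ∀ y ∈ Y, ∀ᶠ y' in 𝓝[Y] y, dist (f y') (f y) ≤ (J y + η) * dist y' y) :
    volume (f '' Y) ≤ ∫⁻ y in Y, (J y + 2 * η : ℝ≥0) ∂μH[1] := by
  rcases isEmpty_or_nonempty X with hX | hX
  · simp [Subsingleton.elim Y ∅]
  set Yn : ℕ → Set X := fun n => {y ∈ Y | ∀ y' ∈ Y, dist y' y < 1 / ((n : ℝ) + 1) →
    dist (f y') (f y) ≤ (J y + η) * dist y' y} with hYn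
  have hmono : Monotone Yn := by
    intro n m hnm y hy
    refine ⟨hy.1, fun y' hy' hd => hy.2 y' hy' (hd.trans_le ?_)⟩
    gcongr
  have hunion : Y = ⋃ n, Yn n := by
    refine Subset.antisymm (fun y hy => ?_) (iUnion_subset fun n y hy => hy.1)
    obtain ⟨r, hr, hr'⟩ := Metric.mem_nhdsWithin_iff.1 (h y hy)
    obtain ⟨n, hn⟩ := exists_nat_one_div_lt hr
    exact mem_iUnion.2 ⟨n, hy, fun y' hy' hd => hr' ⟨Metric.mem_ball.2 (hd.trans hn), hy'⟩⟩
  conv_lhs => rw [hunion, image_iUnion]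
  rw [Monotone.measure_iUnion (fun n m hnm => image_mono (hmono hnm))]
  refine iSup_le fun n => ?_
  obtain ⟨C, hCm, hCd, hCu, hC⟩ := exists_partition_dist_lt (X := X)
    (r := 1 / ((n : ℝ) + 1)) (by positivity)
  set Q : ℕ × ℕ → Set X := fun i => C i.1 ∩ {y | ⌊J y / η⌋₊ = i.2} with hQ
  have hQm : ∀ i, MeasurableSet (Q i) := fun i =>
    (hCm i.1).inter ((Nat.measurable_floor.comp (hJ.div_const η)) (measurableSet_singleton i.2))
  have hQd : Pairwise (Function.onFun Disjoint Q) := by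
    rintro ⟨j, k⟩ ⟨j', k'⟩ hne
    rw [Function.onFun, Set.disjoint_left]
    rintro y ⟨h1, h2⟩ ⟨h3, h4⟩
    simp only [mem_ofPred_eq] at h2 h4
    have hk : k = k' := h2.symm.trans h4
    by_cases hj : j = j'
    · exact hne (by rw [hj, hk])
    · exact Set.disjoint_left.1 (hCd hj) h1 h3
  have hQu : (⋃ i, Q i) = univ := by
    refine eq_univ_of_forall fun y => ?_
    obtain ⟨j, hj⟩ := mem_iUnion.1 (hCu ▸ mem_univ y : y ∈ ⋃ j, C j)
    exact mem_iUnion.2 ⟨(j, ⌊J y / η⌋₊), hj, rfl⟩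
  have hpiece : ∀ i, volume (f '' (Yn n ∩ Q i)) ≤
      ∫⁻ y in Q i, (J y + 2 * η : ℝ≥0) ∂(μH[1].restrict Y) := by
    intro i
    -- With k = ⌊J/η⌋, the local constant J + η is below (k + 2)η, which in turn is at most J + 2η.
    have hlip : LipschitzOnWith ((i.2 + 2) * η) f (Yn n ∩ Q i) := by
      refine LipschitzOnWith.of_dist_le_mul fun x hx y hy => ?_
      have h1 := hy.1.2 x hx.1.1 (hC i.1 x hx.2.1 y hy.2.1)
      refine h1.trans (mul_le_mul_of_nonneg_right ?_ dist_nonneg)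
      have h2 : J y / η < i.2 + 1 := by
        rw [← (hy.2.2 : ⌊J y / η⌋₊ = i.2)]; exact Nat.lt_floor_add_one _
      rw [div_lt_iff₀ hη] at h2
      have h3 : (J y : ℝ) < (i.2 + 1) * η := by exact_mod_cast h2
      push_cast
      linarith
    refine (volume_image_le_mul_hausdorffMeasure hlip).trans ?_
    calc (((i.2 + 2) * η : ℝ≥0) : ℝ≥0∞) * μH[1] (Yn n ∩ Q i)
        ≤ (((i.2 + 2) * η : ℝ≥0) : ℝ≥0∞) * (μH[1].restrict Y) (Q i) := by
          refine mul_le_mul_right ?_ _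
          rw [Measure.restrict_apply (hQm i), inter_comm]
          exact measure_mono (inter_subset_inter_right _ fun y hy => hy.1)
      _ = ∫⁻ y in Q i, ((i.2 + 2) * η : ℝ≥0) ∂(μH[1].restrict Y) := by
          rw [setLIntegral_const]
      _ ≤ _ := by
          refine setLIntegral_mono' (hQm i) fun y hy => ?_
          have h2 : (i.2 : ℝ≥0) ≤ J y / η := by
            rw [← (hy.2 : ⌊J y / η⌋₊ = i.2)]; exact Nat.floor_le zero_le
          rw [le_div_iff₀ hη] at h2
          rw [add_mul]
          exact ENNReal.coe_le_coe.2 (add_le_add_left h2 _)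
  calc volume (f '' Yn n) = volume (⋃ i, f '' (Yn n ∩ Q i)) := by
        rw [← image_iUnion, ← inter_iUnion, hQu, inter_univ]
    _ ≤ ∑' i, volume (f '' (Yn n ∩ Q i)) := measure_iUnion_le _
    _ ≤ ∑' i, ∫⁻ y in Q i, (J y + 2 * η : ℝ≥0) ∂(μH[1].restrict Y) := ENNReal.tsum_le_tsum hpiece
    _ = _ := by rw [← lintegral_iUnion hQm hQd, hQu, Measure.restrict_univ]

/-- The length of the image of `Y` under a real function is at most the integral over `Y` of a
local Lipschitz constant. -/
theorem volume_image_le_lintegral [SecondCountableTopology X] {f : X → ℝ} {Y : Set X}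
    [SigmaFinite (μH[1].restrict Y : Measure X)]
    {J : X → ℝ≥0} (hJ : Measurable J)
    (h : ∀ y ∈ Y, ∀ η : ℝ, 0 < η → ∀ᶠ y' in 𝓝[Y] y, dist (f y') (f y) ≤ (J y + η) * dist y' y) :
    volume (f '' Y) ≤ ∫⁻ y in Y, J y ∂μH[1] := by
  have hfin : ∀ D : Set X, MeasurableSet D → (μH[1].restrict Y) D ≠ ∞ →
      volume (f '' (Y ∩ D)) ≤ ∫⁻ y in D, J y ∂(μH[1].restrict Y) := by
    intro D hD hDfin
    have hrw : (μH[1].restrict Y).restrict D = (μH[1] : Measure X).restrict (Y ∩ D) := by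
      rw [Measure.restrict_restrict hD, inter_comm]
    rw [hrw]
    refine ENNReal.le_of_forall_pos_le_add fun ε hε _ => ?_
    set m := (μH[1].restrict Y) D
    -- On a piece of mass m the error term is 2ηm, which this choice keeps below ε.
    set η : ℝ≥0 := ε / (2 * (m.toNNReal + 1)) with hη
    have hηpos : 0 < η := by positivity
    have hYD : ∀ y ∈ Y ∩ D, ∀ᶠ y' in 𝓝[Y ∩ D] y,
        dist (f y') (f y) ≤ (J y + η) * dist y' y := fun y hy =>
      (h y hy.1 η (by exact_mod_cast hηpos)).filter_mono (nhdsWithin_mono _ inter_subset_left)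
    refine (volume_image_le_lintegral_add hJ hηpos hYD).trans ?_
    simp only [ENNReal.coe_add]
    rw [lintegral_add_right _ measurable_const, lintegral_const, ← hrw,
      Measure.restrict_apply_univ]
    gcongr
    change ((2 * η : ℝ≥0) : ℝ≥0∞) * m ≤ ε
    rw [← ENNReal.coe_toNNReal hDfin]
    norm_cast
    rw [hη]
    have : (0 : ℝ≥0) < m.toNNReal + 1 := by positivity
    calc 2 * (ε / (2 * (m.toNNReal + 1))) * m.toNNReal
        ≤ 2 * (ε / (2 * (m.toNNReal + 1))) * (m.toNNReal + 1) := by gcongr; simp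
      _ = ε := by field_simp
  set μ := (μH[1] : Measure X).restrict Y with hμ
  set D := disjointed (spanningSets μ)
  have hDm : ∀ i, MeasurableSet (D i) := fun i =>
    MeasurableSet.disjointed (fun j => measurableSet_spanningSets μ j) i
  have hDu : ⋃ i, D i = univ := by rw [iUnion_disjointed, iUnion_spanningSets]
  calc volume (f '' Y) = volume (⋃ i, f '' (Y ∩ D i)) := by
        rw [← image_iUnion, ← inter_iUnion, hDu, inter_univ]
    _ ≤ ∑' i, volume (f '' (Y ∩ D i)) := measure_iUnion_le _
    _ ≤ ∑' i, ∫⁻ y in D i, J y ∂μ := ENNReal.tsum_le_tsum fun i => hfin _ (hDm i)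
        ((measure_mono (disjointed_subset _ i)).trans_lt (measure_spanningSets_lt_top μ i)).ne
    _ = _ := by
        rw [← lintegral_iUnion hDm (disjoint_disjointed _), hDu, Measure.restrict_univ]

/-- The weighted form of `volume_image_le_lintegral`. -/
theorem lintegral_image_le_lintegral [SecondCountableTopology X] {f : X → ℝ} (hf : Measurable f)
    {Y : Set X} [SigmaFinite (μH[1].restrict Y : Measure X)]
    {J : X → ℝ≥0} (hJ : Measurable J)
    (h : ∀ y ∈ Y, ∀ η : ℝ, 0 < η → ∀ᶠ y' in 𝓝[Y] y, dist (f y') (f y) ≤ (J y + η) * dist y' y)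
    {G : ℝ → ℝ≥0∞} (hG : Measurable G) :
    ∫⁻ s in f '' Y, G s ≤ ∫⁻ y in Y, J y * G (f y) ∂μH[1] := by
  -- The unweighted bound, applied to the part of `Y` over an arbitrary Borel set, is an inequality
  -- between measures, against which any weight can be integrated.
  have hle : volume.restrict (f '' Y) ≤
      ((μH[1].restrict Y).withDensity fun y => (J y : ℝ≥0∞)).map f := by
    refine Measure.le_iff.2 fun B hB => ?_
    rw [Measure.restrict_apply hB, Measure.map_apply hf hB, withDensity_apply _ (hf hB),
      Measure.restrict_restrict (hf hB)]
    have : B ∩ f '' Y = f '' (f ⁻¹' B ∩ Y) := by rw [image_preimage_inter]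
    rw [this]
    have : SigmaFinite ((μH[1] : Measure X).restrict (f ⁻¹' B ∩ Y)) := by
      rw [← Measure.restrict_restrict (hf hB)]; infer_instance
    exact volume_image_le_lintegral hJ fun y hy η hη =>
      (h y hy.2 η hη).filter_mono (nhdsWithin_mono _ inter_subset_right)
  calc ∫⁻ s in f '' Y, G s ≤ ∫⁻ s, G s ∂(((μH[1].restrict Y).withDensity
        fun y => (J y : ℝ≥0∞)).map f) := lintegral_mono' hle le_rfl
    _ = _ := by
      rw [lintegral_map hG hf]
      exact lintegral_withDensity_eq_lintegral_mul _ hJ.coe_nnreal_ennreal (hG.comp hf)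

end AreaInequality

/-- If `f` varies on `E` at most `C` times as much as `g`, then the length of `f '' E` is at most
`C` times that of `g '' E`. -/
theorem volume_image_le_of_dist_le {X : Type*} {f g : X → ℝ} {E : Set X} {C : ℝ≥0}
    (h : ∀ x ∈ E, ∀ y ∈ E, |f x - f y| ≤ C * |g x - g y|) :
    volume (f '' E) ≤ C * volume (g '' E) := by
  rcases E.eq_empty_or_nonempty with rfl | ⟨x₀, hx₀⟩
  · simp
  have : Nonempty X := ⟨x₀⟩
  -- On `E` the hypothesis makes f a function φ of g, since equal values of g force equal values of
  -- f; so the choice of preimage is immaterial and φ is C-Lipschitz.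
  set φ : ℝ → ℝ := fun v => f (Function.invFunOn g E v)
  have hinv : ∀ x ∈ E, Function.invFunOn g E (g x) ∈ E ∧ g (Function.invFunOn g E (g x)) = g x :=
    fun x hx => ⟨Function.invFunOn_mem ⟨x, hx, rfl⟩, Function.invFunOn_eq ⟨x, hx, rfl⟩⟩
  have hφ : ∀ x ∈ E, φ (g x) = f x := by
    intro x hx
    have := h _ (hinv x hx).1 x hx
    rw [(hinv x hx).2, sub_self, abs_zero, mul_zero] at this
    exact sub_eq_zero.1 (abs_eq_zero.1 (le_antisymm this (abs_nonneg _)))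
  have himg : f '' E = φ '' (g '' E) := by
    rw [image_image]; exact image_congr fun x hx => (hφ x hx).symm
  have hlip : LipschitzOnWith C φ (g '' E) := by
    refine LipschitzOnWith.of_dist_le_mul ?_
    rintro _ ⟨x, hx, rfl⟩ _ ⟨y, hy, rfl⟩
    rw [hφ x hx, hφ y hy, Real.dist_eq, Real.dist_eq]
    exact h x hx y hy
  rw [himg]
  have := volume_image_le_mul_hausdorffMeasure hlip
  rwa [hausdorffMeasure_real] at this

/-- Images of locally null sets are null. -/
theorem volume_image_eq_zero_of_locally {X : Type*} [TopologicalSpace X]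
    [SecondCountableTopology X] {f : X → ℝ} {E : Set X}
    (h : ∀ x ∈ E, ∃ U ∈ 𝓝 x, volume (f '' (E ∩ U)) = 0) : volume (f '' E) = 0 := by
  have := measure_null_of_locally_null (μ := OuterMeasure.comap f volume.toOuterMeasure) E
    fun x hx => by
      obtain ⟨U, hU, hU0⟩ := h x hx
      refine ⟨E ∩ U, inter_mem self_mem_nhdsWithin (mem_nhdsWithin_of_mem_nhds hU), ?_⟩
      simpa using hU0
  simpa using this

namespace RandomTube

/-! ### Coordinates of the plane -/

@[simp] theorem pt_zero (a u : ℝ) : pt a u 0 = a := rfl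

@[simp] theorem pt_one (a u : ℝ) : pt a u 1 = u := rfl

theorem plane_ext {x y : Plane} (h0 : x 0 = y 0) (h1 : x 1 = y 1) : x = y := by
  ext i; fin_cases i <;> assumption

theorem inner_eq (x y : Plane) : ⟪x, y⟫ = x 0 * y 0 + x 1 * y 1 := by
  simp [PiLp.inner_apply, Fin.sum_univ_two, mul_comm]

theorem norm_sq_eq (x : Plane) : ‖x‖ ^ 2 = x 0 ^ 2 + x 1 ^ 2 := by
  simp [EuclideanSpace.norm_sq_eq, Fin.sum_univ_two]

theorem abs_zero_le_norm (x : Plane) : |x 0| ≤ ‖x‖ :=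
  abs_le_of_sq_le_sq (by rw [norm_sq_eq]; nlinarith [sq_nonneg (x 1)]) (norm_nonneg x)

theorem abs_one_le_norm (x : Plane) : |x 1| ≤ ‖x‖ :=
  abs_le_of_sq_le_sq (by rw [norm_sq_eq]; nlinarith [sq_nonneg (x 0)]) (norm_nonneg x)

theorem norm_le_abs_add_abs (x : Plane) : ‖x‖ ≤ |x 0| + |x 1| := by
  refine le_of_sq_le_sq ?_ (by positivity)
  rw [norm_sq_eq]
  nlinarith [abs_nonneg (x 0), abs_nonneg (x 1), sq_abs (x 0), sq_abs (x 1),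
    mul_nonneg (abs_nonneg (x 0)) (abs_nonneg (x 1))]

theorem inner_e (x : Plane) : ⟪x, e⟫ = x 0 := by simp [inner_eq, e]

/-! ### Local epigraphs -/

theorem map_sub_eq (I : Plane ≃ᵃⁱ[ℝ] Plane) (y z : Plane) :
    I y - I z = I.linearIsometryEquiv (y - z) := by
  simpa [vsub_eq_sub] using (I.map_vsub y z).symm

theorem inner_symm_eq (I : Plane ≃ᵃⁱ[ℝ] Plane) (y z m : Plane) :
    ⟪y - z, I.linearIsometryEquiv.symm m⟫ = ⟪I y - I z, m⟫ := by
  rw [map_sub_eq, ← I.linearIsometryEquiv.inner_map_map, LinearIsometryEquiv.apply_symm_apply]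

theorem norm_map_sub (I : Plane ≃ᵃⁱ[ℝ] Plane) (y z : Plane) : ‖I y - I z‖ = ‖y - z‖ := by
  rw [map_sub_eq, LinearIsometryEquiv.norm_map]

variable {A : Set Plane} {x : Plane} {ε : ℝ} {I : Plane ≃ᵃⁱ[ℝ] Plane} {f : ℝ → ℝ}

theorem IsLocalEpigraph.mem_iff (h : IsLocalEpigraph A x ε I f) {y : Plane}
    (hy : y ∈ Metric.ball x ε) : y ∈ A ↔ f (I y 0) < I y 1 := by
  constructor
  · intro hyA
    have : I y ∈ I '' (A ∩ Metric.ball x ε) := ⟨y, ⟨hyA, hy⟩, rfl⟩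
    rw [h.2.2] at this
    exact this.2
  · intro hf
    have : I y ∈ I '' (A ∩ Metric.ball x ε) := by
      rw [h.2.2]
      refine ⟨?_, hf⟩
      rw [mem_ball_iff_norm, ← h.1, norm_map_sub]
      exact mem_ball_iff_norm.1 hy
    obtain ⟨y', hy', he⟩ := this
    exact I.injective he ▸ hy'.1

theorem IsLocalEpigraph.mem_frontier (h : IsLocalEpigraph A x ε I f) {y : Plane}
    (hy : y ∈ Metric.ball x ε) (hf : f (I y 0) = I y 1) : y ∈ frontier A := by
  have hyA : y ∉ A := fun hA => ((h.mem_iff hy).1 hA).ne hf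
  refine ⟨?_, fun hi => hyA (interior_subset hi)⟩
  set v : Plane := I.linearIsometryEquiv.symm (pt 0 1)
  have hcont : Tendsto (fun t : ℝ => y + t • v) (𝓝[>] 0) (𝓝 y) := by
    have : Continuous fun t : ℝ => y + t • v := by fun_prop
    simpa using (this.tendsto 0).mono_left nhdsWithin_le_nhds
  refine mem_closure_of_tendsto hcont ?_
  filter_upwards [hcont.eventually (Metric.isOpen_ball.mem_nhds hy), self_mem_nhdsWithin]
    with t ht ht0
  have hI : I (y + t • v) = I y + t • pt 0 1 := by
    have := map_sub_eq I (y + t • v) y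
    rw [add_sub_cancel_left, map_smul, LinearIsometryEquiv.apply_symm_apply] at this
    rw [← this, add_sub_cancel]
  rw [h.mem_iff ht, hI]
  simp [hf, mem_Ioi.1 ht0]

theorem IsLocalEpigraph.base_mem_frontier (h : IsLocalEpigraph A x ε I f) (hε : 0 < ε) :
    x ∈ frontier A :=
  h.mem_frontier (Metric.mem_ball_self hε) (by simp [h.1, h.2.1])

theorem IsLocalEpigraph.eq_of_mem_frontier (h : IsLocalEpigraph A x ε I f) (hA : IsOpen A)
    {y : Plane} (hy : y ∈ Metric.ball x ε) (hc : ContinuousAt f (I y 0)) (hyA : y ∈ frontier A) :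
    f (I y 0) = I y 1 := by
  rw [hA.frontier_eq] at hyA
  have h1 : I y 1 ≤ f (I y 0) := not_lt.1 fun hlt => hyA.2 ((h.mem_iff hy).2 hlt)
  refine le_antisymm (not_lt.1 fun hlt => ?_) h1
  have hI : Continuous fun z => I z := I.continuous
  have hev : ∀ᶠ z in 𝓝 y, I z 1 < f (I z 0) := by
    have h0 : Continuous fun z => I z 0 := by fun_prop
    have h1 : Continuous fun z => I z 1 := by fun_prop
    exact (h1.tendsto y).eventually_lt (hc.comp_of_eq h0.continuousAt rfl) hlt
  obtain ⟨z, hzA, hz⟩ := ((mem_closure_iff_frequently.1 hyA.1).and_eventually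
    (hev.and (Metric.isOpen_ball.mem_nhds hy))).exists
  exact absurd ((h.mem_iff hz.2).1 hzA) (not_lt.2 hz.1.le)

/-! ### Cones -/

/-- Within the ball of radius `δ` around `q` and among points of `D`, the set `A` contains with
every point the part of the cone with axis `n` and (cosine) aperture `c`. -/
def ConeOn (D A : Set Plane) (q : Plane) (δ : ℝ) (n : Plane) (c : ℝ) : Prop :=
  ∀ y ∈ D, ∀ z ∈ D, y ∈ Metric.ball q δ → z ∈ Metric.ball q δ →
    c * ‖y - z‖ < ⟪y - z, n⟫ → z ∈ A → y ∈ A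

theorem ConeOn.mono {D D' A : Set Plane} {q q' n n' : Plane} {δ δ' c c' : ℝ}
    (h : ConeOn D A q δ n c) (hD : D' ⊆ D) (hq : Metric.ball q' δ' ⊆ Metric.ball q δ)
    (hn : ‖n' - n‖ ≤ c' - c) : ConeOn D' A q' δ' n' c' := by
  intro y hy z hz hyq hzq hlt
  refine h y (hD hy) z (hD hz) (hq hyq) (hq hzq) ?_
  have h1 : ⟪y - z, n'⟫ = ⟪y - z, n⟫ + ⟪y - z, n' - n⟫ := by rw [← inner_add_right]; simp
  have h2 := real_inner_le_norm (y - z) (n' - n)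
  nlinarith [norm_nonneg (y - z), mul_le_mul_of_nonneg_left hn (norm_nonneg (y - z))]

/-- Otherwise z can be moved to a point w of A in D with y still in the open cone at w. Then the
points of D near y lie in A, a neighbourhood of y lies in the closure of A, and regular openness
puts y into A. Testing on a dense D is therefore enough. -/
theorem ConeOn.inner_le {D A : Set Plane} {q n : Plane} {δ c : ℝ} (h : ConeOn D A q δ n c)
    (hA : IsOpen A) (hreg : interior (closure A) = A) (hD : Dense D) {y z : Plane}
    (hy : y ∈ frontier A) (hz : z ∈ frontier A) (hyq : y ∈ Metric.ball q δ)
    (hzq : z ∈ Metric.ball q δ) : ⟪y - z, n⟫ ≤ c * ‖y - z‖ := by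
  by_contra! hlt
  rw [hA.frontier_eq] at hy hz
  have hopen : IsOpen {w | c * ‖y - w‖ < ⟪y - w, n⟫} := isOpen_lt (by fun_prop) (by fun_prop)
  obtain ⟨w, ⟨⟨hw1, hw2⟩, hwA⟩, hwD⟩ := hD.inter_open_nonempty
    ({w | c * ‖y - w‖ < ⟪y - w, n⟫} ∩ Metric.ball q δ ∩ A)
    ((hopen.inter Metric.isOpen_ball).inter hA)
    (mem_closure_iff.1 hz.1 _ (hopen.inter Metric.isOpen_ball) ⟨hlt, hzq⟩)
  have hopen' : IsOpen ({v | c * ‖v - w‖ < ⟪v - w, n⟫} ∩ Metric.ball q δ) :=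
    (isOpen_lt (by fun_prop) (by fun_prop)).inter Metric.isOpen_ball
  refine hy.2 (hreg ▸ mem_interior.2 ⟨_, ?_, hopen', ⟨hw1, hyq⟩⟩)
  calc _ ⊆ closure (({v | c * ‖v - w‖ < ⟪v - w, n⟫} ∩ Metric.ball q δ) ∩ D) :=
        hD.open_subset_closure_inter hopen'
    _ ⊆ closure A := closure_mono fun v hv => h v hv.2 w hwD hv.1.2 hw2 hv.1.1 hwA

theorem ConeOn.abs_inner_le {D A : Set Plane} {q n : Plane} {δ c : ℝ} (h : ConeOn D A q δ n c)
    (hA : IsOpen A) (hreg : interior (closure A) = A) (hD : Dense D) {y z : Plane}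
    (hy : y ∈ frontier A) (hz : z ∈ frontier A) (hyq : y ∈ Metric.ball q δ)
    (hzq : z ∈ Metric.ball q δ) : |⟪y - z, n⟫| ≤ c * ‖y - z‖ := by
  refine abs_le.2 ⟨?_, h.inner_le hA hreg hD hy hz hyq hzq⟩
  have := h.inner_le hA hreg hD hz hy hzq hyq
  rw [← neg_sub y z, inner_neg_left, norm_neg] at this
  linarith

theorem isInnerNormal_of_cones {n : Plane} (hA : IsOpen A) (hx : x ∈ frontier A) (hn : ‖n‖ = 1)
    (h : ∀ c > 0, ∃ δ > 0, ConeOn univ A x δ n c) : IsInnerNormal A x n := by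
  rw [hA.frontier_eq] at hx
  refine ⟨hn, fun c hc => ?_⟩
  obtain ⟨δ, hδ, hcone⟩ := h c hc
  filter_upwards [Metric.ball_mem_nhds x hδ] with y hy
  constructor
  · intro hlt
    have hopen : IsOpen ({w | c * ‖y - w‖ < ⟪y - w, n⟫} ∩ Metric.ball x δ) :=
      (isOpen_lt (by fun_prop) (by fun_prop)).inter Metric.isOpen_ball
    obtain ⟨z, hz, hzA⟩ := mem_closure_iff.1 hx.1 _ hopen ⟨hlt, Metric.mem_ball_self hδ⟩
    exact hcone y trivial z trivial hy hz.2 hz.1 hzA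
  · intro hlt hyA
    refine hx.2 (hcone x trivial y trivial (Metric.mem_ball_self hδ) hy ?_ hyA)
    rw [← neg_sub y x, inner_neg_left, norm_neg]
    linarith

/-! ### Inner normals -/

theorem IsInnerNormal.eventually_mem {n v : Plane} (h : IsInnerNormal A x n) (hv : 0 < ⟪v, n⟫) :
    ∀ᶠ t in 𝓝[>] (0 : ℝ), x + t • v ∈ A ∧ x - t • v ∉ A := by
  have hv0 : 0 < ‖v‖ := norm_pos_iff.2 (by rintro rfl; simp at hv)
  have hc : 0 < ⟪v, n⟫ / (2 * ‖v‖) := by positivity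
  have h1 : Tendsto (fun t : ℝ => x + t • v) (𝓝[>] 0) (𝓝 x) := by
    have : Continuous fun t : ℝ => x + t • v := by fun_prop
    simpa using (this.tendsto 0).mono_left nhdsWithin_le_nhds
  have h2 : Tendsto (fun t : ℝ => x - t • v) (𝓝[>] 0) (𝓝 x) := by
    have : Continuous fun t : ℝ => x - t • v := by fun_prop
    simpa using (this.tendsto 0).mono_left nhdsWithin_le_nhds
  filter_upwards [h1.eventually (h.2 _ hc), h2.eventually (h.2 _ hc), self_mem_nhdsWithin]
    with t ht1 ht2 ht
  rw [mem_Ioi] at ht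
  have key : ⟪v, n⟫ / (2 * ‖v‖) * (t * ‖v‖) < t * ⟪v, n⟫ := by
    have : ⟪v, n⟫ / (2 * ‖v‖) * (t * ‖v‖) = t * ⟪v, n⟫ / 2 := by field_simp
    rw [this]
    linarith [mul_pos ht hv]
  refine ⟨ht1.1 ?_, ht2.2 ?_⟩
  · rw [add_sub_cancel_left, norm_smul, Real.norm_of_nonneg ht.le, inner_smul_left]
    simpa using key
  · rw [show x - t • v - x = -(t • v) by abel, norm_neg, norm_smul, Real.norm_of_nonneg ht.le,
      inner_neg_left, inner_smul_left]
    simpa using key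

/-- For two different unit normals, the direction n - n' points inwards according to n and outwards
according to n'. -/
theorem IsInnerNormal.unique {n n' : Plane} (h : IsInnerNormal A x n) (h' : IsInnerNormal A x n') :
    n = n' := by
  by_contra hne
  have hpos : 0 < ‖n - n'‖ ^ 2 := by
    have := norm_pos_iff.2 (sub_ne_zero.2 hne); positivity
  have he : ‖n - n'‖ ^ 2 = 2 - 2 * ⟪n, n'⟫ := by
    rw [norm_sub_sq_real, h.1, h'.1]; ring
  have h1 : 0 < ⟪n - n', n⟫ := by
    rw [inner_sub_left, real_inner_self_eq_norm_sq, h.1, real_inner_comm]; linarith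
  have h2 : 0 < ⟪n' - n, n'⟫ := by
    rw [inner_sub_left, real_inner_self_eq_norm_sq, h'.1]; linarith
  obtain ⟨t, ht, ht'⟩ := ((h.eventually_mem h1).and (h'.eventually_mem h2)).exists
  refine ht'.2 ?_
  have : x - t • (n' - n) = x + t • (n - n') := by module
  rw [this]
  exact ht.1

theorem IsInnerNormal.normal_eq {n : Plane} (h : IsInnerNormal A x n) : normal A x = n := by
  have hex : ∃ n, IsInnerNormal A x n := ⟨n, h⟩
  rw [normal, dif_pos hex]
  exact hex.choose_spec.unique h

/-! ### Continuously differentiable functions of one variable -/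

/-- Mean value inequality for f minus its linear part at w, with uniform continuity of the
derivative on a compact ball. The scale δ depends on c but not on w, and ρ does not depend on c; the
countable condition `SectionFlat` relies on this order of quantifiers. -/
theorem exists_uniform_slope_of_contDiffAt {f : ℝ → ℝ} (hf : ContDiffAt ℝ 1 f 0) :
    ∃ (ρ : ℝ) (g : ℝ → ℝ), 0 < ρ ∧ ContinuousAt g 0 ∧
      ∀ c > 0, ∃ δ > 0, ∀ w, |w| < ρ → ∀ a b, |a - w| < δ → |b - w| < δ →
        |f a - f b - g w * (a - b)| ≤ c * |a - b| := by
  obtain ⟨f', u, hu, hcont, hder⟩ := contDiffAt_one_iff.1 hf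
  obtain ⟨ρ, hρ, hρu⟩ := Metric.mem_nhds_iff.1 hu
  have hg : ContinuousOn (fun w => f' w 1) u := hcont.clm_apply continuousOn_const
  have hsub : Metric.closedBall (0 : ℝ) (ρ / 2) ⊆ u :=
    (Metric.closedBall_subset_ball (half_lt_self hρ)).trans hρu
  -- Base points within ρ/4 and increments of at most ρ/4 stay in the compact ball of radius ρ/2.
  refine ⟨ρ / 4, fun w => f' w 1, by positivity, hg.continuousAt hu, fun c hc => ?_⟩
  have huc := (isCompact_closedBall (0 : ℝ) (ρ / 2)).uniformContinuousOn_of_continuous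
    (hg.mono hsub)
  obtain ⟨δ, hδ, hδ'⟩ := Metric.uniformContinuousOn_iff.1 huc c hc
  refine ⟨min δ (ρ / 4), by positivity, fun w hw a b ha hb => ?_⟩
  have hmem : ∀ t ∈ Metric.ball w (min δ (ρ / 4)), t ∈ Metric.closedBall (0 : ℝ) (ρ / 2) := by
    intro t ht
    rw [Metric.mem_ball, Real.dist_eq, lt_min_iff] at ht
    rw [Metric.mem_closedBall, Real.dist_eq, sub_zero]
    have := abs_sub_abs_le_abs_sub t w
    linarith
  have hww : w ∈ Metric.closedBall (0 : ℝ) (ρ / 2) := hmem w (Metric.mem_ball_self (by positivity))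
  have hd : ∀ t ∈ Metric.ball w (min δ (ρ / 4)), HasDerivWithinAt (fun t => f t - f' w 1 * t)
      (f' t 1 - f' w 1) (Metric.ball w (min δ (ρ / 4))) t := by
    intro t ht
    have h1 := (hder t (hsub (hmem t ht))).hasDerivAt
    have h2 := (hasDerivAt_id t).const_mul (f' w 1)
    have h3 := (h1.sub h2).hasDerivWithinAt (s := Metric.ball w (min δ (ρ / 4)))
    rw [mul_one] at h3
    exact h3
  have hbd : ∀ t ∈ Metric.ball w (min δ (ρ / 4)), ‖f' t 1 - f' w 1‖ ≤ c := by
    intro t ht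
    have := hδ' t (hmem t ht) w hww ((Metric.mem_ball.1 ht).trans_le (min_le_left _ _))
    rw [Real.dist_eq] at this
    exact this.le
  have := (convex_ball w (min δ (ρ / 4))).norm_image_sub_le_of_norm_hasDerivWithin_le hd hbd
    (x := b) (y := a) (by rwa [Metric.mem_ball, Real.dist_eq]) (by rwa [Metric.mem_ball, Real.dist_eq])
  simp only [Real.norm_eq_abs] at this
  convert this using 2
  ring

/-- The number m may depend on c and need not be the derivative. Difference quotients close to a
common m form a Cauchy filter, which gives the derivative, and derivatives at nearby points are
close to the same m, hence to each other. -/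
theorem contDiffAt_of_uniform_slope {f : ℝ → ℝ} {r : ℝ} (hr : 0 < r)
    (h : ∀ c > 0, ∃ δ > 0, ∀ z, |z| < r → ∃ m, ∀ a b, |a - z| < δ → |b - z| < δ →
        |f a - f b - m * (a - b)| ≤ c * |a - b|) : ContDiffAt ℝ 1 f 0 := by
  have hslope : ∀ c > 0, ∃ δ > 0, ∀ z, |z| < r → ∃ m, ∀ a b, |a - z| < δ → |b - z| < δ →
      a ≠ b → |slope f b a - m| ≤ c := by
    intro c hc
    obtain ⟨δ, hδ, h'⟩ := h c hc
    refine ⟨δ, hδ, fun z hz => (h' z hz).imp fun m hm a b ha hb hab => ?_⟩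
    have hpos : 0 < |a - b| := abs_pos.2 (sub_ne_zero.2 hab)
    have := hm a b ha hb
    rw [slope_def_field, ← mul_le_mul_iff_left₀ hpos, ← abs_mul, sub_mul,
      div_mul_cancel₀ _ (sub_ne_zero.2 hab)]
    exact this
  have hex : ∀ z, |z| < r → ∃ d, HasDerivAt f d z := by
    intro z hz
    have : Cauchy (map (slope f z) (𝓝[≠] z)) := by
      refine Metric.cauchy_iff.2 ⟨inferInstance, fun η hη => ?_⟩
      obtain ⟨δ, hδ, h'⟩ := hslope (η / 3) (by positivity)
      obtain ⟨m, hm⟩ := h' z hz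
      refine ⟨Metric.closedBall m (η / 3), ?_, ?_⟩
      · rw [mem_map]
        filter_upwards [mem_nhdsWithin_of_mem_nhds (Metric.ball_mem_nhds z hδ),
          self_mem_nhdsWithin] with a ha hne
        rw [mem_preimage, Metric.mem_closedBall, Real.dist_eq]
        exact hm a z (by rwa [Metric.mem_ball, Real.dist_eq] at ha) (by simpa using hδ) hne
      · intro a ha b hb
        rw [Metric.mem_closedBall] at ha hb
        linarith [dist_triangle_right a b m]
    obtain ⟨d, hd⟩ := cauchy_map_iff_exists_tendsto.1 this
    exact ⟨d, hasDerivAt_iff_tendsto_slope.2 hd⟩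
  choose! d hd using hex
  have hcont : ContinuousOn d (Metric.ball 0 r) := by
    intro z hz
    refine ContinuousAt.continuousWithinAt (Metric.continuousAt_iff.2 fun η hη => ?_)
    rw [Metric.mem_ball, Real.dist_eq, sub_zero] at hz
    obtain ⟨δ, hδ, h'⟩ := hslope (η / 3) (by positivity)
    obtain ⟨m, hm⟩ := h' z hz
    have hclose : ∀ w, |w| < r → |w - z| < δ → |d w - m| ≤ η / 3 := by
      intro w hw hwz
      have ht := (hasDerivAt_iff_tendsto_slope.1 (hd w hw)).sub_const m |>.abs
      refine le_of_tendsto ht ?_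
      have hb : Metric.ball z δ ∈ 𝓝 w :=
        Metric.isOpen_ball.mem_nhds (by rwa [Metric.mem_ball, Real.dist_eq])
      filter_upwards [mem_nhdsWithin_of_mem_nhds hb, self_mem_nhdsWithin] with a ha hne
      exact hm a w (by rwa [Metric.mem_ball, Real.dist_eq] at ha) hwz hne
    refine ⟨min δ (r - |z|), lt_min hδ (by linarith), fun {w} hw => ?_⟩
    rw [Real.dist_eq, lt_min_iff] at hw
    have h1 := hclose w (by have := abs_sub_abs_le_abs_sub w z; linarith) hw.1
    have h2 := hclose z hz (by simpa using hδ)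
    rw [Real.dist_eq]
    rw [abs_le] at h1 h2
    rw [abs_lt]
    constructor <;> linarith
  refine contDiffAt_one_iff.2 ⟨fun z => ContinuousLinearMap.toSpanSingleton ℝ (d z),
    Metric.ball 0 r, Metric.ball_mem_nhds 0 hr, ?_, fun z hz => ?_⟩
  · exact (ContinuousLinearMap.toSpanSingletonCLE (𝕜 := ℝ) (E := ℝ)).continuous.comp_continuousOn hcont
  · exact (hd z (by simpa using hz)).hasFDerivAt


/-! ### Continuously differentiable boundaries described by cones. -/

/-- The upward unit normal of a graph with slope `m`. -/
noncomputable def graphNormal (m : ℝ) : Plane := (√(1 + m ^ 2))⁻¹ • pt (-m) 1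

theorem norm_graphNormal (m : ℝ) : ‖graphNormal m‖ = 1 := by
  have h : (0 : ℝ) < 1 + m ^ 2 := by positivity
  have hs : ‖pt (-m) 1‖ = √(1 + m ^ 2) := by
    rw [← Real.sqrt_sq (norm_nonneg (pt (-m) 1)), norm_sq_eq]
    simp [add_comm]
  rw [graphNormal, norm_smul, hs, norm_inv, Real.norm_of_nonneg (Real.sqrt_nonneg _)]
  exact inv_mul_cancel₀ (Real.sqrt_pos.2 h).ne'

theorem continuous_graphNormal : Continuous graphNormal := by
  have h : Continuous fun m : ℝ => pt (-m) 1 := by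
    unfold pt
    refine (PiLp.continuous_toLp 2 _).comp (continuous_pi fun i => ?_)
    fin_cases i <;> simp <;> fun_prop
  exact ((by fun_prop : Continuous fun m : ℝ => √(1 + m ^ 2)).inv₀
    fun m => (Real.sqrt_pos.2 (by positivity)).ne').smul h

theorem coneOn_of_slope (h : IsLocalEpigraph A x ε I f) {q : Plane} {δ c m : ℝ} (hc : 0 < c)
    (hq : Metric.ball q δ ⊆ Metric.ball x ε)
    (hf : ∀ a b, |a - I q 0| < δ → |b - I q 0| < δ → |f a - f b - m * (a - b)| ≤ c * |a - b|) :
    ConeOn univ A q δ (I.linearIsometryEquiv.symm (graphNormal m)) c := by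
  intro y _ z _ hy hz hlt hzA
  rw [h.mem_iff (hq hz)] at hzA
  rw [h.mem_iff (hq hy)]
  have hcoord : ∀ w ∈ Metric.ball q δ, |I w 0 - I q 0| < δ := by
    intro w hw
    have := abs_zero_le_norm (I w - I q)
    rw [norm_map_sub] at this
    exact lt_of_le_of_lt (by simpa using this) (mem_ball_iff_norm.1 hw)
  have hs := hf _ _ (hcoord y hy) (hcoord z hz)
  rw [inner_symm_eq, ← norm_map_sub I, graphNormal, inner_smul_right, inner_eq] at hlt
  simp only [pt_zero, pt_one, PiLp.sub_apply] at hlt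
  have hsq : 1 ≤ √(1 + m ^ 2) := by
    rw [Real.one_le_sqrt]; nlinarith [sq_nonneg m]
  have hpos : 0 < √(1 + m ^ 2) := by linarith
  have habs := abs_zero_le_norm (I y - I z)
  simp only [PiLp.sub_apply] at habs
  rw [inv_mul_eq_div, lt_div_iff₀ hpos] at hlt
  have h1 : c * |I y 0 - I z 0| ≤ c * ‖I y - I z‖ * √(1 + m ^ 2) := by
    calc c * |I y 0 - I z 0| ≤ c * ‖I y - I z‖ * 1 := by
          rw [mul_one]; exact mul_le_mul_of_nonneg_left habs hc.le
      _ ≤ _ := mul_le_mul_of_nonneg_left hsq (by positivity)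
  have := (abs_le.1 hs).2
  linarith

/-- At points where the boundary is continuously differentiable, the set is nearby uniformly close
to half planes, with directions close to the inner normal. -/
theorem HasC1BoundaryAt.exists_normal (hA : IsOpen A) (hx : HasC1BoundaryAt A x) :
    ∃ n, IsInnerNormal A x n ∧ ∀ η > 0, ∃ r > 0, ∀ c > 0, ∃ δ > 0, ∀ q ∈ Metric.ball x r,
      ∃ m, ‖m‖ = 1 ∧ ‖m - n‖ < η ∧ ConeOn univ A q δ m c := by
  obtain ⟨ε, I, f, hε, hf, h⟩ := hx
  obtain ⟨ρ, g, hρ, hg, hslope⟩ := exists_uniform_slope_of_contDiffAt hf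
  set N : ℝ → Plane := fun w => I.linearIsometryEquiv.symm (graphNormal (g w)) with hN
  have hN1 : ∀ w, ‖N w‖ = 1 := fun w => by
    rw [hN]; simp only [LinearIsometryEquiv.norm_map]; exact norm_graphNormal _
  have hNc : ContinuousAt N 0 :=
    (I.linearIsometryEquiv.symm.continuous.comp continuous_graphNormal).continuousAt.comp hg
  have key : ∀ η > 0, ∃ r > 0, ∀ c > 0, ∃ δ > 0, ∀ q ∈ Metric.ball x r,
      ‖N (I q 0) - N 0‖ < η ∧ ConeOn univ A q δ (N (I q 0)) c := by
    intro η hη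
    obtain ⟨r₁, hr₁, hr₁'⟩ := Metric.continuousAt_iff.1 hNc η hη
    refine ⟨min (min r₁ ρ) (ε / 2), by positivity, fun c hc => ?_⟩
    obtain ⟨δ, hδ, hδ'⟩ := hslope c hc
    refine ⟨min δ (ε / 2), by positivity, fun q hq => ?_⟩
    rw [Metric.mem_ball, lt_min_iff, lt_min_iff] at hq
    have hq0 : |I q 0| ≤ dist q x := by
      have := abs_zero_le_norm (I q - I x)
      rw [norm_map_sub, h.1, sub_zero] at this
      rwa [dist_eq_norm]
    refine ⟨?_, coneOn_of_slope h hc ?_ ?_⟩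
    · rw [← dist_eq_norm]
      refine hr₁' ?_
      rw [Real.dist_eq, sub_zero]
      exact hq0.trans_lt hq.1.1
    · refine Metric.ball_subset_ball' ?_
      linarith [min_le_right δ (ε / 2)]
    · intro a b ha hb
      exact hδ' _ (hq0.trans_lt hq.1.2) a b (ha.trans_le (min_le_left _ _))
        (hb.trans_le (min_le_left _ _))
  refine ⟨N 0, isInnerNormal_of_cones hA (h.base_mem_frontier hε) (hN1 0) fun c hc => ?_, ?_⟩
  · obtain ⟨r, hr, h'⟩ := key 1 one_pos
    obtain ⟨δ, hδ, h''⟩ := h' c hc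
    refine ⟨δ, hδ, ?_⟩
    have := (h'' x (Metric.mem_ball_self hr)).2
    rwa [h.1] at this
  · intro η hη
    obtain ⟨r, hr, h'⟩ := key η hη
    refine ⟨r, hr, fun c hc => ?_⟩
    obtain ⟨δ, hδ, h''⟩ := h' c hc
    exact ⟨δ, hδ, fun q hq => ⟨_, hN1 _, (h'' q hq).1, (h'' q hq).2⟩⟩

theorem HasC1BoundaryAt.isInnerNormal_normal (hA : IsOpen A) (hx : HasC1BoundaryAt A x) :
    IsInnerNormal A x (normal A x) := by
  obtain ⟨n, hn, -⟩ := hx.exists_normal hA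
  rwa [hn.normal_eq]

theorem HasC1BoundaryAt.exists_coneOn_normal (hA : IsOpen A) (hx : HasC1BoundaryAt A x) :
    ∀ c > 0, ∃ δ > 0, ConeOn univ A x δ (normal A x) c := by
  intro c hc
  obtain ⟨n, hn, h⟩ := hx.exists_normal hA
  obtain ⟨r, hr, h'⟩ := h (c / 2) (by positivity)
  obtain ⟨δ, hδ, h''⟩ := h' (c / 2) (by positivity)
  obtain ⟨m, -, hm, hcone⟩ := h'' x (Metric.mem_ball_self hr)
  refine ⟨δ, hδ, hcone.mono Subset.rfl Subset.rfl ?_⟩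
  rw [hn.normal_eq, ← norm_neg, neg_sub]
  linarith

theorem HasC1BoundaryAt.mem_frontier (hx : HasC1BoundaryAt A x) : x ∈ frontier A := by
  obtain ⟨ε, I, f, hε, -, h⟩ := hx
  exact h.base_mem_frontier hε

/-- Near a point of differentiability, chords of the boundary are almost orthogonal to the inner
normal. -/
theorem HasC1BoundaryAt.exists_abs_inner_le (hA : IsOpen A) (hreg : interior (closure A) = A)
    (hx : HasC1BoundaryAt A x) : ∀ c > 0, ∃ δ > 0, ∀ y ∈ frontier A, ∀ z ∈ frontier A,
      y ∈ Metric.ball x δ → z ∈ Metric.ball x δ → |⟪y - z, normal A x⟫| ≤ c * ‖y - z‖ := by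
  intro c hc
  obtain ⟨δ, hδ, h⟩ := hx.exists_coneOn_normal hA c hc
  exact ⟨δ, hδ, fun y hy z hz hyq hzq => h.abs_inner_le hA hreg dense_univ hy hz hyq hzq⟩

/-- The inner normal depends continuously on the point. -/
theorem HasC1BoundaryAt.tendsto_normal (hA : IsOpen A) (hx : HasC1BoundaryAt A x) :
    Tendsto (normal A) (𝓝[{y | HasC1BoundaryAt A y}] x) (𝓝 (normal A x)) := by
  obtain ⟨n, hn, h⟩ := hx.exists_normal hA
  rw [hn.normal_eq, Metric.tendsto_nhds]
  intro η hη
  obtain ⟨δ, hδ, hcone⟩ := hx.exists_coneOn_normal hA (min (η / 4) (1 / 4)) (by positivity)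
  rw [hn.normal_eq] at hcone
  filter_upwards [mem_nhdsWithin_of_mem_nhds (Metric.ball_mem_nhds x hδ), self_mem_nhdsWithin]
    with y hy hyC
  have hyn := hyC.isInnerNormal_normal hA
  set k := normal A y
  set c := min (η / 4) (1 / 4) with hcdef
  have hc : 0 < c := by positivity
  have hcη : c ≤ η / 4 := min_le_left _ _
  have hc4 : c ≤ 1 / 4 := min_le_right _ _
  have hyf := hyC.mem_frontier
  -- If v in the cone at x pointed outwards at y, a short step from y along v would leave A,
  -- although the cone condition keeps that step in A.
  have hpos : ∀ v : Plane, c * ‖v‖ < ⟪v, n⟫ → 0 ≤ ⟪v, k⟫ := by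
    intro v hv
    by_contra! hneg
    have hneg' : 0 < ⟪-v, k⟫ := by rw [inner_neg_left]; linarith
    have hcl : Tendsto (fun t : ℝ => y + t • v) (𝓝[>] 0) (𝓝 y) := by
      have : Continuous fun t : ℝ => y + t • v := by fun_prop
      simpa using (this.tendsto 0).mono_left nhdsWithin_le_nhds
    obtain ⟨t, ⟨⟨ht1, ht2⟩, htb⟩, ht0⟩ := ((hyn.eventually_mem hneg').and
      (hcl.eventually (Metric.isOpen_ball.mem_nhds hy))).and self_mem_nhdsWithin |>.exists
    have hyeq : y - t • -v = y + t • v := by module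
    rw [hyeq] at ht2
    have hopen : IsOpen ({w | c * ‖y + t • v - w‖ < ⟪y + t • v - w, n⟫} ∩ Metric.ball x δ) :=
      (isOpen_lt (by fun_prop) (by fun_prop)).inter Metric.isOpen_ball
    obtain ⟨z, hz, hzA⟩ := mem_closure_iff.1 hyf.1 _ hopen ⟨by
      simp only [mem_ofPred_eq, add_sub_cancel_left, norm_smul, inner_smul_left,
        Real.norm_of_nonneg ht0.le]
      simp only [conj_trivial]
      nlinarith, hy⟩
    exact ht2 (hcone _ trivial z trivial htb hz.2 hz.1 hzA)
  set g := ⟪n, k⟫ with hgdef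
  have hk : ‖k‖ = 1 := hyn.1
  have hn1 : ‖n‖ = 1 := hn.1
  have hg0 : 0 ≤ g := hpos n (by rw [hn1, real_inner_self_eq_norm_sq, hn1]; linarith)
  have hg1 : g ≤ 1 := by
    have := real_inner_le_norm n k
    rw [hn1, hk] at this; linarith
  set w := k - g • n with hw
  have hwn : ⟪w, n⟫ = 0 := by
    rw [hw, inner_sub_left, inner_smul_left, real_inner_self_eq_norm_sq, hn1, real_inner_comm]
    simp [hgdef]
  have hwsq : ‖w‖ ^ 2 = 1 - g ^ 2 := by
    rw [hw, norm_sub_sq_real, hk, norm_smul, hn1, inner_smul_right, real_inner_comm,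
      Real.norm_of_nonneg hg0]
    rw [← hgdef]; ring
  have hwk : ⟪w, k⟫ = 1 - g ^ 2 := by
    rw [hw, inner_sub_left, inner_smul_left, real_inner_self_eq_norm_sq, hk]
    simp only [conj_trivial]
    rw [← hgdef]; ring
  have hwc : ‖w‖ ≤ 2 * c := by
    rcases (norm_nonneg w).eq_or_lt with h0 | h0
    · rw [← h0]; positivity
    -- The component w of k orthogonal to n is tested against a vector of the cone that points
    -- against w. This yields ‖w‖ ≤ 2c, and then ‖k - n‖² ≤ 2‖w‖² ≤ 8c².
    have := hpos ((2 * c * ‖w‖) • n - w) (by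
      rw [inner_sub_left, inner_smul_left, hwn, real_inner_self_eq_norm_sq, hn1]
      simp only [conj_trivial]
      have h1 : ‖(2 * c * ‖w‖) • n - w‖ ≤ 2 * c * ‖w‖ + ‖w‖ := by
        refine (norm_sub_le _ _).trans ?_
        rw [norm_smul, hn1, Real.norm_of_nonneg (by positivity), mul_one]
      have h2 : c * ‖(2 * c * ‖w‖) • n - w‖ ≤ c * (2 * c * ‖w‖ + ‖w‖) :=
        mul_le_mul_of_nonneg_left h1 hc.le
      have h3 : c * (2 * c * ‖w‖ + ‖w‖) = (c * ‖w‖) * (2 * c + 1) := by ring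
      have h4 : 0 < c * ‖w‖ := by positivity
      nlinarith)
    rw [inner_sub_left, inner_smul_left, hwk, ← hwsq, ← hgdef] at this
    simp only [conj_trivial] at this
    have h5 : ‖w‖ * ‖w‖ ≤ ‖w‖ * (2 * c) := by
      have : 2 * c * ‖w‖ * g ≤ 2 * c * ‖w‖ := mul_le_of_le_one_right (by positivity) hg1
      nlinarith
    exact le_of_mul_le_mul_left h5 h0
  have hfin : ‖k - n‖ ^ 2 ≤ 8 * c ^ 2 := by
    rw [norm_sub_sq_real, hk, hn1, real_inner_comm, ← hgdef]
    have : ‖w‖ ^ 2 ≤ (2 * c) ^ 2 := pow_le_pow_left₀ (norm_nonneg w) hwc 2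
    nlinarith
  rw [dist_eq_norm]
  refine lt_of_pow_lt_pow_left₀ 2 hη.le ?_
  nlinarith

/-- A Lipschitz boundary that is nearby uniformly close to straight lines is continuously
differentiable. -/
theorem hasC1BoundaryAt_of_cones {D : Set Plane} {L : ℝ≥0} (hε : 0 < ε) (hf : LipschitzWith L f)
    (h : IsLocalEpigraph A x ε I f) (hA : IsOpen A) (hreg : interior (closure A) = A)
    (hD : Dense D) (hcone : ∃ r > 0, ∀ c > 0, ∃ δ > 0, ∀ q ∈ D, q ∈ Metric.ball x r →
      ∃ m, ‖m‖ = 1 ∧ ConeOn D A q δ m c) : HasC1BoundaryAt A x := by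
  obtain ⟨r, hr, hcone⟩ := hcone
  set K : ℝ := 1 + L with hK
  have hKpos : 0 < K := by positivity
  set Y : ℝ → Plane := fun a => I.symm (pt a (f a)) with hY
  have hIY : ∀ a, I (Y a) = pt a (f a) := fun a => I.apply_symm_apply _
  have hY0 : Y 0 = x := I.injective (by rw [hIY, h.1, h.2.1]; exact plane_ext rfl rfl)
  have hflip : ∀ a b, |f a - f b| ≤ L * |a - b| := fun a b => by
    simpa [Real.dist_eq] using hf.dist_le_mul a b
  have hYlip : ∀ a b, ‖Y a - Y b‖ ≤ K * |a - b| := by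
    intro a b
    rw [← norm_map_sub I, hIY, hIY]
    refine (norm_le_abs_add_abs _).trans ?_
    simp only [PiLp.sub_apply, pt_zero, pt_one]
    linarith [hflip a b, show K * |a - b| = |a - b| + L * |a - b| by rw [hK]; ring]
  refine ⟨ε, I, f, hε, contDiffAt_of_uniform_slope (r := min (r / 2) (ε / 2) / K)
    (by positivity) fun c' hc' => ?_, h⟩
  -- The first bound keeps the cone axis away from the horizontal of the chart, |n 1| ≥ 1/(2K). The
  -- second makes the slope error cK/|n 1| at most c'.
  set c := min (1 / (2 * K)) (c' / (2 * K ^ 2)) with hcdef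
  have hc : 0 < c := by positivity
  have hcK : c * K ≤ 1 / 2 := by
    calc c * K ≤ 1 / (2 * K) * K := by gcongr; exact min_le_left _ _
      _ = 1 / 2 := by field_simp
  have hcc' : c * K * (2 * K) ≤ c' := by
    calc c * K * (2 * K) ≤ c' / (2 * K ^ 2) * K * (2 * K) := by gcongr; exact min_le_right _ _
      _ = c' := by field_simp
  obtain ⟨δ, hδ, hδ'⟩ := hcone c hc
  refine ⟨min (δ / 2) (ε / 2) / K, by positivity, fun z hz => ?_⟩
  rw [lt_div_iff₀ hKpos, lt_min_iff] at hz
  have hzx : dist (Y z) x < r / 2 ∧ dist (Y z) x < ε / 2 := by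
    have := hYlip z 0
    rw [hY0, sub_zero] at this
    rw [dist_eq_norm]
    constructor <;> linarith [hz.1, hz.2, mul_comm K |z|]
  obtain ⟨q, hqD, hq⟩ := hD.exists_dist_lt (Y z) (show 0 < min (δ / 2) (r / 2) by positivity)
  rw [lt_min_iff] at hq
  obtain ⟨m, hm1, hm⟩ := hδ' q hqD (by
    rw [Metric.mem_ball]
    linarith [dist_triangle q (Y z) x, dist_comm q (Y z)])
  set n := I.linearIsometryEquiv m with hn
  have hmn : m = I.linearIsometryEquiv.symm n := by rw [hn, LinearIsometryEquiv.symm_apply_apply]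
  have hn1 : n 0 ^ 2 + n 1 ^ 2 = 1 := by
    rw [← norm_sq_eq, hn, LinearIsometryEquiv.norm_map, hm1, one_pow]
  have hnear : ∀ a, |a - z| < min (δ / 2) (ε / 2) / K → Y a ∈ Metric.ball q δ ∧
      Y a ∈ frontier A := by
    intro a ha
    rw [lt_div_iff₀ hKpos, lt_min_iff] at ha
    have h1 := hYlip a z
    rw [← dist_eq_norm] at h1
    refine ⟨?_, h.mem_frontier ?_ ?_⟩
    · rw [Metric.mem_ball]
      linarith [dist_triangle (Y a) (Y z) q, ha.1, mul_comm K |a - z|]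
    · rw [Metric.mem_ball]
      linarith [dist_triangle (Y a) (Y z) x, ha.2, mul_comm K |a - z|]
    · rw [hIY]; rfl
  have hpair : ∀ a b, |a - z| < min (δ / 2) (ε / 2) / K → |b - z| < min (δ / 2) (ε / 2) / K →
      |n 0 * (a - b) + n 1 * (f a - f b)| ≤ c * K * |a - b| := by
    intro a b ha hb
    have := hm.abs_inner_le hA hreg hD (hnear a ha).2 (hnear b hb).2 (hnear a ha).1 (hnear b hb).1
    rw [hmn, inner_symm_eq, hIY, hIY, inner_eq] at this
    simp only [PiLp.sub_apply, pt_zero, pt_one] at this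
    calc |n 0 * (a - b) + n 1 * (f a - f b)| = |(a - b) * n 0 + (f a - f b) * n 1| := by
          congr 1; ring
      _ ≤ c * ‖Y a - Y b‖ := this
      _ ≤ c * (K * |a - b|) := mul_le_mul_of_nonneg_left (hYlip a b) hc.le
      _ = _ := by ring
  -- A single chord of the L-Lipschitz graph gives |n 0| ≤ cK + L|n 1|; together with |n 0| + |n 1|
  -- ≥ 1 and cK ≤ 1/2 this bounds |n 1| from below.
  have hn1big : 1 / (2 * K) ≤ |n 1| := by
    set d := min (δ / 2) (ε / 2) / K / 2 with hd
    have hdpos : 0 < d := by positivity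
    have h1 := hpair (z + d) z (by rw [add_sub_cancel_left, abs_of_pos hdpos]; linarith)
      (by rw [sub_self, abs_zero]; linarith)
    have h2 := hflip (z + d) z
    rw [add_sub_cancel_left, abs_of_pos hdpos] at h1 h2
    have h3 : |n 0| * d ≤ c * K * d + |n 1| * (L * d) := by
      calc |n 0| * d = |(n 0 * d + n 1 * (f (z + d) - f z)) - n 1 * (f (z + d) - f z)| := by
            rw [add_sub_cancel_right, abs_mul, abs_of_pos hdpos]
        _ ≤ _ := (abs_sub _ _).trans (by
            rw [abs_mul (n 1)]
            exact add_le_add h1 (mul_le_mul_of_nonneg_left h2 (abs_nonneg _)))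
    have h4 : |n 0| ≤ c * K + |n 1| * L := by
      refine le_of_mul_le_mul_right ?_ hdpos
      linarith
    have h5 : 1 ≤ |n 0| + |n 1| := by
      nlinarith [abs_nonneg (n 0), abs_nonneg (n 1), sq_abs (n 0), sq_abs (n 1),
        mul_nonneg (abs_nonneg (n 0)) (abs_nonneg (n 1))]
    rw [div_le_iff₀ (by positivity)]
    have : |n 1| * K = |n 1| + |n 1| * L := by rw [hK]; ring
    nlinarith
  have hn1pos : 0 < |n 1| := lt_of_lt_of_le (by positivity) hn1big
  refine ⟨-n 0 / n 1, fun a b ha hb => ?_⟩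
  have h1 := hpair a b ha hb
  have h2 : n 0 * (a - b) + n 1 * (f a - f b) = n 1 * (f a - f b - -n 0 / n 1 * (a - b)) := by
    have : n 1 ≠ 0 := abs_pos.1 hn1pos
    field_simp
    ring
  rw [h2, abs_mul] at h1
  have h3 : 1 ≤ |n 1| * (2 * K) := by
    rwa [div_le_iff₀ (by positivity)] at hn1big
  set T := |f a - f b - -n 0 / n 1 * (a - b)|
  calc T ≤ T * (|n 1| * (2 * K)) := le_mul_of_one_le_right (abs_nonneg _) h3
    _ = (|n 1| * T) * (2 * K) := by ring
    _ ≤ (c * K * |a - b|) * (2 * K) := by gcongr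
    _ = (c * K * (2 * K)) * |a - b| := by ring
    _ ≤ c' * |a - b| := by gcongr

/-- If the boundary near `x` lies in narrow cones whose axes are uniformly non-horizontal, then the
inner normal at `x` is not horizontal. -/
theorem normal_not_horizontal_of_cones {D : Set Plane} {L : ℝ≥0} (hε : 0 < ε)
    (hf : LipschitzWith L f) (h : IsLocalEpigraph A x ε I f) (hA : IsOpen A)
    (hreg : interior (closure A) = A) (hD : Dense D) (hC : HasC1BoundaryAt A x) {η : ℝ} (hη : 0 < η)
    (hcone : ∀ c > 0, ∃ δ > 0, ∃ q m, x ∈ Metric.ball q δ ∧ η ≤ |m 1| ∧ ‖m‖ = 1 ∧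
      ConeOn D A q δ m c) : normal A x 1 ≠ 0 := by
  intro hn
  set n := normal A x
  have hn1 : |n 0| = 1 := by
    have := norm_sq_eq n
    rw [(hC.isInnerNormal_normal hA).1, hn] at this
    rw [← sq_eq_sq₀ (abs_nonneg _) zero_le_one, sq_abs]
    linarith
  -- For a boundary chord v at x, a horizontal normal gives |v 0| ≤ ‖v‖/4, while a cone whose axis
  -- has vertical part at least η gives |v 1| ≤ ‖v‖/8. These contradict ‖v‖ ≤ |v 0| + |v 1|.
  set c := min (1 / 4) (η / 16) with hcdef
  have hc : 0 < c := by positivity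
  obtain ⟨δ₁, hδ₁, h₁⟩ := hC.exists_abs_inner_le hA hreg c hc
  obtain ⟨δ₂, hδ₂, q, m, hxq, hmη, hm1, h₂⟩ := hcone c hc
  set Y : ℝ → Plane := fun a => I.symm (pt a (f a)) with hY
  have hIY : ∀ a, I (Y a) = pt a (f a) := fun a => I.apply_symm_apply _
  have hY0 : Y 0 = x := I.injective (by rw [hIY, h.1, h.2.1]; exact plane_ext rfl rfl)
  have hYc : Continuous Y := by
    refine I.symm.continuous.comp ?_
    unfold pt
    refine (PiLp.continuous_toLp 2 _).comp (continuous_pi fun i => ?_)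
    have := hf.continuous
    fin_cases i <;> simp <;> fun_prop
  have hev : ∀ᶠ a in 𝓝[≠] (0 : ℝ), Y a ∈ Metric.ball x ε ∩ Metric.ball x δ₁ ∩ Metric.ball q δ₂ := by
    refine (hYc.tendsto' 0 x hY0).mono_left nhdsWithin_le_nhds |>.eventually
      (((Metric.isOpen_ball.inter Metric.isOpen_ball).inter Metric.isOpen_ball).mem_nhds
        ⟨⟨Metric.mem_ball_self hε, Metric.mem_ball_self hδ₁⟩, hxq⟩)
  obtain ⟨a, ha, ha0⟩ := (hev.and self_mem_nhdsWithin).exists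
  have hfr : Y a ∈ frontier A := h.mem_frontier ha.1.1 (by rw [hIY]; rfl)
  have hxf := hC.mem_frontier
  have hne : Y a ≠ x := fun he => ha0 (by
    have := congrArg I he
    rw [hIY, h.1] at this
    exact congrArg (fun v : Plane => v 0) this)
  have i1 := h₁ _ hfr _ hxf ha.1.2 (Metric.mem_ball_self hδ₁)
  have i2 := h₂.abs_inner_le hA hreg hD hfr hxf ha.2 hxq
  set v := Y a - x
  have hv : 0 < ‖v‖ := norm_pos_iff.2 (sub_ne_zero.2 hne)
  rw [inner_eq] at i1 i2
  rw [hn, mul_zero, add_zero, abs_mul, hn1, mul_one] at i1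
  have hm0 : |m 0| ≤ 1 := hm1 ▸ abs_zero_le_norm m
  have i3 : |v 1| * |m 1| ≤ 2 * c * ‖v‖ := by
    calc |v 1| * |m 1| = |(v 0 * m 0 + v 1 * m 1) - v 0 * m 0| := by
          rw [add_sub_cancel_left, abs_mul]
      _ ≤ c * ‖v‖ + |v 0| * |m 0| := (abs_sub _ _).trans (by rw [abs_mul (v 0)]; gcongr)
      _ ≤ c * ‖v‖ + (c * ‖v‖) * 1 := by gcongr
      _ = _ := by ring
  have i4 : |v 1| * η ≤ η / 8 * ‖v‖ := by
    calc |v 1| * η ≤ |v 1| * |m 1| := by gcongr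
      _ ≤ 2 * c * ‖v‖ := i3
      _ ≤ 2 * (η / 16) * ‖v‖ := by gcongr; exact min_le_right _ _
      _ = _ := by ring
  have i5 : |v 1| ≤ 1 / 8 * ‖v‖ := by
    refine le_of_mul_le_mul_right ?_ hη
    linarith
  have i6 : |v 0| ≤ 1 / 4 * ‖v‖ := i1.trans (by gcongr; exact min_le_left _ _)
  linarith [norm_le_abs_add_abs v]


/-! ### Translations -/

section Translation

variable {A : Set Plane} (v : Plane)

theorem mem_frontier_translate {x : Plane} :
    x ∈ frontier (Homeomorph.addRight v ⁻¹' A) ↔ x + v ∈ frontier A := by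
  rw [← Homeomorph.preimage_frontier]; rfl

theorem isInnerNormal_translate {x n : Plane} :
    IsInnerNormal (Homeomorph.addRight v ⁻¹' A) x n ↔ IsInnerNormal A (x + v) n := by
  refine and_congr_right fun _ => forall₂_congr fun c _ => ?_
  rw [show 𝓝 (x + v) = map (Homeomorph.addRight v) (𝓝 x) from
    ((Homeomorph.addRight v).map_nhds_eq x).symm, eventually_map]
  simp

open Classical in
theorem normal_translate (x : Plane) :
    normal (Homeomorph.addRight v ⁻¹' A) x = normal A (x + v) := by
  have : (fun n => IsInnerNormal (Homeomorph.addRight v ⁻¹' A) x n) =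
      fun n => IsInnerNormal A (x + v) n := funext fun n => propext (isInnerNormal_translate v)
  have key : ∀ p q : Plane → Prop, p = q →
      (if h : ∃ n, p n then h.choose else 0) = if h : ∃ n, q n then h.choose else 0 := by
    rintro p _ rfl; rfl
  exact key _ _ this

theorem IsLocalEpigraph.translate {x : Plane} {ε : ℝ} {I : Plane ≃ᵃⁱ[ℝ] Plane} {f : ℝ → ℝ}
    (h : IsLocalEpigraph A (x + v) ε I f) : IsLocalEpigraph (Homeomorph.addRight v ⁻¹' A) x ε
      ((AffineIsometryEquiv.constVAdd ℝ Plane v).trans I) f := by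
  refine ⟨by simp [vadd_eq_add, add_comm v x, h.1], h.2.1, ?_⟩
  rw [← h.2.2]
  ext z
  constructor
  · rintro ⟨y, ⟨hyA, hy⟩, rfl⟩
    refine ⟨y + v, ⟨hyA, ?_⟩, by simp [vadd_eq_add, add_comm v y]⟩
    simpa using hy
  · rintro ⟨y, ⟨hyA, hy⟩, rfl⟩
    refine ⟨y - v, ⟨by simpa using hyA, ?_⟩, by simp [vadd_eq_add]⟩
    rw [Metric.mem_ball, dist_eq_norm] at hy ⊢
    convert hy using 2
    abel

theorem HasC1BoundaryAt.translate {x : Plane} (h : HasC1BoundaryAt A (x + v)) :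
    HasC1BoundaryAt (Homeomorph.addRight v ⁻¹' A) x := by
  obtain ⟨ε, I, f, hε, hf, h⟩ := h
  exact ⟨ε, _, f, hε, hf, h.translate v⟩

end Translation

/-! ### Flat sections -/

instance : Nonempty (Metric.sphere (0 : Plane) 1) :=
  ⟨⟨graphNormal 0, by rw [mem_sphere_zero_iff_norm, norm_graphNormal]⟩⟩

/-- A dense sequence of points. -/
noncomputable def densePt : ℕ → Plane := TopologicalSpace.denseSeq Plane

/-- A dense sequence of unit vectors. -/
noncomputable def denseDir (m : ℕ) : Plane :=
  (TopologicalSpace.denseSeq (Metric.sphere (0 : Plane) 1) m : Plane)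

theorem dense_range_densePt : Dense (range densePt) := TopologicalSpace.denseRange_denseSeq Plane

theorem norm_denseDir (m : ℕ) : ‖denseDir m‖ = 1 :=
  mem_sphere_zero_iff_norm.1 (Subtype.prop _)

theorem exists_denseDir_near {n : Plane} (hn : ‖n‖ = 1) {η : ℝ} (hη : 0 < η) :
    ∃ m, ‖denseDir m - n‖ < η := by
  obtain ⟨m, hm⟩ := (TopologicalSpace.denseRange_denseSeq (Metric.sphere (0 : Plane) 1)).exists_dist_lt
    ⟨n, mem_sphere_zero_iff_norm.2 hn⟩ hη
  refine ⟨m, ?_⟩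
  rw [dist_comm] at hm
  rwa [← dist_eq_norm]

/-- A condition in countably many terms for the boundary of `A` to be continuously differentiable
with non-horizontal normals near the vertical axis. -/
def SectionFlat (A : Set Plane) : Prop :=
  ∃ i j : ℕ, ∀ k : ℕ, ∃ l : ℕ, ∀ q : ℕ, |densePt q 0| < 1 / ((j : ℝ) + 1) →
    ∃ m : ℕ, 1 / ((i : ℝ) + 1) ≤ |denseDir m 1| ∧
      ConeOn (range densePt) A (densePt q) (1 / ((l : ℝ) + 1)) (denseDir m) (1 / ((k : ℝ) + 1))

/-- Interior and exterior points are included, where the cone condition is trivial with a vertical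
axis, so that the whole vertical segment can be covered by compactness. -/
theorem exists_cones_near {A : Set Plane} (hA : IsOpen A) {x : Plane}
    (h : x ∈ frontier A → HasC1BoundaryAt A x ∧ normal A x 1 ≠ 0) :
    ∃ η > 0, ∃ r > 0, ∀ c > 0, ∃ δ > 0, ∀ q ∈ Metric.ball x r,
      ∃ m, ‖m‖ = 1 ∧ η ≤ |m 1| ∧ ConeOn univ A q δ m c := by
  have htriv : ∀ r > 0, (Metric.ball x r ⊆ A ∨ Metric.ball x r ⊆ Aᶜ) →
      ∃ η > 0, ∃ r > 0, ∀ c > 0, ∃ δ > 0, ∀ q ∈ Metric.ball x r,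
        ∃ m, ‖m‖ = 1 ∧ η ≤ |m 1| ∧ ConeOn univ A q δ m c := by
    intro r hr h
    refine ⟨1, one_pos, r / 2, half_pos hr, fun c _ => ⟨r / 2, half_pos hr, fun q hq =>
      ⟨graphNormal 0, norm_graphNormal 0, by simp [graphNormal], ?_⟩⟩⟩
    have hsub : Metric.ball q (r / 2) ⊆ Metric.ball x r :=
      Metric.ball_subset_ball' (by linarith [Metric.mem_ball.1 hq])
    rcases h with h | h
    · exact fun y _ z _ hy _ _ _ => h (hsub hy)
    · exact fun y _ z _ _ hz _ hzA => absurd hzA (h (hsub hz))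
  by_cases hxA : x ∈ A
  · obtain ⟨r, hr, h'⟩ := Metric.isOpen_iff.1 hA x hxA
    exact htriv r hr (Or.inl h')
  by_cases hxc : x ∈ closure A
  · obtain ⟨hC, hn⟩ := h (by rw [hA.frontier_eq]; exact ⟨hxc, hxA⟩)
    obtain ⟨n, hin, h'⟩ := hC.exists_normal hA
    rw [hin.normal_eq] at hn
    have hpos : 0 < |n 1| := abs_pos.2 hn
    obtain ⟨r, hr, h''⟩ := h' (|n 1| / 2) (half_pos hpos)
    refine ⟨|n 1| / 2, half_pos hpos, r, hr, fun c hc => ?_⟩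
    obtain ⟨δ, hδ, h3⟩ := h'' c hc
    refine ⟨δ, hδ, fun q hq => ?_⟩
    obtain ⟨m, hm1, hmn, hm⟩ := h3 q hq
    refine ⟨m, hm1, ?_, hm⟩
    have h4 := abs_one_le_norm (m - n)
    rw [PiLp.sub_apply] at h4
    have h5 := abs_sub_abs_le_abs_sub (n 1) (m 1)
    rw [abs_sub_comm] at h5
    linarith
  · obtain ⟨r, hr, h'⟩ := Metric.isOpen_iff.1 isClosed_closure.isOpen_compl x hxc
    exact htriv r hr (Or.inr (h'.trans (compl_subset_compl.2 subset_closure)))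

/-- Compactness of the vertical segment makes the local constants of `exists_cones_near` uniform.
Half of the aperture and half of the bound on the axis are given away to replace the axis by a
member of the dense sequence. -/
theorem sectionFlat_of_regular {A : Set Plane} {M : ℝ} (hA : IsOpen A)
    (hAM : ∀ x ∈ A, |x 1| ≤ M)
    (h : ∀ x ∈ frontier A, x 0 = 0 → HasC1BoundaryAt A x ∧ normal A x 1 ≠ 0) :
    SectionFlat A := by
  have hcomp : ∃ η > 0, ∃ r > 0, ∀ c > 0, ∃ δ > 0, ∀ q : Plane, q 1 ∈ Icc (-M - 1) (M + 1) →
      |q 0| < r → ∃ m, ‖m‖ = 1 ∧ η ≤ |m 1| ∧ ConeOn univ A q δ m c := by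
    refine (isCompact_Icc (a := -M - 1) (b := M + 1)).induction_on
      (p := fun s => ∃ η > 0, ∃ r > 0, ∀ c > 0, ∃ δ > 0, ∀ q : Plane, q 1 ∈ s →
      |q 0| < r → ∃ m, ‖m‖ = 1 ∧ η ≤ |m 1| ∧ ConeOn univ A q δ m c) ?_ ?_ ?_ ?_
    · exact ⟨1, one_pos, 1, one_pos, fun c _ => ⟨1, one_pos, fun q hq => absurd hq (notMem_empty _)⟩⟩
    · rintro s t hst ⟨η, hη, r, hr, h'⟩
      refine ⟨η, hη, r, hr, fun c hc => ?_⟩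
      obtain ⟨δ, hδ, h''⟩ := h' c hc
      exact ⟨δ, hδ, fun q hq => h'' q (hst hq)⟩
    · rintro s t ⟨η, hη, r, hr, h'⟩ ⟨η₂, hη₂, r₂, hr₂, h₂'⟩
      refine ⟨min η η₂, lt_min hη hη₂, min r r₂, lt_min hr hr₂, fun c hc => ?_⟩
      obtain ⟨δ, hδ, h''⟩ := h' c hc
      obtain ⟨δ₂, hδ₂, h₂''⟩ := h₂' c hc
      refine ⟨min δ δ₂, lt_min hδ hδ₂, fun q hq hq0 => ?_⟩
      rcases hq with hq | hq
      · obtain ⟨m, h1, h2, h3⟩ := h'' q hq (hq0.trans_le (min_le_left _ _))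
        exact ⟨m, h1, (min_le_left _ _).trans h2, h3.mono Subset.rfl
          (Metric.ball_subset_ball (min_le_left _ _)) (by simp)⟩
      · obtain ⟨m, h1, h2, h3⟩ := h₂'' q hq (hq0.trans_le (min_le_right _ _))
        exact ⟨m, h1, (min_le_right _ _).trans h2, h3.mono Subset.rfl
          (Metric.ball_subset_ball (min_le_right _ _)) (by simp)⟩
    · intro u _
      obtain ⟨η, hη, r, hr, h'⟩ := exists_cones_near hA (x := pt 0 u) fun hx => h _ hx rfl
      refine ⟨Metric.ball u (r / 2), mem_nhdsWithin_of_mem_nhds (Metric.ball_mem_nhds _ (half_pos hr)),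
        η, hη, r / 2, half_pos hr, fun c hc => ?_⟩
      obtain ⟨δ, hδ, h''⟩ := h' c hc
      refine ⟨δ, hδ, fun q hq hq0 => h'' q ?_⟩
      rw [mem_ball_iff_norm]
      refine (norm_le_abs_add_abs _).trans_lt ?_
      rw [Metric.mem_ball, Real.dist_eq] at hq
      simp only [PiLp.sub_apply, pt_zero, pt_one, sub_zero]
      linarith
  obtain ⟨η, hη, r, hr, h'⟩ := hcomp
  obtain ⟨i, hi⟩ := exists_nat_one_div_lt (half_pos (lt_min hη one_pos))
  obtain ⟨j, hj⟩ := exists_nat_one_div_lt hr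
  refine ⟨i, j, fun k => ?_⟩
  have hk : (0 : ℝ) < 1 / ((k : ℝ) + 1) := by positivity
  obtain ⟨δ, hδ, h''⟩ := h' (1 / ((k : ℝ) + 1) / 2) (half_pos hk)
  obtain ⟨l, hl⟩ := exists_nat_one_div_lt (lt_min hδ one_pos)
  rw [lt_min_iff] at hl
  refine ⟨l, fun q hq => ?_⟩
  have hcone : ∃ m, ‖m‖ = 1 ∧ min η 1 ≤ |m 1| ∧
      ConeOn univ A (densePt q) (1 / ((l : ℝ) + 1)) m (1 / ((k : ℝ) + 1) / 2) := by
    by_cases hq1 : densePt q 1 ∈ Icc (-M - 1) (M + 1)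
    · obtain ⟨m, h1, h2, h3⟩ := h'' _ hq1 (hq.trans hj)
      exact ⟨m, h1, (min_le_left _ _).trans h2, h3.mono Subset.rfl
        (Metric.ball_subset_ball hl.1.le) (by simp)⟩
    -- A dense point at height beyond M + 1 is at distance more than 1 from A, so no z in A is
    -- within the scale and the condition is vacuous.
    · refine ⟨graphNormal 0, norm_graphNormal 0, by simp [graphNormal], ?_⟩
      intro y _ z _ _ hz _ hzA
      refine absurd ?_ hq1
      have h1 := hAM z hzA
      have h2 := abs_one_le_norm (z - densePt q)
      rw [PiLp.sub_apply] at h2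
      have h3 := (h2.trans_lt (mem_ball_iff_norm.1 hz)).trans hl.2
      rw [abs_lt] at h3
      rw [abs_le] at h1
      constructor <;> linarith [h1.1, h1.2, h3.1, h3.2]
  obtain ⟨m, hm1, hmη, hm⟩ := hcone
  obtain ⟨m', hm'⟩ := exists_denseDir_near hm1
    (lt_min (half_pos hk) (half_pos (lt_min hη one_pos)))
  rw [lt_min_iff] at hm'
  refine ⟨m', ?_, hm.mono (subset_univ _) Subset.rfl (by linarith)⟩
  have h4 := abs_one_le_norm (denseDir m' - m)
  rw [PiLp.sub_apply] at h4
  have h5 := abs_sub_abs_le_abs_sub (m 1) (denseDir m' 1)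
  rw [abs_sub_comm] at h5
  linarith

/-- The Lipschitz chart at x is what allows narrow cones with unknown axes to be turned into
differentiability. With `sectionFlat_of_regular` this identifies regularity over the axis with a
measurable event. -/
theorem regular_of_sectionFlat {A : Set Plane} {ε : ℝ} {L : ℝ≥0} (hε : 0 < ε)
    (hL : HasLipschitzBoundary ε L A) (hA : IsOpen A) (hreg : interior (closure A) = A)
    (h : SectionFlat A) {x : Plane} (hx : x ∈ frontier A) (hx0 : x 0 = 0) :
    HasC1BoundaryAt A x ∧ normal A x 1 ≠ 0 := by
  obtain ⟨I, f, hf, hI⟩ := hL x hx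
  obtain ⟨i, j, h⟩ := h
  have hj : (0 : ℝ) < 1 / ((j : ℝ) + 1) := by positivity
  have hq0 : ∀ q ∈ Metric.ball x (1 / ((j : ℝ) + 1)), |q 0| < 1 / ((j : ℝ) + 1) := by
    intro q hq
    have := abs_zero_le_norm (q - x)
    rw [PiLp.sub_apply, hx0, sub_zero] at this
    exact this.trans_lt (mem_ball_iff_norm.1 hq)
  have hC : HasC1BoundaryAt A x := by
    refine hasC1BoundaryAt_of_cones hε hf hI hA hreg dense_range_densePt
      ⟨1 / ((j : ℝ) + 1), hj, fun c hc => ?_⟩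
    obtain ⟨k, hk⟩ := exists_nat_one_div_lt hc
    obtain ⟨l, hl⟩ := h k
    refine ⟨1 / ((l : ℝ) + 1), by positivity, ?_⟩
    rintro _ ⟨q, rfl⟩ hq
    obtain ⟨m, -, hm⟩ := hl q (hq0 _ hq)
    exact ⟨denseDir m, norm_denseDir m, hm.mono Subset.rfl Subset.rfl (by simpa using hk.le)⟩
  refine ⟨hC, normal_not_horizontal_of_cones hε hf hI hA hreg dense_range_densePt hC
    (η := 1 / ((i : ℝ) + 1)) (by positivity) fun c hc => ?_⟩
  obtain ⟨k, hk⟩ := exists_nat_one_div_lt hc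
  obtain ⟨l, hl⟩ := h k
  have hl' : (0 : ℝ) < 1 / ((l : ℝ) + 1) := by positivity
  obtain ⟨_, ⟨q, rfl⟩, hq⟩ := dense_range_densePt.exists_dist_lt x (lt_min hl' hj)
  rw [lt_min_iff] at hq
  obtain ⟨m, hmi, hm⟩ := hl q (hq0 _ (by rw [Metric.mem_ball, dist_comm]; exact hq.2))
  exact ⟨_, hl', densePt q, denseDir m, hq.1, hmi, norm_denseDir m,
    hm.mono Subset.rfl Subset.rfl (by simpa using hk.le)⟩

/-! ### Environments -/

variable {M : ℝ}

namespace Env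

theorem regular' (ω : Env M) : interior (closure ω.tube) = ω.tube := ω.regular

theorem isOpen_tube (ω : Env M) : IsOpen ω.tube := by
  rw [← ω.regular']; exact isOpen_interior

theorem abs_le_of_mem_tube (ω : Env M) {x : Plane} (hx : x ∈ ω.tube) : |x 1| ≤ M :=
  (ω.sec (x 0)).subset hx

theorem pt_mem_tube (ω : Env M) (a u : ℝ) : pt a u ∈ ω.tube ↔ u ∈ ω.slice a := Iff.rfl

theorem ball_subset_tube (ω : Env M) {x : Plane} {r : ℝ} :
    Metric.ball x r ⊆ ω.tube ↔ ∀ j, densePt j ∈ Metric.ball x r → densePt j ∈ ω.tube := by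
  refine ⟨fun h j hj => h hj, fun h => ?_⟩
  rw [← ω.regular']
  refine interior_maximal ?_ Metric.isOpen_ball
  refine (dense_range_densePt.open_subset_closure_inter Metric.isOpen_ball).trans (closure_mono ?_)
  rintro _ ⟨hy, j, rfl⟩
  exact h j hy

end Env

theorem tube_shift (a : ℝ) (ω : Env M) :
    (shift a ω).tube = Homeomorph.addRight (pt a 0) ⁻¹' ω.tube := tubeOf_shift ω.sec a

theorem mem_tube_shift {a : ℝ} {ω : Env M} {x : Plane} :
    x ∈ (shift a ω).tube ↔ x + pt a 0 ∈ ω.tube := by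
  rw [tube_shift]; rfl

theorem pt_add_pt (a b u : ℝ) : pt a u + pt b 0 = pt (a + b) u :=
  plane_ext rfl (add_zero u)

theorem measurable_env_iff {α : Type*} [MeasurableSpace α] {g : α → Env M} :
    Measurable g ↔ ∀ β, Measurable fun x => (g x).sec β := by
  rw [measurable_iff_comap_le]
  simp only [instMeasurableSpaceEnv, MeasurableSpace.comap_iSup, iSup_le_iff,
    MeasurableSpace.comap_comp]
  exact forall_congr' fun β => measurable_iff_comap_le.symm

theorem measurable_sec (β : ℝ) : Measurable fun ω : Env M => ω.sec β :=
  measurable_env_iff.1 measurable_id β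

/-- Each section of the shifted path is continuous in the shift and measurable in the environment,
hence jointly measurable. -/
theorem measurable_shift : Measurable fun p : ℝ × Env M => shift p.1 p.2 :=
  measurable_env_iff.2 fun β =>
    measurable_uncurry_of_continuous_of_measurable (u := fun a (ω : Env M) => ω.sec (β + a))
      (fun ω => ω.continuous_sec.comp (continuous_const.add continuous_id))
      fun a => measurable_sec (β + a)

theorem continuous_volume_sdiff (c d : ℝ) :
    Continuous fun B : Sec M => volume.real (Ioo c d \ B.carrier) := by
  refine (LipschitzWith.of_dist_le_mul (K := 1) fun B B' => ?_).continuous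
  have key : ∀ B B' : Sec M, volume.real (Ioo c d \ B.carrier) ≤
      volume.real (Ioo c d \ B'.carrier) + dist B B' := by
    intro B B'
    refine (measureReal_mono (s₂ := (Ioo c d \ B'.carrier) ∪ (B.carrier ∆ B'.carrier)) ?_ ?_).trans
      (measureReal_union_le _ _)
    · intro u hu
      by_cases h : u ∈ B'.carrier
      · exact Or.inr (Or.inr ⟨h, hu.2⟩)
      · exact Or.inl ⟨hu.1, h⟩
    · refine measure_union_ne_top ?_ ?_
      · exact ne_top_of_le_ne_top (measure_Ioo_lt_top.ne) (measure_mono sdiff_subset)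
      · refine ne_top_of_le_ne_top (measure_union_ne_top B.volume_ne_top B'.volume_ne_top)
          (measure_mono ?_)
        exact union_subset_union sdiff_subset sdiff_subset
  rw [NNReal.coe_one, one_mul, Real.dist_eq, abs_le]
  have h1 := key B B'
  have h2 := key B' B
  rw [dist_comm] at h2
  constructor <;> linarith

/-- Rectangles are contained in the tube if almost all of their rational sections are. -/
theorem Env.rectangle_subset (ω : Env M) {a b c d : ℝ}
    (h : ∀ α : ℚ, (α : ℝ) ∈ Ioo a b → volume.real (Ioo c d \ ω.slice α) = 0) {x : Plane}
    (h0 : x 0 ∈ Ioo a b) (h1 : x 1 ∈ Ioo c d) : x ∈ ω.tube := by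
  have hall : ∀ α ∈ Ioo a b, volume.real (Ioo c d \ ω.slice α) = 0 := by
    have hcl : IsClosed {α : ℝ | volume.real (Ioo c d \ ω.slice α) = 0} :=
      isClosed_eq ((continuous_volume_sdiff c d).comp ω.continuous_sec) continuous_const
    intro α hα
    -- Continuity of the path in symmetric difference extends the null condition from rational to
    -- all abscissas. Sections are then dense in (c,d), the rectangle lies in the closure of the
    -- tube, and regular openness removes the closure.
    have : Ioo a b ⊆ closure (Ioo a b ∩ range ((↑) : ℚ → ℝ)) :=
      Rat.isDenseEmbedding_coe_real.dense.open_subset_closure_inter isOpen_Ioo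
    refine closure_minimal ?_ hcl (this hα)
    rintro _ ⟨hβ, β, rfl⟩
    exact h β hβ
  rw [← ω.regular']
  refine interior_maximal (s := closure ω.tube) (t := {y : Plane | y 0 ∈ Ioo a b ∧ y 1 ∈ Ioo c d}) ?_ ?_ ⟨h0, h1⟩
  · rintro y ⟨hy0, hy1⟩
    have hz : volume (Ioo c d \ ω.slice (y 0)) = 0 :=
      (measureReal_eq_zero_iff (ne_top_of_le_ne_top measure_Ioo_lt_top.ne
        (measure_mono sdiff_subset))).1 (hall _ hy0)
    have hcl : y 1 ∈ closure (ω.slice (y 0)) := by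
      by_contra hn
      have hop : IsOpen (Ioo c d ∩ (closure (ω.slice (y 0)))ᶜ) :=
        isOpen_Ioo.inter isClosed_closure.isOpen_compl
      refine (hop.measure_pos volume ⟨_, hy1, hn⟩).ne' (measure_mono_null ?_ hz)
      exact fun u hu => ⟨hu.1, fun hu' => hu.2 (subset_closure hu')⟩
    have hcont : Continuous fun u : ℝ => pt (y 0) u := by
      unfold pt
      refine (PiLp.continuous_toLp 2 _).comp (continuous_pi fun i => ?_)
      fin_cases i <;> simp <;> fun_prop
    have : pt (y 0) (y 1) ∈ closure ω.tube :=
      map_mem_closure hcont hcl fun u hu => (ω.pt_mem_tube _ _).2 hu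
    rwa [plane_ext (x := pt (y 0) (y 1)) (y := y) rfl rfl] at this
  · exact (isOpen_Ioo.preimage (by fun_prop : Continuous fun y : Plane => y 0)).inter
      (isOpen_Ioo.preimage (by fun_prop : Continuous fun y : Plane => y 1))

/-- The metric on sections sees only volumes, so that membership of a point in one section is not a
measurable event by itself. For a regular open tube it is expressed by countably many volumes, which
yields joint measurability in the point and the environment. -/
theorem Env.mem_tube_iff (ω : Env M) (x : Plane) : x ∈ ω.tube ↔ ∃ a b c d : ℚ,
    (x 0 ∈ Ioo (a : ℝ) b ∧ x 1 ∈ Ioo (c : ℝ) d) ∧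
      ∀ α : ℚ, (α : ℝ) ∈ Ioo (a : ℝ) b → volume.real (Ioo (c : ℝ) d \ ω.slice α) = 0 := by
  constructor
  · intro hx
    obtain ⟨r, hr, hsub⟩ := Metric.isOpen_iff.1 ω.isOpen_tube x hx
    obtain ⟨a, ha1, ha2⟩ := exists_rat_btwn (show x 0 - r / 2 < x 0 by linarith)
    obtain ⟨b, hb1, hb2⟩ := exists_rat_btwn (show x 0 < x 0 + r / 2 by linarith)
    obtain ⟨c, hc1, hc2⟩ := exists_rat_btwn (show x 1 - r / 2 < x 1 by linarith)
    obtain ⟨d, hd1, hd2⟩ := exists_rat_btwn (show x 1 < x 1 + r / 2 by linarith)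
    refine ⟨a, b, c, d, ⟨⟨ha2, hb1⟩, hc2, hd1⟩, fun α hα => ?_⟩
    have : Ioo (c : ℝ) d \ ω.slice α = ∅ := by
      refine sdiff_eq_empty.2 fun u hu => (ω.pt_mem_tube _ _).1 (hsub ?_)
      rw [mem_ball_iff_norm]
      refine (norm_le_abs_add_abs _).trans_lt ?_
      simp only [PiLp.sub_apply, pt_zero, pt_one]
      have h1 : |(α : ℝ) - x 0| < r / 2 := by
        rw [abs_lt]; constructor <;> linarith [hα.1, hα.2]
      have h2 : |u - x 1| < r / 2 := by
        rw [abs_lt]; constructor <;> linarith [hu.1, hu.2]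
      linarith
    simp [this]
  · rintro ⟨a, b, c, d, ⟨h0, h1⟩, h⟩
    exact ω.rectangle_subset h h0 h1

/-! ### Measurable events, and regularity of the section at the origin. -/

theorem measurableSet_mem_tube : MeasurableSet {p : Plane × Env M | p.1 ∈ p.2.tube} := by
  simp only [Env.mem_tube_iff, ofPred_exists]
  refine MeasurableSet.iUnion fun a => MeasurableSet.iUnion fun b => MeasurableSet.iUnion fun c =>
    MeasurableSet.iUnion fun d => ?_
  refine MeasurableSet.inter ?_ ?_
  · have h0 : Measurable fun p : Plane × Env M => p.1 0 :=
      (by fun_prop : Continuous fun y : Plane => y 0).measurable.comp measurable_fst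
    have h1 : Measurable fun p : Plane × Env M => p.1 1 :=
      (by fun_prop : Continuous fun y : Plane => y 1).measurable.comp measurable_fst
    exact (h0 measurableSet_Ioo).inter (h1 measurableSet_Ioo)
  · have : {p : Plane × Env M | ∀ α : ℚ, (α : ℝ) ∈ Ioo (a : ℝ) b →
        volume.real (Ioo (c : ℝ) d \ p.2.slice α) = 0} = ⋂ α : ℚ, ⋂ _ : (α : ℝ) ∈ Ioo (a : ℝ) b,
        {p : Plane × Env M | volume.real (Ioo (c : ℝ) d \ p.2.slice α) = 0} := by
      ext p; simp
    change MeasurableSet {p : Plane × Env M | _}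
    rw [this]
    refine MeasurableSet.iInter fun α => MeasurableSet.iInter fun _ => ?_
    exact (((continuous_volume_sdiff (c : ℝ) d).measurable.comp (measurable_sec (α : ℝ))).comp
      measurable_snd) (measurableSet_singleton 0)

theorem measurableSet_mem_tube_of {α : Type*} [MeasurableSpace α] {x : α → Plane} {g : α → Env M}
    (hx : Measurable x) (hg : Measurable g) : MeasurableSet {a | x a ∈ (g a).tube} :=
  (hx.prodMk hg) measurableSet_mem_tube

theorem measurableSet_sectionFlat : MeasurableSet {ω : Env M | SectionFlat ω.tube} := by
  have hcone : ∀ q δ n c, MeasurableSet {ω : Env M | ConeOn (range densePt) ω.tube q δ n c} := by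
    intro q δ n c
    simp only [ConeOn, forall_mem_range, ofPred_forall]
    refine MeasurableSet.iInter fun i => MeasurableSet.iInter fun j => MeasurableSet.iInter fun _ =>
      MeasurableSet.iInter fun _ => MeasurableSet.iInter fun _ => ?_
    simp only [imp_iff_not_or, ofPred_or]
    exact (measurableSet_mem_tube_of measurable_const measurable_id).compl.union
      (measurableSet_mem_tube_of measurable_const measurable_id)
  simp only [SectionFlat, ofPred_exists, ofPred_forall]
  refine MeasurableSet.iUnion fun i => MeasurableSet.iUnion fun j => MeasurableSet.iInter fun k =>
    MeasurableSet.iUnion fun l => MeasurableSet.iInter fun q => MeasurableSet.iInter fun _ =>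
    MeasurableSet.iUnion fun m => ?_
  exact (MeasurableSet.const _).inter (hcone _ _ _ _)

theorem mem_regularPoints_iff {ω : Env M} {x : Plane} : x ∈ regularPoints ω ↔
    HasC1BoundaryAt ω.tube x ∧ normal ω.tube x 1 ≠ 0 := by
  have key : HasC1BoundaryAt ω.tube x →
      (|⟪normal ω.tube x, e⟫| ≠ 1 ↔ normal ω.tube x 1 ≠ 0) := by
    intro hC
    have h1 := norm_sq_eq (normal ω.tube x)
    rw [(hC.isInnerNormal_normal ω.isOpen_tube).1] at h1
    rw [inner_e, not_iff_not]
    constructor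
    · intro h
      rw [← sq_abs (normal ω.tube x 0), h] at h1
      exact pow_eq_zero_iff two_ne_zero |>.1 (by linarith)
    · intro h
      rw [h] at h1
      rw [← sq_eq_sq₀ (abs_nonneg _) zero_le_one, sq_abs]
      linarith
  exact ⟨fun h => ⟨h.2.1, (key h.2.1).1 h.2.2⟩, fun h => ⟨h.1.mem_frontier, h.1, (key h.1).2 h.2⟩⟩

theorem mem_regularPoints_shift {ω : Env M} {a : ℝ} {x : Plane}
    (h : x + pt a 0 ∈ regularPoints ω) : x ∈ regularPoints (shift a ω) := by
  rw [mem_regularPoints_iff] at h ⊢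
  rw [tube_shift, normal_translate]
  exact ⟨h.1.translate _, h.2⟩

theorem measurableSet_frontier_tube (ω : Env M) : MeasurableSet (frontier ω.tube) :=
  isClosed_frontier.measurableSet

theorem boundaryMeasure_apply_frontier_diff (ω : Env M) (R : Set Plane) :
    boundaryMeasure ω (frontier ω.tube \ R) = (μH[1] : Measure Plane) (frontier ω.tube \ R) := by
  rw [boundaryMeasure, Measure.restrict_apply' (measurableSet_frontier_tube ω),
    inter_eq_left.2 sdiff_subset]

theorem lipschitzWith_coord_zero : LipschitzWith 1 fun x : Plane => x 0 :=
  LipschitzWith.of_dist_le_mul fun x y => by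
    rw [NNReal.coe_one, one_mul, dist_eq_norm x y, Real.dist_eq]
    exact abs_zero_le_norm (x - y)

/-- The abscissa is 1-Lipschitz, so the exceptional boundary points project to a null set of
abscissas. -/
theorem ae_section_regular {ω : Env M} {R : Set Plane}
    (h : (μH[1] : Measure Plane) (frontier ω.tube \ R) = 0) :
    ∀ᵐ a : ℝ, ∀ x ∈ frontier ω.tube, x 0 = a → x ∈ R := by
  have h0 : volume ((fun x : Plane => x 0) '' (frontier ω.tube \ R)) = 0 := by
    refine le_antisymm ((volume_image_le_mul_hausdorffMeasure
      (lipschitzWith_coord_zero.lipschitzOnWith)).trans ?_) zero_le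
    rw [h, mul_zero]
  refine measure_mono_null (fun a ha => ?_) h0
  rw [mem_compl_iff, mem_ofPred_eq] at ha
  push Not at ha
  obtain ⟨x, hx, hxa, hxR⟩ := ha
  exact ⟨x, ⟨hx, hxR⟩, hxa⟩

/-- Almost surely the section at almost every abscissa is flat. By Fubini some fixed abscissa is
almost surely good, and stationarity moves it to 0. -/
theorem ae_sectionFlat (P : Measure (Env M)) [IsProbabilityMeasure P] (hstat : IsStationary P)
    (hR : ConditionR P) : ∀ᵐ ω ∂P, SectionFlat ω.tube := by
  have h1 : ∀ᵐ ω ∂P, ∀ᵐ a : ℝ, SectionFlat (shift a ω).tube := by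
    filter_upwards [hR] with ω hω
    rw [boundaryMeasure_apply_frontier_diff] at hω
    filter_upwards [ae_section_regular hω] with a ha
    refine sectionFlat_of_regular (shift a ω).isOpen_tube
      (fun x hx => (shift a ω).abs_le_of_mem_tube hx) fun x hx hx0 => ?_
    rw [tube_shift, mem_frontier_translate] at hx
    exact mem_regularPoints_iff.1 (mem_regularPoints_shift
      (ha _ hx (by simp [hx0])))
  have hm : MeasurableSet {p : Env M × ℝ | SectionFlat (shift p.2 p.1).tube} :=
    (measurable_shift.comp measurable_swap) measurableSet_sectionFlat
  rw [Measure.ae_ae_comm hm] at h1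
  obtain ⟨a, ha⟩ := h1.exists
  rw [← (hstat a).map_eq]
  exact (ae_map_iff (hstat a).measurable.aemeasurable measurableSet_sectionFlat).2 ha


/-! ### Length of Lipschitz boundaries -/

theorem hausdorffMeasure_frontier_inter_ball_le {A : Set Plane} (hA : IsOpen A) {x : Plane}
    {ε : ℝ} {L : ℝ≥0} {I : Plane ≃ᵃⁱ[ℝ] Plane} {f : ℝ → ℝ} (hf : LipschitzWith L f)
    (h : IsLocalEpigraph A x ε I f) :
    (μH[1] : Measure Plane) (frontier A ∩ Metric.ball x ε) ≤
      ((1 + L : ℝ≥0) : ℝ≥0∞) * ENNReal.ofReal (2 * ε) := by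
  have hY : LipschitzWith (1 + L) fun a : ℝ => I.symm (pt a (f a)) := by
    refine LipschitzWith.of_dist_le_mul fun a b => ?_
    rw [I.symm.dist_map, dist_eq_norm]
    refine (norm_le_abs_add_abs _).trans ?_
    have := hf.dist_le_mul a b
    simp only [Real.dist_eq] at this
    simp only [PiLp.sub_apply, pt_zero, pt_one, Real.dist_eq]
    push_cast
    linarith
  have hsub : frontier A ∩ Metric.ball x ε ⊆
      (fun a : ℝ => I.symm (pt a (f a))) '' Ioo (-ε) ε := by
    rintro y ⟨hyA, hy⟩
    have he := h.eq_of_mem_frontier hA hy hf.continuous.continuousAt hyA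
    refine ⟨I y 0, ?_, ?_⟩
    · have := abs_zero_le_norm (I y - I x)
      rw [norm_map_sub, h.1, sub_zero] at this
      exact abs_lt.1 (this.trans_lt (mem_ball_iff_norm.1 hy))
    · simp only [he]
      rw [show pt (I y 0) (I y 1) = I y from plane_ext rfl rfl, I.symm_apply_apply]
  refine (measure_mono hsub).trans ?_
  have := hY.hausdorffMeasure_image_le (d := 1) zero_le_one (Ioo (-ε) ε)
  rw [hausdorffMeasure_real, ENNReal.rpow_one, Real.volume_Ioo, sub_neg_eq_add, ← two_mul] at this
  exact this

theorem isLocallyFiniteMeasure_boundary {A : Set Plane} (hA : IsOpen A) {ε : ℝ} {L : ℝ≥0}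
    (hε : 0 < ε) (hL : HasLipschitzBoundary ε L A) :
    IsLocallyFiniteMeasure ((μH[1] : Measure Plane).restrict (frontier A)) := by
  refine ⟨fun x => ?_⟩
  by_cases hx : x ∈ frontier A
  · obtain ⟨I, f, hf, h⟩ := hL x hx
    refine ⟨Metric.ball x ε, Metric.ball_mem_nhds x hε, ?_⟩
    rw [Measure.restrict_apply measurableSet_ball, inter_comm]
    exact (hausdorffMeasure_frontier_inter_ball_le hA hf h).trans_lt
      (ENNReal.mul_lt_top ENNReal.coe_lt_top ENNReal.ofReal_lt_top)
  · refine ⟨(frontier A)ᶜ, isClosed_frontier.isOpen_compl.mem_nhds hx, ?_⟩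
    rw [Measure.restrict_apply isClosed_frontier.measurableSet.compl, compl_inter_self]
    simp

theorem sigmaFinite_restrict_of_subset_frontier {A Y : Set Plane} (hA : IsOpen A) {ε : ℝ}
    {L : ℝ≥0} (hε : 0 < ε) (hL : HasLipschitzBoundary ε L A) (hY : Y ⊆ frontier A) :
    SigmaFinite ((μH[1] : Measure Plane).restrict Y) := by
  have := isLocallyFiniteMeasure_boundary hA hε hL
  rw [← Measure.restrict_restrict_of_subset hY]
  infer_instance

/-- A fixed ball is covered by finitely many balls of radius ε/2, each contained in one graph chart
if it meets the boundary. The bound depends only on ε, L and the radius, so it survives taking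
expectations. -/
theorem exists_hausdorffMeasure_frontier_le {ε : ℝ} (hε : 0 < ε) (L : ℝ≥0) (R : ℝ) :
    ∃ C : ℝ≥0∞, C ≠ ∞ ∧ ∀ A : Set Plane, IsOpen A → HasLipschitzBoundary ε L A →
      (μH[1] : Measure Plane) (frontier A ∩ Metric.closedBall 0 R) ≤ C := by
  obtain ⟨t, -, htfin, ht⟩ := (isCompact_closedBall (0 : Plane) R).finite_cover_balls
    (half_pos hε)
  set C₁ : ℝ≥0∞ := ((1 + L : ℝ≥0) : ℝ≥0∞) * ENNReal.ofReal (2 * ε)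
  refine ⟨∑ _ ∈ htfin.toFinset, C₁, by
    simp only [Finset.sum_const, nsmul_eq_mul, ne_eq]
    exact (ENNReal.mul_lt_top (ENNReal.natCast_lt_top _)
      (ENNReal.mul_lt_top ENNReal.coe_lt_top ENNReal.ofReal_lt_top)).ne, fun A hA hL => ?_⟩
  calc (μH[1] : Measure Plane) (frontier A ∩ Metric.closedBall 0 R)
      ≤ (μH[1] : Measure Plane) (⋃ c ∈ htfin.toFinset, frontier A ∩ Metric.ball c (ε / 2)) := by
        refine measure_mono fun y hy => ?_
        obtain ⟨c, hc, hyc⟩ := mem_iUnion₂.1 (ht hy.2)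
        exact mem_iUnion₂.2 ⟨c, htfin.mem_toFinset.2 hc, hy.1, hyc⟩
    _ ≤ ∑ c ∈ htfin.toFinset, (μH[1] : Measure Plane) (frontier A ∩ Metric.ball c (ε / 2)) :=
        measure_biUnion_finset_le _ _
    _ ≤ _ := by
        refine Finset.sum_le_sum fun c _ => ?_
        rcases (frontier A ∩ Metric.ball c (ε / 2)).eq_empty_or_nonempty with h0 | ⟨x, hxA, hx⟩
        · rw [h0, measure_empty]; exact zero_le
        · obtain ⟨I, f, hf, h⟩ := hL x hxA
          refine (measure_mono ?_).trans (hausdorffMeasure_frontier_inter_ball_le hA hf h)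
          refine inter_subset_inter_right _ (Metric.ball_subset_ball' ?_)
          rw [Metric.mem_ball, dist_comm] at hx
          linarith

/-! ### Chords near regular points -/

/-- Decomposition along n and the tangent τ: the linear function with gradient w varies along the
boundary at the rate |w·τ|. With w = e this rate is κ; with w orthogonal to the segment from (0,u)
it is the numerator in the derivative of the slope. -/
theorem abs_inner_le_of_flat {n v : Plane} {c : ℝ} (hn : ‖n‖ = 1) (h : |⟪v, n⟫| ≤ c * ‖v‖)
    (w : Plane) : |⟪v, w⟫| ≤ (|w 1 * n 0 - w 0 * n 1| + c * ‖w‖) * ‖v‖ := by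
  have hn2 : n 0 ^ 2 + n 1 ^ 2 = 1 := by rw [← norm_sq_eq, hn, one_pow]
  set τ : Plane := pt (-n 1) (n 0) with hτ
  have hτ1 : ‖τ‖ = 1 := by
    rw [← sq_eq_sq₀ (norm_nonneg _) zero_le_one, norm_sq_eq]
    simp only [hτ, pt_zero, pt_one]; linarith
  have hdec : ⟪v, w⟫ = ⟪v, τ⟫ * (w 1 * n 0 - w 0 * n 1) + ⟪v, n⟫ * ⟪w, n⟫ := by
    simp only [inner_eq, hτ, pt_zero, pt_one]
    linear_combination (-(v 0 * w 0 + v 1 * w 1)) * hn2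
  have h1 : |⟪v, τ⟫| ≤ ‖v‖ := by simpa [hτ1] using abs_real_inner_le_norm v τ
  have h2 : |⟪w, n⟫| ≤ ‖w‖ := by simpa [hn] using abs_real_inner_le_norm w n
  rw [hdec]
  calc _ ≤ |⟪v, τ⟫ * (w 1 * n 0 - w 0 * n 1)| + |⟪v, n⟫ * ⟪w, n⟫| := abs_add_le _ _
    _ ≤ ‖v‖ * |w 1 * n 0 - w 0 * n 1| + c * ‖v‖ * ‖w‖ := by
        rw [abs_mul, abs_mul]; gcongr
        exact (abs_nonneg _).trans h
    _ = _ := by ring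

theorem kappa_eq (ω : Env M) (x : Plane) : kappa ω x = |normal ω.tube x 1| := by
  have hnorm : ‖transProj (normal ω.tube x)‖ = |normal ω.tube x 1| := by
    rw [← sq_eq_sq₀ (norm_nonneg _) (abs_nonneg _), norm_sq_eq, sq_abs]
    simp [transProj]
  rw [kappa, sectionNormal, hnorm, inner_smul_right, inner_eq]
  simp only [transProj, pt_zero, pt_one, mul_zero, zero_add]
  rcases eq_or_ne (normal ω.tube x 1) 0 with h0 | h0
  · simp [h0]
  · rw [← abs_mul_abs_self (normal ω.tube x 1), inv_mul_cancel_left₀ (abs_ne_zero.2 h0)]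

/-- Measurability of `regularPoints` is not needed: a Borel subset of full length serves in its
place. -/
theorem exists_measurable_regular {ω : Env M}
    (hR : boundaryMeasure ω (frontier ω.tube \ regularPoints ω) = 0) :
    ∃ R : Set Plane, MeasurableSet R ∧ R ⊆ regularPoints ω ∧
      (μH[1] : Measure Plane) (frontier ω.tube \ R) = 0 := by
  rw [boundaryMeasure_apply_frontier_diff] at hR
  set N := toMeasurable μH[1] (frontier ω.tube \ regularPoints ω)
  refine ⟨frontier ω.tube \ N, (measurableSet_frontier_tube ω).diff (measurableSet_toMeasurable _ _),
    fun x hx => ?_, ?_⟩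
  · by_contra hxr
    exact hx.2 (subset_toMeasurable _ _ ⟨hx.1, hxr⟩)
  · refine measure_mono_null (fun x hx => ?_) ((measure_toMeasurable _).trans hR)
    by_contra hxN
    exact hx.2 ⟨hx.1, hxN⟩

open Classical in
theorem measurable_indicator_normal {ω : Env M} {R : Set Plane} (hR : MeasurableSet R)
    (hRreg : R ⊆ regularPoints ω) : Measurable (R.indicator (normal ω.tube)) := by
  have hc : ContinuousOn (normal ω.tube) R := fun x hx =>
    ((hRreg hx).2.1.tendsto_normal ω.isOpen_tube).mono_left
      (nhdsWithin_mono _ fun y hy => (hRreg hy).2.1)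
  rw [← piecewise_eq_indicator]
  exact hc.measurable_piecewise continuousOn_const hR

/-! ### Sections -/

theorem floor_ne_of_lt_dist {u v : ℝ} {N : ℕ} (hN : 1 ≤ N) (h : 1 / (N : ℝ) < dist u v) :
    ⌊N * u⌋ ≠ ⌊N * v⌋ := by
  intro he
  have := Int.abs_sub_lt_one_of_floor_eq_floor he
  have hN' : (0 : ℝ) < N := by exact_mod_cast hN
  rw [← mul_sub, abs_mul, abs_of_pos hN'] at this
  rw [Real.dist_eq, div_lt_iff₀ hN'] at h
  linarith

theorem Sec.finite_frontier (B : Sec M) : (frontier B.carrier).Finite := by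
  obtain ⟨N, hN, hsep⟩ := B.lipschitz
  refine Set.Finite.of_finite_image (f := fun u : ℝ => ⌊N * u⌋) ?_ ?_
  · refine (Set.finite_Icc ⌊(N : ℝ) * -M⌋ ⌊(N : ℝ) * M⌋).subset ?_
    rintro _ ⟨u, hu, rfl⟩
    have hcl : IsClosed (Lam M) := isClosed_le continuous_norm continuous_const
    have hu' : |u| ≤ M := closure_minimal B.subset hcl (frontier_subset_closure hu)
    rw [abs_le] at hu'
    exact ⟨Int.floor_mono (by gcongr; exact hu'.1), Int.floor_mono (by gcongr; exact hu'.2)⟩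
  · intro u hu v hv he
    by_contra hne
    exact floor_ne_of_lt_dist hN (hsep hu hv hne) he

theorem Env.finite_frontier_slice (ω : Env M) (a : ℝ) : (frontier (ω.slice a)).Finite :=
  (ω.sec a).finite_frontier

theorem continuous_pt_right (a : ℝ) : Continuous fun u : ℝ => pt a u := by
  unfold pt
  refine (PiLp.continuous_toLp 2 _).comp (continuous_pi fun i => ?_)
  fin_cases i <;> simp <;> fun_prop

theorem Env.mem_frontier_tube_of_slice (ω : Env M) {a u : ℝ} (h : u ∈ frontier (ω.slice a)) :
    pt a u ∈ frontier ω.tube := by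
  rw [(show IsOpen (ω.slice a) from (ω.sec a).isOpen).frontier_eq] at h
  rw [ω.isOpen_tube.frontier_eq]
  exact ⟨map_mem_closure (continuous_pt_right a) h.1 fun v hv => (ω.pt_mem_tube _ _).2 hv,
    fun h' => h.2 ((ω.pt_mem_tube _ _).1 h')⟩

theorem lintegral_sectionMeasure (ω : Env M) (a : ℝ) (g : ℝ → ℝ≥0∞) :
    ∫⁻ u, g u ∂(sectionMeasure ω a) = ∑ u ∈ (ω.finite_frontier_slice a).toFinset, g u := by
  have : frontier (ω.slice a) = ((ω.finite_frontier_slice a).toFinset : Set ℝ) := by simp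
  have hm : sectionMeasure ω a =
      Measure.count.restrict ((ω.finite_frontier_slice a).toFinset : Set ℝ) :=
    congrArg Measure.count.restrict this
  rw [hm, lintegral_finset]
  simp

/-! ### The normalizing constant is finite -/

/-- By `abs_inner_le_of_flat`, κ is the local Lipschitz constant of the abscissa along the boundary.
-/
theorem volume_coord_image_le {ω : Env M} {ε : ℝ} {L : ℝ≥0} (hε : 0 < ε)
    (hL : HasLipschitzBoundary ε L ω.tube) {R : Set Plane}
    (hRreg : R ⊆ regularPoints ω) {D : Set Plane} (hDR : D ⊆ R) {c : ℝ≥0}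
    (hDc : ∀ y ∈ D, kappa ω y ≤ c) :
    volume ((fun y : Plane => y 0) '' D) ≤ c * (μH[1] : Measure Plane) D := by
  have := sigmaFinite_restrict_of_subset_frontier ω.isOpen_tube hε hL
    (fun y hy => (hRreg (hDR hy)).1 : D ⊆ frontier ω.tube)
  refine (volume_image_le_lintegral (Y := D)
    (J := fun _ => c) measurable_const fun y hy η hη => ?_).trans (by rw [setLIntegral_const])
  have hreg := (hRreg (hDR hy)).2.1
  obtain ⟨δ, hδ, h⟩ := hreg.exists_abs_inner_le ω.isOpen_tube ω.regular' η hη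
  filter_upwards [mem_nhdsWithin_of_mem_nhds (Metric.ball_mem_nhds y hδ), self_mem_nhdsWithin]
    with y' hy' hy'D
  have h1 := h y' (hRreg (hDR hy'D)).1 y (hRreg (hDR hy)).1 hy' (Metric.mem_ball_self hδ)
  have h2 := abs_inner_le_of_flat (hreg.isInnerNormal_normal ω.isOpen_tube).1 h1 e
  rw [inner_e] at h2
  have he : ‖e‖ = 1 := by
    rw [← sq_eq_sq₀ (norm_nonneg _) zero_le_one, norm_sq_eq]; simp [e]
  rw [he] at h2
  simp only [e, pt_zero, pt_one, zero_mul, zero_sub, one_mul, abs_neg, mul_one] at h2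
  rw [Real.dist_eq, dist_eq_norm y' y]
  refine h2.trans ?_
  gcongr
  rw [← kappa_eq]
  exact hDc y hy

theorem kappa_shift (ω : Env M) (a u : ℝ) : kappa (shift a ω) (pt 0 u) = kappa ω (pt a u) := by
  rw [kappa_eq, kappa_eq, tube_shift, normal_translate, pt_add_pt, zero_add]

theorem slice_shift (ω : Env M) (a b : ℝ) : (shift a ω).slice b = ω.slice (b + a) := rfl

/-- A coarea inequality with weight κ⁻¹. The boundary is cut into cells of height 1/n and nearly
constant κ⁻¹; the projection of a cell has length at most κ times its own, which cancels the weight.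
Rounding costs the factor 2. -/
theorem lintegral_sum_inv_kappa_le {ω : Env M} {ε : ℝ} {L : ℝ≥0} (hε : 0 < ε)
    (hL : HasLipschitzBoundary ε L ω.tube)
    (hR : boundaryMeasure ω (frontier ω.tube \ regularPoints ω) = 0) :
    ∫⁻ a in Ioo (0 : ℝ) 1, ∫⁻ u, ENNReal.ofReal (kappa (shift a ω) (pt 0 u))⁻¹
      ∂(sectionMeasure (shift a ω) 0) ≤
      2 * (μH[1] : Measure Plane) (frontier ω.tube ∩ Metric.closedBall 0 (1 + M)) := by
  obtain ⟨R, hRm, hRreg, hR0⟩ := exists_measurable_regular hR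
  have hnm := measurable_indicator_normal hRm hRreg
  set Y : Set Plane := R ∩ Metric.closedBall 0 (1 + M) with hY
  have hYm : MeasurableSet Y := hRm.inter Metric.isClosed_closedBall.measurableSet
  have hκm : Measurable fun y => |R.indicator (normal ω.tube) y 1| := by
    have : Measurable fun v : Plane => |v 1| :=
      (by fun_prop : Continuous fun v : Plane => |v 1|).measurable
    exact this.comp hnm
  have hκ : ∀ y ∈ R, |R.indicator (normal ω.tube) y 1| = kappa ω y := fun y hy => by
    rw [indicator_of_mem hy, kappa_eq]
  have hκpos : ∀ y ∈ R, 0 < kappa ω y ∧ kappa ω y ≤ 1 := by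
    intro y hy
    rw [kappa_eq]
    have := mem_regularPoints_iff.1 (hRreg hy)
    refine ⟨abs_pos.2 this.2, ?_⟩
    rw [← (this.1.isInnerNormal_normal ω.isOpen_tube).1]
    exact abs_one_le_norm _
  set D : ℕ → ℤ × ℕ → Set Plane := fun n i =>
    Y ∩ {y | ⌊(n : ℝ) * y 1⌋ = i.1 ∧ ⌊|R.indicator (normal ω.tube) y 1|⁻¹⌋₊ = i.2} with hD
  have hDm : ∀ n i, MeasurableSet (D n i) := by
    intro n i
    have h1 : Measurable fun y : Plane => ⌊(n : ℝ) * y 1⌋ :=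
      Int.measurable_floor.comp
        (by fun_prop : Continuous fun y : Plane => (n : ℝ) * y 1).measurable
    have h2 : Measurable fun y : Plane => ⌊|R.indicator (normal ω.tube) y 1|⁻¹⌋₊ :=
      Nat.measurable_floor.comp hκm.inv
    exact hYm.inter ((h1 (measurableSet_singleton i.1)).inter (h2 (measurableSet_singleton i.2)))
  have hDd : ∀ n, Pairwise (Function.onFun Disjoint (D n)) := by
    rintro n ⟨j, k⟩ ⟨j', k'⟩ hne
    rw [Function.onFun, Set.disjoint_left]
    rintro y ⟨-, h1, h2⟩ ⟨-, h3, h4⟩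
    exact hne (Prod.ext (h1.symm.trans h3) (h2.symm.trans h4))
  -- A weighted count of the cells that meet the section over a. Measurable hulls are used since
  -- projections of cells need not be measurable.
  set h : ℕ → ℝ → ℝ≥0∞ := fun n a => ∑' i : ℤ × ℕ, ((i.2 : ℝ≥0∞) + 1) *
    (toMeasurable volume ((fun y : Plane => y 0) '' D n i)).indicator 1 a with hh
  have hwm : ∀ n (i : ℤ × ℕ), Measurable fun a : ℝ => ((i.2 : ℝ≥0∞) + 1) *
      (toMeasurable volume ((fun y : Plane => y 0) '' D n i)).indicator 1 a := fun n i =>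
    measurable_const.mul (measurable_one.indicator (measurableSet_toMeasurable _ _))
  have hhm : ∀ n, Measurable (h n) := fun n => Measurable.tsum fun i =>
    hwm n i
  have hint : ∀ n, ∫⁻ a, h n a ≤
      2 * (μH[1] : Measure Plane) (frontier ω.tube ∩ Metric.closedBall 0 (1 + M)) := by
    intro n
    rw [hh, lintegral_tsum fun i => (hwm n i).aemeasurable]
    have hterm : ∀ i : ℤ × ℕ, ∫⁻ a, ((i.2 : ℝ≥0∞) + 1) *
        (toMeasurable volume ((fun y : Plane => y 0) '' D n i)).indicator 1 a ≤
        2 * (μH[1] : Measure Plane) (D n i) := by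
      intro i
      rw [lintegral_const_mul _ (measurable_one.indicator (measurableSet_toMeasurable _ _)),
        lintegral_indicator_one (measurableSet_toMeasurable _ _), measure_toMeasurable]
      rcases (D n i).eq_empty_or_nonempty with h0 | ⟨y₀, hy₀⟩
      · simp [h0]
      -- Since κ ≤ 1, the integer part k of κ⁻¹ is at least 1 and (k + 1)/k ≤ 2.
      have hk1 : 1 ≤ i.2 := by
        rw [← hy₀.2.2, hκ _ hy₀.1.1]
        exact Nat.le_floor (by
          rw [Nat.cast_one]; exact (one_le_inv₀ (hκpos _ hy₀.1.1).1).2 (hκpos _ hy₀.1.1).2)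
      have hk0 : (0 : ℝ) < i.2 := by exact_mod_cast hk1
      have hv := volume_coord_image_le hε hL hRreg (D := D n i) (fun y hy => hy.1.1)
        (c := (i.2 : ℝ≥0)⁻¹) (by
          intro y hy
          have h1 := hκpos y hy.1.1
          have h2 : (i.2 : ℝ) ≤ (kappa ω y)⁻¹ := by
            rw [← hy.2.2, hκ _ hy.1.1]
            exact Nat.floor_le (inv_nonneg.2 h1.1.le)
          push_cast
          exact (le_inv_comm₀ hk0 h1.1).1 h2)
      calc ((i.2 : ℝ≥0∞) + 1) * volume ((fun y : Plane => y 0) '' D n i)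
          ≤ ((i.2 : ℝ≥0∞) + 1) * (((i.2 : ℝ≥0)⁻¹ : ℝ≥0) * (μH[1] : Measure Plane) (D n i)) := by
            gcongr
        _ = (((i.2 : ℝ≥0) + 1) * (i.2 : ℝ≥0)⁻¹ : ℝ≥0) * (μH[1] : Measure Plane) (D n i) := by
            rw [← mul_assoc]; push_cast; rfl
        _ ≤ 2 * (μH[1] : Measure Plane) (D n i) := by
            gcongr
            have h1 : (1 : ℝ≥0) ≤ i.2 := by exact_mod_cast hk1
            have h2 : (0 : ℝ≥0) < i.2 := by exact_mod_cast hk1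
            have : ((i.2 : ℝ≥0) + 1) * (i.2 : ℝ≥0)⁻¹ ≤ 2 := by
              rw [← div_eq_mul_inv, div_le_iff₀ h2, two_mul]
              gcongr
            exact_mod_cast this
    calc _ ≤ ∑' i : ℤ × ℕ, 2 * (μH[1] : Measure Plane) (D n i) := ENNReal.tsum_le_tsum hterm
      _ = 2 * (μH[1] : Measure Plane) (⋃ i, D n i) := by
          rw [ENNReal.tsum_mul_left, measure_iUnion (hDd n) (hDm n)]
      _ ≤ _ := by
          gcongr
          exact iUnion_subset fun i y hy => ⟨(hRreg hy.1.1).1, hy.1.2⟩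
  have hpt : ∀ᵐ a ∂(volume.restrict (Ioo (0 : ℝ) 1)),
      ∫⁻ u, ENNReal.ofReal (kappa (shift a ω) (pt 0 u))⁻¹ ∂(sectionMeasure (shift a ω) 0) ≤
        liminf (fun n => h n a) atTop := by
    filter_upwards [ae_restrict_of_ae (ae_section_regular hR0), ae_restrict_mem measurableSet_Ioo]
      with a ha ha01
    rw [lintegral_sectionMeasure]
    simp only [kappa_shift]
    -- Once 1/n is below the separation of the section, its boundary points lie in different cells
    -- and h n a dominates the sum of κ⁻¹. The threshold depends on a, hence the lower limit and
    -- Fatou's lemma.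
    obtain ⟨N, hN, hsep⟩ := ((shift a ω).sec 0).lipschitz
    refine le_liminf_of_le (by isBoundedDefault) ?_
    filter_upwards [eventually_ge_atTop N] with n hn
    set s := ((shift a ω).finite_frontier_slice 0).toFinset with hs
    have hmemR : ∀ u ∈ s, pt a u ∈ R := by
      intro u hu
      rw [hs, Finite.mem_toFinset, slice_shift, zero_add] at hu
      exact ha _ (ω.mem_frontier_tube_of_slice hu) rfl
    have hmemY : ∀ u ∈ s, pt a u ∈ Y := by
      intro u hu
      refine ⟨hmemR u hu, ?_⟩
      have hcl : IsClosed {x : Plane | |x 1| ≤ M} := isClosed_le (by fun_prop) continuous_const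
      have hM : |u| ≤ M := closure_minimal (fun x hx => ω.abs_le_of_mem_tube hx) hcl
        (frontier_subset_closure (hRreg (hmemR u hu)).1)
      rw [mem_closedBall_zero_iff]
      refine (norm_le_abs_add_abs _).trans ?_
      simp only [pt_zero, pt_one]
      have : |a| ≤ 1 := abs_le.2 ⟨by linarith [ha01.1], ha01.2.le⟩
      linarith
    set φ : ℝ → ℤ × ℕ := fun u =>
      (⌊(n : ℝ) * u⌋, ⌊|R.indicator (normal ω.tube) (pt a u) 1|⁻¹⌋₊) with hφ
    have hφinj : Set.InjOn φ s := by
      intro u hu v hv he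
      by_contra hne
      have hu' : u ∈ frontier ((shift a ω).slice 0) := by simpa [hs] using hu
      have hv' : v ∈ frontier ((shift a ω).slice 0) := by simpa [hs] using hv
      have hN0 : (0 : ℝ) < N := by exact_mod_cast hN
      refine floor_ne_of_lt_dist (hN.trans hn) (lt_of_le_of_lt ?_ (hsep hu' hv' hne))
        (congrArg Prod.fst he)
      gcongr
    calc ∑ u ∈ s, ENNReal.ofReal (kappa ω (pt a u))⁻¹
        ≤ ∑ u ∈ s, (fun i : ℤ × ℕ => ((i.2 : ℝ≥0∞) + 1) *
            (toMeasurable volume ((fun y : Plane => y 0) '' D n i)).indicator 1 a) (φ u) := by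
          refine Finset.sum_le_sum fun u hu => ?_
          have hmem : a ∈ toMeasurable volume ((fun y : Plane => y 0) '' D n (φ u)) :=
            subset_toMeasurable _ _ ⟨pt a u, ⟨hmemY u hu, rfl, rfl⟩, rfl⟩
          simp only [indicator_of_mem hmem, Pi.one_apply, mul_one]
          rw [hφ]
          simp only [hκ _ (hmemR u hu)]
          rw [← Nat.cast_add_one, ← ENNReal.ofReal_natCast]
          refine ENNReal.ofReal_le_ofReal ?_
          push_cast
          exact (Nat.lt_floor_add_one _).le
      _ = ∑ i ∈ s.image φ, ((i.2 : ℝ≥0∞) + 1) *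
            (toMeasurable volume ((fun y : Plane => y 0) '' D n i)).indicator 1 a :=
          (Finset.sum_image (f := fun i : ℤ × ℕ => ((i.2 : ℝ≥0∞) + 1) *
            (toMeasurable volume ((fun y : Plane => y 0) '' D n i)).indicator 1 a) hφinj).symm
      _ ≤ h n a := ENNReal.sum_le_tsum _
  calc _ ≤ ∫⁻ a in Ioo (0 : ℝ) 1, liminf (fun n => h n a) atTop := lintegral_mono_ae hpt
    _ ≤ ∫⁻ a, liminf (fun n => h n a) atTop := setLIntegral_le_lintegral _ _
    _ ≤ liminf (fun n => ∫⁻ a, h n a) atTop := lintegral_liminf_le hhm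
    _ ≤ liminf (fun _ : ℕ => 2 * (μH[1] : Measure Plane)
          (frontier ω.tube ∩ Metric.closedBall 0 (1 + M))) atTop :=
        liminf_le_liminf (Eventually.of_forall hint)
    _ = _ := liminf_const _

/-- Stationarity, for integrals over a unit interval of shifts. -/
theorem lintegral_eq_lintegral_shift {P : Measure (Env M)} [IsProbabilityMeasure P]
    (hstat : IsStationary P) {g : Env M → ℝ≥0∞} (hg : Measurable g) :
    ∫⁻ ω, g ω ∂P = ∫⁻ ω, (∫⁻ a in Ioo (0 : ℝ) 1, g (shift a ω)) ∂P := by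
  have hjoint : Measurable fun p : Env M × ℝ => g (shift p.2 p.1) :=
    hg.comp (measurable_shift.comp measurable_swap)
  rw [lintegral_lintegral_swap hjoint.aemeasurable]
  have : ∀ a : ℝ, ∫⁻ ω, g (shift a ω) ∂P = ∫⁻ ω, g ω ∂P := fun a =>
    (hstat a).lintegral_comp hg
  simp [this]

theorem Z_ne_top {P : Measure (Env M)} [IsProbabilityMeasure P] (hstat : IsStationary P)
    (hL : ConditionL P) (hR : ConditionR P) : Z P ≠ ∞ := by
  obtain ⟨ε, L, hε, hL⟩ := hL
  obtain ⟨C, hC, hCb⟩ := exists_hausdorffMeasure_frontier_le hε L (1 + M)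
  -- The inner integral is not shown to be measurable in the environment, so stationarity is applied
  -- to a measurable minorant with the same integral.
  obtain ⟨g, hgm, hgle, hgeq⟩ := exists_measurable_le_lintegral_eq P fun ω : Env M =>
    ∫⁻ u, ENNReal.ofReal (kappa ω (pt 0 u))⁻¹ ∂(sectionMeasure ω 0)
  have : Z P ≤ ∫⁻ _ : Env M, 2 * C ∂P := by
    rw [Z, hgeq, lintegral_eq_lintegral_shift hstat hgm]
    refine lintegral_mono_ae ?_
    filter_upwards [hL, hR] with ω hLω hRω
    calc ∫⁻ a in Ioo (0 : ℝ) 1, g (shift a ω)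
        ≤ ∫⁻ a in Ioo (0 : ℝ) 1, ∫⁻ u, ENNReal.ofReal (kappa (shift a ω) (pt 0 u))⁻¹
            ∂(sectionMeasure (shift a ω) 0) := lintegral_mono fun a => hgle (shift a ω)
      _ ≤ _ := lintegral_sum_inv_kappa_le hε hLω hRω
      _ ≤ 2 * C := by gcongr; exact hCb _ ω.isOpen_tube hLω
  refine ne_top_of_le_ne_top ?_ this
  simp only [lintegral_const, measure_univ, mul_one]
  exact ENNReal.mul_ne_top ENNReal.ofNat_ne_top hC


/-! ### Leaving the closure of the tube, and positivity of the cosine constant. -/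

/-- Needed with the closure because limits of rays inside the tube are only known to lie in its
closure. -/
theorem IsInnerNormal.eventually_notMem_closure {A : Set Plane} {x n v : Plane}
    (h : IsInnerNormal A x n) (hv : 0 < ⟪v, n⟫) : ∀ᶠ t in 𝓝[>] (0 : ℝ), x - t • v ∉ closure A := by
  have hv0 : 0 < ‖v‖ := norm_pos_iff.2 (by rintro rfl; simp at hv)
  set c := ⟪v, n⟫ / (2 * ‖v‖) with hc
  have hcpos : 0 < c := by positivity
  obtain ⟨r, hr, hr'⟩ := Metric.eventually_nhds_iff_ball.1 (h.2 c hcpos)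
  have hopen : IsOpen ({y | ⟪y - x, n⟫ < -(c * ‖y - x‖)} ∩ Metric.ball x r) :=
    (isOpen_lt (by fun_prop) (by fun_prop)).inter Metric.isOpen_ball
  have h2 : Tendsto (fun t : ℝ => x - t • v) (𝓝[>] 0) (𝓝 x) := by
    have : Continuous fun t : ℝ => x - t • v := by fun_prop
    simpa using (this.tendsto 0).mono_left nhdsWithin_le_nhds
  filter_upwards [h2.eventually (Metric.ball_mem_nhds x hr), self_mem_nhdsWithin] with t ht1 ht hcl
  rw [mem_Ioi] at ht
  have key : c * (t * ‖v‖) < t * ⟪v, n⟫ := by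
    have : c * (t * ‖v‖) = t * ⟪v, n⟫ / 2 := by rw [hc]; field_simp
    rw [this]
    linarith [mul_pos ht hv]
  obtain ⟨y, hy, hyA⟩ := mem_closure_iff.1 hcl _ hopen ⟨by
    rw [mem_ofPred_eq, show x - t • v - x = -(t • v) by abel, norm_neg, norm_smul,
      Real.norm_of_nonneg ht.le, inner_neg_left, inner_smul_left]
    simpa using key, ht1⟩
  exact (hr' y hy.2).2 hy.1 hyA

theorem gammaTwo_pos : 0 < gammaTwo := by
  unfold gammaTwo
  simp only [inner_e, pt_zero, integral_cos, Real.sin_neg, Real.sin_pi_div_two]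
  norm_num

/-! ### The slope of the segment to a boundary point -/

/-- The slope of the segment between `(0, u)` and `y`. -/
noncomputable def slopeTo (u : ℝ) (y : Plane) : ℝ := (y 1 - u) / y 0

theorem measurable_slopeTo (u : ℝ) : Measurable (slopeTo u) :=
  ((by fun_prop : Continuous fun y : Plane => y 1 - u).measurable).div
    (by fun_prop : Continuous fun y : Plane => y 0).measurable

theorem exists_lipschitzOnWith_slopeTo (u : ℝ) {y : Plane} (hy : 0 < y 0) :
    ∃ K, ∃ t ∈ 𝓝 y, LipschitzOnWith K (slopeTo u) t := by
  have : ContDiffAt ℝ 1 (slopeTo u) y := by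
    unfold slopeTo
    refine ContDiffAt.div ?_ ?_ hy.ne'
    · exact ((EuclideanSpace.proj (𝕜 := ℝ) (1 : Fin 2)).contDiff.sub contDiff_const).contDiffAt
    · exact (EuclideanSpace.proj (𝕜 := ℝ) (0 : Fin 2)).contDiff.contDiffAt
  exact this.exists_lipschitzOnWith

/-- The difference of slopes at y' and y is (y' - y)·w/(y' 0 · y 0) with w orthogonal to y - (0,u);
by `abs_inner_le_of_flat` the rate along the boundary is |(y - (0,u))·n|/(y 0)². -/
theorem eventually_dist_slopeTo_le {ω : Env M} (u : ℝ) {y : Plane} (hy : y ∈ regularPoints ω)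
    (hy0 : 0 < y 0) {η : ℝ} (hη : 0 < η) : ∀ᶠ y' in 𝓝[frontier ω.tube] y,
      dist (slopeTo u y') (slopeTo u y) ≤
        (|⟪y - pt 0 u, normal ω.tube y⟫| / y 0 ^ 2 + η) * dist y' y := by
  set n := normal ω.tube y
  set B := |⟪y - pt 0 u, n⟫| with hB
  set w : Plane := pt (-(y 1 - u)) (y 0) with hw
  set c : ℝ := η * y 0 ^ 2 / (2 * (‖w‖ + 1)) with hc
  have hcpos : 0 < c := by positivity
  obtain ⟨δ, hδ, h⟩ := hy.2.1.exists_abs_inner_le ω.isOpen_tube ω.regular' c hcpos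
  have hlim : Tendsto (fun y' : Plane => (B + c * ‖w‖) / (y' 0 * y 0)) (𝓝 y)
      (𝓝 ((B + c * ‖w‖) / (y 0 * y 0))) := by
    refine Tendsto.div tendsto_const_nhds ?_ (by positivity)
    exact ((by fun_prop : Continuous fun y' : Plane => y' 0 * y 0).tendsto y)
  have hlt : (B + c * ‖w‖) / (y 0 * y 0) < B / y 0 ^ 2 + η := by
    have h1 : c * ‖w‖ / (y 0 * y 0) < η := by
      rw [div_lt_iff₀ (by positivity), hc, div_mul_eq_mul_div, div_lt_iff₀ (by positivity)]
      have : 0 ≤ ‖w‖ := norm_nonneg w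
      have h2 : 0 < η * y 0 ^ 2 := by positivity
      nlinarith
    rw [add_div, ← sq]
    rw [← sq] at h1
    linarith
  filter_upwards [mem_nhdsWithin_of_mem_nhds (Metric.ball_mem_nhds y hδ), self_mem_nhdsWithin,
    mem_nhdsWithin_of_mem_nhds (hlim.eventually_lt_const hlt),
    mem_nhdsWithin_of_mem_nhds (((by fun_prop : Continuous fun y' : Plane => y' 0).tendsto
      y).eventually_const_lt hy0)] with y' hy'δ hy'A hy'lt hy'0
  have h1 := h y' hy'A y hy.1 hy'δ (Metric.mem_ball_self hδ)
  have h2 := abs_inner_le_of_flat (hy.2.1.isInnerNormal_normal ω.isOpen_tube).1 h1 w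
  have h3 : w 1 * n 0 - w 0 * n 1 = ⟪y - pt 0 u, n⟫ := by
    rw [inner_eq]; simp [hw]; ring
  rw [h3, ← hB] at h2
  have h4 : slopeTo u y' - slopeTo u y = ⟪y' - y, w⟫ / (y' 0 * y 0) := by
    rw [inner_eq]
    simp only [slopeTo, hw, PiLp.sub_apply, pt_zero, pt_one]
    field_simp
    ring
  have hpos : 0 < y' 0 * y 0 := mul_pos hy'0 hy0
  rw [Real.dist_eq, h4, abs_div, abs_of_pos hpos, dist_eq_norm y' y, div_le_iff₀ hpos]
  refine h2.trans ?_
  have h5 : B + c * ‖w‖ ≤ (B / y 0 ^ 2 + η) * (y' 0 * y 0) := (div_le_iff₀ hpos).1 hy'lt.le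
  calc (B + c * ‖w‖) * ‖y' - y‖ ≤ ((B / y 0 ^ 2 + η) * (y' 0 * y 0)) * ‖y' - y‖ := by gcongr
    _ = _ := by ring

/-- The boundary points to the right of the vertical axis that are not in `R` or at which the ray
from `(0, u)` is tangential. -/
def badPoints (ω : Env M) (R : Set Plane) (u : ℝ) : Set Plane :=
  {y | y ∈ frontier ω.tube ∧ 0 < y 0 ∧ (y ∉ R ∨ ⟪y - pt 0 u, normal ω.tube y⟫ = 0)}

/-- Points outside R form a null set, preserved by the locally Lipschitz slope. At tangential points
the slope has derivative zero along the boundary, so a Sard-type argument applies. -/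
theorem volume_slopeTo_badPoints {ω : Env M} {ε : ℝ} {L : ℝ≥0} (hε : 0 < ε)
    (hL : HasLipschitzBoundary ε L ω.tube) {R : Set Plane} (hRreg : R ⊆ regularPoints ω)
    (hR0 : (μH[1] : Measure Plane) (frontier ω.tube \ R) = 0) (u : ℝ) :
    volume (slopeTo u '' badPoints ω R u) = 0 := by
  set E₁ : Set Plane := {y | y ∈ frontier ω.tube \ R ∧ 0 < y 0} with hE₁
  set E₂ : Set Plane := {y | y ∈ R ∧ 0 < y 0 ∧ ⟪y - pt 0 u, normal ω.tube y⟫ = 0} with hE₂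
  have hsub : badPoints ω R u ⊆ E₁ ∪ E₂ := by
    rintro y ⟨hy, hy0, h⟩
    by_cases hyR : y ∈ R
    · exact Or.inr ⟨hyR, hy0, h.resolve_left fun h => h hyR⟩
    · exact Or.inl ⟨⟨hy, hyR⟩, hy0⟩
  refine measure_mono_null (image_mono hsub) ?_
  rw [image_union]
  refine measure_union_null ?_ ?_
  · refine volume_image_eq_zero_of_locally fun y hy => ?_
    obtain ⟨K, t, ht, hK⟩ := exists_lipschitzOnWith_slopeTo u hy.2
    refine ⟨t, ht, le_antisymm ((volume_image_le_mul_hausdorffMeasure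
      (hK.mono inter_subset_right)).trans ?_) zero_le⟩
    rw [measure_mono_null (fun y hy => hy.1.1) hR0, mul_zero]
  · have hE₂f : E₂ ⊆ frontier ω.tube := fun y hy => (hRreg hy.1).1
    have := sigmaFinite_restrict_of_subset_frontier ω.isOpen_tube hε hL hE₂f
    refine le_antisymm ((volume_image_le_lintegral (J := fun _ => 0) measurable_const
      fun y hy η hη => ?_).trans (by simp)) zero_le
    have := eventually_dist_slopeTo_le u (hRreg hy.1) hy.2.1 hη
    rw [hy.2.2, abs_zero, zero_div] at this
    exact (this.filter_mono (nhdsWithin_mono _ hE₂f))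

/-! ### A lower bound for the second moment of the jump -/

/-- The points of `R` seen from `(0, u)` with a slope between `0` and `1` and at a horizontal
distance of at least `δ` divided by the slope. -/
def farPoints (ω : Env M) (R : Set Plane) (δ u : ℝ) : Set Plane :=
  {y | y ∈ R ∧ 0 < y 0 ∧ slopeTo u y ∈ Ioo 0 1 ∧ δ / slopeTo u y ≤ y 0 ∧
    0 < ⟪y - pt 0 u, normal ω.tube (pt 0 u)⟫ ∧
    ∀ t ∈ Ioo (0 : ℝ) 1, pt 0 u + t • (y - pt 0 u) ∈ ω.tube}

theorem measurableSet_farPoints (ω : Env M) {R : Set Plane} (hR : MeasurableSet R) (δ u : ℝ) :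
    MeasurableSet (farPoints ω R δ u) := by
  have h0 : Measurable fun y : Plane => y 0 :=
    (by fun_prop : Continuous fun y : Plane => y 0).measurable
  have hs := measurable_slopeTo u
  have hin : Measurable fun y : Plane => ⟪y - pt 0 u, normal ω.tube (pt 0 u)⟫ :=
    (by fun_prop : Continuous fun y : Plane =>
      ⟪y - pt 0 u, normal ω.tube (pt 0 u)⟫).measurable
  -- Visibility along each compact subsegment is an open condition on y, and countably many
  -- subsegments suffice.
  have hseg : {y : Plane | ∀ t ∈ Ioo (0 : ℝ) 1, pt 0 u + t • (y - pt 0 u) ∈ ω.tube} =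
      ⋂ j : ℕ, {y : Plane | ∀ t ∈ Icc (1 / ((j : ℝ) + 1)) (1 - 1 / ((j : ℝ) + 1)),
        pt 0 u + t • (y - pt 0 u) ∈ ω.tube} := by
    ext y
    simp only [mem_ofPred_eq, mem_iInter]
    constructor
    · intro h j t ht
      have : (0 : ℝ) < 1 / ((j : ℝ) + 1) := by positivity
      exact h t ⟨by linarith [ht.1], by linarith [ht.2]⟩
    · intro h t ht
      obtain ⟨j, hj⟩ := exists_nat_one_div_lt (lt_min ht.1 (sub_pos.2 ht.2))
      rw [lt_min_iff] at hj
      exact h j t ⟨hj.1.le, by linarith [hj.2]⟩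
  have hsegm : MeasurableSet
      {y : Plane | ∀ t ∈ Ioo (0 : ℝ) 1, pt 0 u + t • (y - pt 0 u) ∈ ω.tube} := by
    rw [hseg]
    refine MeasurableSet.iInter fun j => IsOpen.measurableSet ?_
    rw [isOpen_iff_eventually]
    intro y hy
    refine isCompact_Icc.eventually_forall_of_forall_eventually fun t ht => ?_
    have hc : Continuous fun z : Plane × ℝ => pt 0 u + z.2 • (z.1 - pt 0 u) := by fun_prop
    exact (hc.tendsto (y, t)).eventually (ω.isOpen_tube.mem_nhds (hy t ht))
  exact hR.inter ((measurableSet_lt measurable_const h0).inter ((hs measurableSet_Ioo).inter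
    ((measurableSet_le (measurable_const.div hs) h0).inter
      ((measurableSet_lt measurable_const hin).inter hsegm))))

/-- Change of variables from y to its slope s. The Jacobian |(y - x)·n(y)|/(y 0)² absorbs the second
cosine factor of `K`, the first one equals (y 0)(n 0 + s n 1), and y 0 ≥ δ/s for far points. The
constant 1/3 stems from ‖x - y‖³ ≤ 2√2 (y 0)³ ≤ 3 (y 0)³ when 0 < s < 1. -/
theorem le_b {ω : Env M} {ε : ℝ} {L : ℝ≥0} (hε : 0 < ε) (hL : HasLipschitzBoundary ε L ω.tube)
    {R : Set Plane} (hR : MeasurableSet R) (hRreg : R ⊆ regularPoints ω) {δ : ℝ} (hδ : 0 < δ)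
    {u : ℝ} (hx : pt 0 u ∈ regularPoints ω) :
    ∫⁻ s in slopeTo u '' farPoints ω R δ u, ENNReal.ofReal (gammaTwo / 3 * (δ / s) ^ 2 *
      (normal ω.tube (pt 0 u) 0 + s * normal ω.tube (pt 0 u) 1)) ≤ b ω u := by
  set x := pt 0 u with hxdef
  set n := normal ω.tube x with hn
  set Y := farPoints ω R δ u with hY
  have hYR : Y ⊆ R := fun y hy => hy.1
  have hYf : Y ⊆ frontier ω.tube := fun y hy => (hRreg hy.1).1
  have hYm : MeasurableSet Y := measurableSet_farPoints ω hR δ u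
  have := sigmaFinite_restrict_of_subset_frontier ω.isOpen_tube hε hL hYf
  set J : Plane → ℝ≥0 := fun y => Real.toNNReal
    (|⟪y - x, R.indicator (normal ω.tube) y⟫| / y 0 ^ 2) with hJ
  have hJm : Measurable J := by
    refine Measurable.real_toNNReal (Measurable.div ?_ ?_)
    · have h1 : Measurable fun y : Plane => ⟪y - x, R.indicator (normal ω.tube) y⟫ :=
        (measurable_id.sub_const x).inner (measurable_indicator_normal hR hRreg)
      exact continuous_abs.measurable.comp h1
    · exact (by fun_prop : Continuous fun y : Plane => y 0 ^ 2).measurable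
  have hJv : ∀ y ∈ Y, (J y : ℝ) = |⟪y - x, normal ω.tube y⟫| / y 0 ^ 2 := by
    intro y hy
    rw [hJ]
    simp only [indicator_of_mem (hYR hy)]
    exact Real.coe_toNNReal _ (by positivity)
  set G : ℝ → ℝ≥0∞ := fun s => ENNReal.ofReal (gammaTwo / 3 * (δ / s) ^ 2 * (n 0 + s * n 1))
    with hG
  have hGm : Measurable G := by
    refine ENNReal.measurable_ofReal.comp ?_
    exact ((measurable_const.mul ((measurable_const.div measurable_id).pow_const 2))).mul
      (measurable_const.add (measurable_id.mul_const _))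
  refine (lintegral_image_le_lintegral (measurable_slopeTo u) hJm (fun y hy η hη => ?_) hGm).trans ?_
  · rw [hJv y hy]
    exact (eventually_dist_slopeTo_le u (hRreg (hYR hy)) hy.2.1 hη).filter_mono
      (nhdsWithin_mono _ hYf)
  have hres : ∫⁻ y in Y, J y * G (slopeTo u y) ∂μH[1] =
      ∫⁻ y in Y, J y * G (slopeTo u y) ∂(boundaryMeasure ω) := by
    rw [boundaryMeasure, Measure.restrict_restrict_of_subset hYf]
  rw [hres]
  refine (setLIntegral_mono' hYm fun y hy => ?_).trans (setLIntegral_le_lintegral _ _)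
  obtain ⟨hyR, hy0, ⟨hs0, hs1⟩, hys, hyn, hseg⟩ := hy
  set s := slopeTo u y with hs
  have hyx1 : y 1 - u = s * y 0 := by rw [hs, slopeTo, div_mul_cancel₀ _ hy0.ne']
  have hnormsq : ‖x - y‖ ^ 2 = y 0 ^ 2 * (1 + s ^ 2) := by
    rw [norm_sq_eq]
    simp only [hxdef, PiLp.sub_apply, pt_zero, pt_one]
    rw [← neg_sub (y 1) u, hyx1]
    ring
  have hyx : y - x ≠ 0 := by
    intro h0
    have := congrArg (fun v : Plane => v 0) h0
    simp [hxdef] at this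
    exact hy0.ne' this
  have hnpos : 0 < ‖y - x‖ := norm_pos_iff.2 hyx
  have hseen : Seen ω x y := by
    refine ⟨‖y - x‖⁻¹ • (y - x), ‖y - x‖, ?_, hnpos, fun t ht => ?_, ?_⟩
    · rw [norm_smul, norm_inv, norm_norm, inv_mul_cancel₀ hnpos.ne']
    · rw [smul_smul, ← div_eq_mul_inv]
      exact hseg _ ⟨div_pos ht.1 hnpos, (div_lt_one hnpos).2 ht.2⟩
    · rw [smul_smul, mul_inv_cancel₀ hnpos.ne', one_smul, add_sub_cancel]
  have hyreg := hRreg hyR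
  set m := normal ω.tube y with hm
  -- The segment reaches y from inside the tube, which an outward normal component of x - y would
  -- forbid.
  have hsign : 0 ≤ ⟪x - y, m⟫ := by
    by_contra! hneg
    have hin := hyreg.2.1.isInnerNormal_normal ω.isOpen_tube
    have hpos : 0 < ⟪y - x, m⟫ := by rw [← neg_sub x y, inner_neg_left]; linarith
    have hev : ∀ᶠ t in 𝓝[>] (0 : ℝ), t < 1 :=
      mem_nhdsWithin_of_mem_nhds (Iio_mem_nhds one_pos)
    obtain ⟨t, ⟨ht1, ht2⟩, ht3⟩ := ((hin.eventually_mem hpos).and hev).and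
      self_mem_nhdsWithin |>.exists
    refine ht1.2 ?_
    have := hseg (1 - t) ⟨by linarith, by linarith⟩
    convert this using 1
    rw [← hxdef]; module
  have habs : |⟪y - x, m⟫| = ⟪x - y, m⟫ := by
    rw [← neg_sub x y, inner_neg_left, abs_neg, abs_of_nonneg hsign]
  have hK : K ω x y = gammaTwo * (⟪y - x, n⟫ * ⟪x - y, m⟫) / ‖x - y‖ ^ 3 := by
    rw [K, if_pos ⟨hx, hyreg, hseen⟩]
  have hyxn : ⟪y - x, n⟫ = y 0 * (n 0 + s * n 1) := by
    rw [inner_eq]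
    simp only [hxdef, PiLp.sub_apply, pt_zero, pt_one, sub_zero]
    rw [hyx1]; ring
  have hns : 0 < n 0 + s * n 1 := by
    have h1 : 0 < y 0 * (n 0 + s * n 1) := hyxn ▸ hyn
    exact pos_of_mul_pos_right h1 hy0.le
  have hcube : ‖x - y‖ ^ 3 ≤ 3 * y 0 ^ 3 := by
    have h1 : ‖x - y‖ ≤ √2 * y 0 := by
      refine le_of_sq_le_sq ?_ (by positivity)
      rw [hnormsq, mul_pow, Real.sq_sqrt (by norm_num)]
      have : s ^ 2 ≤ 1 := by nlinarith
      nlinarith [sq_nonneg (y 0)]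
    calc ‖x - y‖ ^ 3 ≤ (√2 * y 0) ^ 3 := by gcongr
      _ = √2 ^ 2 * √2 * y 0 ^ 3 := by ring
      _ ≤ 3 * y 0 ^ 3 := by
          rw [Real.sq_sqrt (by norm_num)]
          have : √2 ≤ 3 / 2 := by
            rw [Real.sqrt_le_left (by norm_num)]; norm_num
          gcongr
          linarith
  have hxy : 0 < ‖x - y‖ := by rwa [norm_sub_rev]
  have hγ := gammaTwo_pos
  rw [inner_e, sub_zero, hK, hyxn, ← ENNReal.ofReal_coe_nnreal, hJv y ⟨hyR, hy0, ⟨hs0, hs1⟩, hys, hyn, hseg⟩,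
    habs, hG, ← ENNReal.ofReal_mul (by positivity)]
  refine ENNReal.ofReal_le_ofReal ?_
  have hds : (δ / s) ^ 2 ≤ y 0 ^ 2 := by gcongr
  calc ⟪x - y, m⟫ / y 0 ^ 2 * (gammaTwo / 3 * (δ / s) ^ 2 * (n 0 + s * n 1))
      ≤ ⟪x - y, m⟫ / y 0 ^ 2 * (gammaTwo / 3 * y 0 ^ 2 * (n 0 + s * n 1)) := by gcongr
    _ = y 0 ^ 2 * (gammaTwo * (y 0 * (n 0 + s * n 1) * ⟪x - y, m⟫) / (3 * y 0 ^ 3)) := by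
        field_simp
    _ ≤ _ := by gcongr

/-- A ray that stays in the closure of the tube up to the height `q` ends in a far point, unless
it runs through a bad point. -/
theorem mem_slopeTo_farPoints {ω : Env M} {R : Set Plane} (hRreg : R ⊆ regularPoints ω)
    {u s p q : ℝ} (hs : s ∈ Ioo (0 : ℝ) 1) (hup : u ≤ p) (hpq : p < q)
    (hbad : s ∉ slopeTo u '' badPoints ω R u)
    (hpos : 0 < ⟪pt 1 s, normal ω.tube (pt 0 u)⟫)
    (hcl : ∀ r ∈ Ioo 0 ((q - u) / s), pt 0 u + r • pt 1 s ∈ closure ω.tube) :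
    s ∈ slopeTo u '' farPoints ω R (q - p) u := by
  set x := pt 0 u with hx
  set z : ℝ → Plane := fun r => x + r • pt 1 s with hz
  have hzc : Continuous z := by fun_prop
  have hz0 : ∀ r, z r 0 = r := fun r => by simp [hz, hx]
  have hz1 : ∀ r, z r 1 = u + r * s := fun r => by simp [hz, hx]
  have hslope : ∀ r, 0 < r → slopeTo u (z r) = s := by
    intro r hr
    rw [slopeTo, hz0, hz1, add_sub_cancel_left, mul_div_cancel_left₀ _ hr.ne']
  have hgood : ∀ r, 0 < r → z r ∈ frontier ω.tube →
      z r ∈ R ∧ ⟪pt 1 s, normal ω.tube (z r)⟫ ≠ 0 := by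
    intro r hr hfr
    have : z r ∉ badPoints ω R u := fun hb => hbad ⟨_, hb, hslope r hr⟩
    simp only [badPoints, mem_ofPred_eq, not_and, not_or, not_not] at this
    have h := this hfr (by rwa [hz0])
    refine ⟨h.1, fun h0 => h.2 ?_⟩
    rw [hz]
    simp only [← hx, add_sub_cancel_left, inner_smul_left]
    rw [hz] at h0
    simp only at h0
    rw [h0, mul_zero]
  -- Since s is not bad, the ray crosses the boundary transversally wherever it touches it, and
  -- would leave the closure on one of the two sides.
  have hin : ∀ r ∈ Ioo 0 ((q - u) / s), z r ∈ ω.tube := by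
    intro r hr
    by_contra hout
    have hfr : z r ∈ frontier ω.tube := by
      rw [ω.isOpen_tube.frontier_eq]; exact ⟨hcl r hr, hout⟩
    obtain ⟨hR, hne⟩ := hgood r hr.1 hfr
    have hnor := (hRreg hR).2.1.isInnerNormal_normal ω.isOpen_tube
    rcases lt_or_gt_of_ne hne with hneg | hpos
    · have hev : ∀ᶠ t in 𝓝[>] (0 : ℝ), t < (q - u) / s - r :=
        mem_nhdsWithin_of_mem_nhds (Iio_mem_nhds (by linarith [hr.2]))
      have hpos' : 0 < ⟪-pt 1 s, normal ω.tube (z r)⟫ := by rw [inner_neg_left]; linarith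
      obtain ⟨t, ⟨ht1, ht2⟩, ht3⟩ := ((hnor.eventually_notMem_closure hpos').and hev).and
        self_mem_nhdsWithin |>.exists
      refine ht1 ?_
      have := hcl (r + t) ⟨by linarith [hr.1], by linarith⟩
      convert this using 1
      rw [hz]; module
    · have hev : ∀ᶠ t in 𝓝[>] (0 : ℝ), t < r :=
        mem_nhdsWithin_of_mem_nhds (Iio_mem_nhds hr.1)
      obtain ⟨t, ⟨ht1, ht2⟩, ht3⟩ := ((hnor.eventually_notMem_closure hpos).and hev).and
        self_mem_nhdsWithin |>.exists
      refine ht1 ?_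
      have := hcl (r - t) ⟨by linarith, by linarith [hr.2]⟩
      convert this using 1
      rw [hz]; module
  have hℓ : 0 < (q - u) / s := div_pos (by linarith) hs.1
  set T : Set ℝ := {r | 0 < r ∧ ∀ r' ∈ Ioo 0 r, z r' ∈ ω.tube} with hT
  have hTℓ : (q - u) / s ∈ T := ⟨hℓ, hin⟩
  -- A ray of positive slope climbs above the height bound M after finite time, so there is a last
  -- abscissa r₀ and a boundary point there.
  have hTb : BddAbove T := by
    refine ⟨(M - u) / s, fun r hr => le_of_forall_lt fun r' hr' => ?_⟩
    obtain ⟨r'', h1, h2⟩ := exists_between (max_lt hr' hr.1)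
    rw [max_lt_iff] at h1
    have := ω.abs_le_of_mem_tube (hr.2 r'' ⟨h1.2, h2⟩)
    rw [hz1, abs_le] at this
    refine h1.1.trans_le ?_
    rw [le_div_iff₀ hs.1]
    linarith
  set r₀ := sSup T with hr₀
  have hr₀ℓ : (q - u) / s ≤ r₀ := le_csSup hTb hTℓ
  have hr₀pos : 0 < r₀ := hℓ.trans_le hr₀ℓ
  have hin' : ∀ r ∈ Ioo 0 r₀, z r ∈ ω.tube := by
    intro r hr
    obtain ⟨r', hr'T, hr'⟩ := exists_lt_of_lt_csSup ⟨_, hTℓ⟩ hr.2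
    exact hr'T.2 r ⟨hr.1, hr'⟩
  have hout : z r₀ ∉ ω.tube := by
    intro hmem
    obtain ⟨η, hη, hη'⟩ := Metric.mem_nhds_iff.1
      ((hzc.tendsto r₀).eventually (ω.isOpen_tube.mem_nhds hmem))
    have : r₀ + η ∈ T := by
      refine ⟨by linarith, fun r hr => ?_⟩
      by_cases hlt : r < r₀
      · exact hin' r ⟨hr.1, hlt⟩
      · refine hη' ?_
        rw [Metric.mem_ball, Real.dist_eq, abs_lt]
        constructor <;> linarith [hr.2]
    linarith [le_csSup hTb this]
  have hcl₀ : z r₀ ∈ closure ω.tube := by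
    refine mem_closure_of_tendsto (b := 𝓝[<] r₀)
      ((hzc.tendsto r₀).mono_left nhdsWithin_le_nhds) ?_
    filter_upwards [Ioo_mem_nhdsLT hr₀pos] with r hr using hin' r hr
  have hfr : z r₀ ∈ frontier ω.tube := by
    rw [ω.isOpen_tube.frontier_eq]; exact ⟨hcl₀, hout⟩
  refine ⟨z r₀, ⟨(hgood r₀ hr₀pos hfr).1, by rwa [hz0], by rwa [hslope _ hr₀pos], ?_, ?_, ?_⟩,
    hslope _ hr₀pos⟩
  · rw [hslope _ hr₀pos, hz0]
    refine le_trans ?_ hr₀ℓ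
    have := hs.1
    gcongr
  · rw [← hx]
    simp only [hz, add_sub_cancel_left, inner_smul_left]
    exact mul_pos hr₀pos hpos
  · intro t ht
    have := hin' (t * r₀) ⟨mul_pos ht.1 hr₀pos, mul_lt_of_lt_one_left hr₀pos ht.2⟩
    convert this using 1
    rw [← hx]; simp only [hz]; module


theorem continuous_pt {X : Type*} [TopologicalSpace X] {f g : X → ℝ} (hf : Continuous f)
    (hg : Continuous g) : Continuous fun x => pt (f x) (g x) := by
  unfold pt
  refine (PiLp.continuous_toLp 2 _).comp (continuous_pi fun i => ?_)
  fin_cases i <;> simpa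

/-! ### Chords through the strip -/

/-- The segment of slope `s` and horizontal length `r` that ends in `(0, p)` is in the tube. -/
def BackSegment (p s r : ℝ) (ω : Env M) : Prop :=
  ∀ r' ∈ Icc 0 r, pt (-r') (p - s * r') ∈ ω.tube

/-- A compact segment in the open tube has a uniform margin, and for a regular open tube the
containment of a ball can be tested on a dense sequence. This makes `BackSegment` a countable
condition, jointly measurable in the slope and the environment. -/
theorem backSegment_iff (p s : ℝ) (r : ℚ) (ω : Env M) : BackSegment p s r ω ↔
    ∃ k : ℕ, ∀ r' : ℚ, (r' : ℝ) ∈ Icc (0 : ℝ) r → ∀ j,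
      densePt j ∈ Metric.ball (pt (-r') (p - s * r')) (1 / ((k : ℝ) + 1)) →
        densePt j ∈ ω.tube := by
  simp only [← Env.ball_subset_tube]
  constructor
  · intro h
    have hc : Continuous fun r' : ℝ => pt (-r') (p - s * r') :=
      continuous_pt (by fun_prop) (by fun_prop)
    have hK : IsCompact ((fun r' : ℝ => pt (-r') (p - s * r')) '' Icc (0 : ℝ) r) :=
      isCompact_Icc.image hc
    have hsub : (fun r' : ℝ => pt (-r') (p - s * r')) '' Icc (0 : ℝ) r ⊆ ω.tube := by
      rintro _ ⟨r', hr', rfl⟩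
      exact h r' hr'
    obtain ⟨δ, hδ, hδ'⟩ := hK.exists_thickening_subset_open ω.isOpen_tube hsub
    obtain ⟨k, hk⟩ := exists_nat_one_div_lt hδ
    refine ⟨k, fun r' hr' => ?_⟩
    have hmem : pt (-(r' : ℝ)) (p - s * r') ∈
        (fun r' : ℝ => pt (-r') (p - s * r')) '' Icc (0 : ℝ) r := ⟨r', hr', rfl⟩
    exact ((Metric.ball_subset_ball hk.le).trans
      (Metric.ball_subset_thickening hmem δ)).trans hδ'
  · rintro ⟨k, hk⟩ r' hr'
    have hk0 : (0 : ℝ) < 1 / ((k : ℝ) + 1) := by positivity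
    rcases hr'.2.eq_or_lt with he | hlt
    · rw [he]
      exact hk r ⟨he ▸ hr'.1, le_rfl⟩ (Metric.mem_ball_self hk0)
    · obtain ⟨r'', h1, h2⟩ := exists_rat_btwn
        (show r' < min (r : ℝ) (r' + 1 / ((k : ℝ) + 1) / (1 + |s|)) from
          lt_min hlt (lt_add_of_pos_right _ (by positivity)))
      rw [lt_min_iff] at h2
      refine hk r'' ⟨hr'.1.trans h1.le, h2.1.le⟩ ?_
      rw [mem_ball_iff_norm]
      refine (norm_le_abs_add_abs _).trans_lt ?_
      simp only [PiLp.sub_apply, pt_zero, pt_one]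
      have h3 : (r'' - r') * (1 + |s|) < 1 / ((k : ℝ) + 1) := by
        rw [← lt_div_iff₀ (by positivity)]; linarith [h2.2]
      have e1 : |-r' - -(r'' : ℝ)| = r'' - r' := by
        rw [show -r' - -(r'' : ℝ) = r'' - r' by ring, abs_of_pos (by linarith)]
      have e2 : |p - s * r' - (p - s * r'')| = |s| * (r'' - r') := by
        rw [show p - s * r' - (p - s * r'') = s * (r'' - r') by ring, abs_mul,
          abs_of_pos (show 0 < (r'' : ℝ) - r' by linarith)]
      rw [e1, e2]
      linarith

theorem measurableSet_backSegment (p : ℝ) (r : ℚ) :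
    MeasurableSet {z : ℝ × Env M | BackSegment p z.1 r z.2} := by
  simp only [backSegment_iff, ofPred_exists, ofPred_forall]
  refine MeasurableSet.iUnion fun k => MeasurableSet.iInter fun r' => MeasurableSet.iInter fun _ =>
    MeasurableSet.iInter fun j => ?_
  simp only [imp_iff_not_or, ofPred_or]
  refine MeasurableSet.union (MeasurableSet.compl ?_)
    (measurableSet_mem_tube_of measurable_const measurable_snd)
  have hc : Continuous fun s : ℝ => pt (-(r' : ℝ)) (p - s * r') :=
    continuous_pt (by fun_prop) (by fun_prop)
  have : IsOpen {s : ℝ | densePt j ∈ Metric.ball (pt (-(r' : ℝ)) (p - s * r'))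
      (1 / ((k : ℝ) + 1))} := by
    simp only [Metric.mem_ball]
    exact isOpen_lt (continuous_const.dist hc) continuous_const
  exact measurable_fst this.measurableSet

/-- The horizontal distance of `(0, p)` to the starting point of the chord of slope `s` through
that point. -/
noncomputable def travel (p s : ℝ) (ω : Env M) : ℝ≥0∞ :=
  ⨆ r : ℚ, {z : ℝ × Env M | BackSegment p z.1 r z.2}.indicator
    (fun _ => ENNReal.ofReal r) (s, ω)

theorem measurable_travel (p : ℝ) : Measurable fun z : ℝ × Env M => travel p z.1 z.2 :=
  Measurable.iSup fun r => measurable_const.indicator (measurableSet_backSegment p r)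

theorem le_travel {p s : ℝ} {r : ℚ} {ω : Env M} (h : BackSegment p s r ω) :
    ENNReal.ofReal r ≤ travel p s ω := by
  refine le_trans ?_ (le_iSup _ r)
  rw [indicator_of_mem (show (s, ω) ∈ {z : ℝ × Env M | BackSegment p z.1 r z.2} from h)]

theorem mem_tube_of_lt_travel {p s r' : ℝ} {ω : Env M} (hr' : 0 ≤ r')
    (h : ENNReal.ofReal r' < travel p s ω) : pt (-r') (p - s * r') ∈ ω.tube := by
  obtain ⟨r, hr⟩ := lt_iSup_iff.1 h
  by_cases hb : (s, ω) ∈ {z : ℝ × Env M | BackSegment p z.1 r z.2}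
  · rw [indicator_of_mem hb] at hr
    exact hb r' ⟨hr', ((ENNReal.ofReal_lt_ofReal_iff_of_nonneg hr').1 hr).le⟩
  · rw [indicator_of_notMem hb] at hr
    simp at hr

attribute [irreducible] travel

theorem travel_le {p s : ℝ} (hs : 0 < s) (ω : Env M) :
    travel p s ω ≤ ENNReal.ofReal ((p + M) / s) := by
  refine le_of_forall_lt fun x hx => ?_
  obtain ⟨r', hr', hx', hlt⟩ : ∃ r' : ℝ, 0 ≤ r' ∧ x < ENNReal.ofReal r' ∧
      ENNReal.ofReal r' < travel p s ω := by
    obtain ⟨y, hy1, hy2⟩ := ENNReal.lt_iff_exists_nnreal_btwn.1 hx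
    exact ⟨y, y.2, by simpa using hy1, by simpa using hy2⟩
  refine hx'.trans_le (ENNReal.ofReal_le_ofReal ?_)
  have := ω.abs_le_of_mem_tube (mem_tube_of_lt_travel hr' hlt)
  rw [pt_one, abs_le] at this
  rw [le_div_iff₀ hs]
  linarith [this.1]

theorem travel_ne_top {p s : ℝ} (hs : 0 < s) (ω : Env M) : travel p s ω ≠ ∞ :=
  ne_top_of_le_ne_top ENNReal.ofReal_ne_top (travel_le hs ω)

theorem notMem_tube_travel {p s : ℝ} (hs : 0 < s) (ω : Env M) :
    pt (-(travel p s ω).toReal) (p - s * (travel p s ω).toReal) ∉ ω.tube := by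
  intro hmem
  set τ := (travel p s ω).toReal with hτ
  have hτ' : ENNReal.ofReal τ = travel p s ω := ENNReal.ofReal_toReal (travel_ne_top hs ω)
  have hc : Continuous fun r' : ℝ => pt (-r') (p - s * r') :=
    continuous_pt (by fun_prop) (by fun_prop)
  obtain ⟨η, hη, hη'⟩ := Metric.mem_nhds_iff.1
    ((hc.tendsto τ).eventually (ω.isOpen_tube.mem_nhds hmem))
  obtain ⟨r, hr1, hr2⟩ := exists_rat_btwn (show τ < τ + η by linarith)
  have hb : BackSegment p s r ω := by
    intro r' hr'
    by_cases hlt : r' < τ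
    · refine mem_tube_of_lt_travel hr'.1 ?_
      rw [← hτ']
      exact (ENNReal.ofReal_lt_ofReal_iff_of_nonneg hr'.1).2 hlt
    · refine hη' ?_
      rw [Metric.mem_ball, Real.dist_eq, abs_lt]
      constructor <;> linarith [hr'.2]
  have := le_travel hb
  rw [← hτ', ENNReal.ofReal_le_ofReal_iff ENNReal.toReal_nonneg] at this
  linarith

theorem travel_mem_frontier {p s : ℝ} (hs : 0 < s) {ω : Env M} (hp : pt 0 p ∈ ω.tube) :
    pt (-(travel p s ω).toReal) (p - s * (travel p s ω).toReal) ∈ frontier ω.tube := by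
  have hout := notMem_tube_travel (p := p) hs ω
  set τ := (travel p s ω).toReal with hτ
  have hτ' : ENNReal.ofReal τ = travel p s ω := ENNReal.ofReal_toReal (travel_ne_top hs ω)
  have hτ0 : 0 < τ := by
    refine lt_of_le_of_ne ENNReal.toReal_nonneg fun h0 => hout ?_
    rw [← h0]; simpa using hp
  rw [ω.isOpen_tube.frontier_eq]
  refine ⟨?_, hout⟩
  have hc : Continuous fun r' : ℝ => pt (-r') (p - s * r') :=
    continuous_pt (by fun_prop) (by fun_prop)
  refine mem_closure_of_tendsto (b := 𝓝[<] τ)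
    ((hc.tendsto τ).mono_left nhdsWithin_le_nhds) ?_
  filter_upwards [Ioo_mem_nhdsLT hτ0] with r hr
  refine mem_tube_of_lt_travel hr.1.le ?_
  rw [← hτ']
  exact (ENNReal.ofReal_lt_ofReal_iff_of_nonneg hr.1.le).2 hr.2

/-- The first coordinate of the starting point of the chord of slope `s` through `(t, p)`. -/
noncomputable def startCoord (p s : ℝ) (ω : Env M) (t : ℝ) : ℝ :=
  t - (travel p s (shift t ω)).toReal

/-- The starting point of the chord of slope `s` through `(t, p)`. -/
noncomputable def startPt (p s : ℝ) (ω : Env M) (t : ℝ) : Plane :=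
  pt (startCoord p s ω t) (p - s * (travel p s (shift t ω)).toReal)

theorem measurable_startCoord (p : ℝ) :
    Measurable fun z : (ℝ × Env M) × ℝ => startCoord p z.1.1 z.1.2 z.2 := by
  have h1 : Measurable fun z : (ℝ × Env M) × ℝ => shift z.2 z.1.2 :=
    Measurable.comp (g := fun y : ℝ × Env M => shift y.1 y.2) measurable_shift
      (measurable_snd.prodMk (measurable_snd.comp measurable_fst))
  have h2 : Measurable fun z : (ℝ × Env M) × ℝ => travel p z.1.1 (shift z.2 z.1.2) :=
    Measurable.comp (g := fun y : ℝ × Env M => travel p y.1 y.2) (measurable_travel p)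
      ((measurable_fst.comp measurable_fst).prodMk h1)
  simp only [startCoord]
  exact measurable_snd.sub h2.ennreal_toReal

theorem shift_shift (a t : ℝ) (ω : Env M) : shift t (shift a ω) = shift (t + a) ω := by
  have : (shift t (shift a ω)).sec = (shift (t + a) ω).sec := by
    funext α
    simp [shift, add_assoc]
  cases h1 : shift t (shift a ω)
  cases h2 : shift (t + a) ω
  simp_all

theorem startCoord_shift (p s a : ℝ) (ω : Env M) (t : ℝ) :
    startCoord p s (shift a ω) t = startCoord p s ω (t + a) - a := by
  rw [startCoord, startCoord, shift_shift]; ring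

/-- The tube lies above -M, so the backward displacement is bounded. This makes the law of the
starting points locally finite. -/
theorem startCoord_mem_Icc {p s : ℝ} (hs : 0 < s) (ω : Env M) (t : ℝ) :
    startCoord p s ω t ∈ Icc (t - max ((p + M) / s) 0) t := by
  have h1 := ENNReal.toReal_mono ENNReal.ofReal_ne_top (travel_le (p := p) hs (shift t ω))
  rw [ENNReal.toReal_ofReal'] at h1
  have h2 : 0 ≤ (travel p s (shift t ω)).toReal := ENNReal.toReal_nonneg
  rw [startCoord]
  constructor <;> linarith

/-- The abscissa at height `p` of the line of slope `s` through a point. -/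
noncomputable def crossing (p s : ℝ) (y : Plane) : ℝ := y 0 + (p - y 1) / s

theorem crossing_startPt {p s : ℝ} (hs : 0 < s) (ω : Env M) (t : ℝ) :
    crossing p s (startPt p s ω t) = t := by
  simp only [crossing, startPt, startCoord, pt_zero, pt_one]
  field_simp
  ring

theorem startPt_mem_frontier {p s : ℝ} (hs : 0 < s) {ω : Env M} (hp : ∀ a, pt a p ∈ ω.tube)
    (t : ℝ) : startPt p s ω t ∈ frontier ω.tube := by
  have := travel_mem_frontier (p := p) hs (ω := shift t ω) (by
    rw [mem_tube_shift, pt_add_pt]; exact hp _)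
  rw [tube_shift, mem_frontier_translate, pt_add_pt, neg_add_eq_sub] at this
  exact this

/-- Below height p the ray retraces the chord defining the starting point; from p up to q it runs in
the strip. -/
theorem startPt_ray {p q s : ℝ} (hs : 0 < s) {ω : Env M}
    (hstrip : ∀ a, ∀ u ∈ Icc p q, pt a u ∈ ω.tube) (t r : ℝ)
    (hr : r ∈ Ioo 0 ((q - startPt p s ω t 1) / s)) : startPt p s ω t + r • pt 1 s ∈ ω.tube := by
  set τ := (travel p s (shift t ω)).toReal with hτ
  have hτ' : ENNReal.ofReal τ = travel p s (shift t ω) :=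
    ENNReal.ofReal_toReal (travel_ne_top hs _)
  have heq : startPt p s ω t + r • pt 1 s = pt (t - (τ - r)) (p - s * (τ - r)) := by
    refine plane_ext ?_ ?_
    · simp [startPt, startCoord]; ring
    · simp [startPt]; ring
  rw [heq]
  by_cases hrτ : r ≤ τ
  · have := mem_tube_of_lt_travel (p := p) (s := s) (ω := shift t ω) (r' := τ - r)
      (by linarith) (by
        rw [← hτ']
        exact (ENNReal.ofReal_lt_ofReal_iff_of_nonneg (by linarith)).2 (by linarith [hr.1]))
    rw [mem_tube_shift, pt_add_pt, neg_add_eq_sub] at this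
    exact this
  · have h2 := hr.2
    rw [lt_div_iff₀ hs] at h2
    simp only [startPt, pt_one, ← hτ] at h2
    have : 0 < s * (r - τ) := mul_pos hs (by linarith)
    exact hstrip _ _ ⟨by linarith, by nlinarith⟩

theorem startPt_one_le {p s : ℝ} (hs : 0 < s) (ω : Env M) (t : ℝ) : startPt p s ω t 1 ≤ p := by
  have : 0 ≤ s * (travel p s (shift t ω)).toReal := mul_nonneg hs.le ENNReal.toReal_nonneg
  simp only [startPt, pt_one]
  linarith

/-! ### The density of the starting points -/

/-- The upper density at the origin of the starting points of chords of slope `s`. -/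
noncomputable def startDensity (p s : ℝ) (ω : Env M) : ℝ≥0∞ :=
  limsup (fun k : ℕ => ((k : ℝ≥0∞) + 1) *
    volume {t | startCoord p s ω t ∈ Icc (0 : ℝ) (1 / ((k : ℝ) + 1))}) atTop

theorem measurable_startDensity (p : ℝ) :
    Measurable fun z : ℝ × Env M => startDensity p z.1 z.2 := by
  refine Measurable.limsup fun k => measurable_const.mul ?_
  exact measurable_measure_prodMk_left
    (s := {z : (ℝ × Env M) × ℝ | startCoord p z.1.1 z.1.2 z.2 ∈ Icc (0 : ℝ) (1 / ((k : ℝ) + 1))})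
    (measurable_startCoord p measurableSet_Icc)

theorem measurable_startCoord_right (p s : ℝ) (ω : Env M) : Measurable (startCoord p s ω) := by
  have h : Measurable fun t : ℝ => (((s, ω), t) : (ℝ × Env M) × ℝ) :=
    measurable_const.prodMk measurable_id
  exact Measurable.comp (g := fun z : (ℝ × Env M) × ℝ => startCoord p z.1.1 z.1.2 z.2)
    (measurable_startCoord p) h

/-- Near a point of a boundary with non-horizontal normal, chords are not too steep. -/
theorem abs_one_le_of_flat {n v : Plane} (hn : ‖n‖ = 1) (hn1 : n 1 ≠ 0) {c : ℝ}
    (hc : c ≤ |n 1| / 2) (h : |⟪v, n⟫| ≤ c * ‖v‖) : |v 1| ≤ 4 / |n 1| * |v 0| := by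
  have hpos : 0 < |n 1| := abs_pos.2 hn1
  have hn0 : |n 0| ≤ 1 := hn ▸ abs_zero_le_norm n
  have hn1' : |n 1| ≤ 1 := hn ▸ abs_one_le_norm n
  have h1 : |v 1| * |n 1| ≤ |n 1| / 2 * (|v 0| + |v 1|) + |v 0| := by
    calc |v 1| * |n 1| = |⟪v, n⟫ - v 0 * n 0| := by
          rw [inner_eq, add_sub_cancel_left, abs_mul]
      _ ≤ |⟪v, n⟫| + |v 0| * |n 0| := (abs_sub _ _).trans (by rw [abs_mul (v 0)])
      _ ≤ c * ‖v‖ + |v 0| * 1 := by gcongr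
      _ ≤ |n 1| / 2 * (|v 0| + |v 1|) + |v 0| := by
          rw [mul_one]
          have := mul_le_mul hc (norm_le_abs_add_abs v) (norm_nonneg v) (by positivity)
          linarith
  rw [div_mul_eq_mul_div, le_div_iff₀ hpos]
  have : |n 1| / 2 * |v 0| ≤ 1 / 2 * |v 0| := by gcongr
  nlinarith [abs_nonneg (v 0)]

/-- Local control of the crossing point by the first coordinate along the boundary. -/
theorem exists_abs_crossing_sub_le {ω : Env M} {x : Plane} (hx : x ∈ regularPoints ω) (p : ℝ)
    {s : ℝ} (hs : 0 < s) {η : ℝ} (hη : 0 < η) :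
    ∃ δ > 0, ∀ y ∈ frontier ω.tube ∩ Metric.ball x δ, ∀ z ∈ frontier ω.tube ∩ Metric.ball x δ,
      |crossing p s y - crossing p s z| ≤
        (|normal ω.tube x 0 + s * normal ω.tube x 1| / (s * |normal ω.tube x 1|) + η) *
          |y 0 - z 0| := by
  obtain ⟨hC, hn1⟩ := mem_regularPoints_iff.1 hx
  have hn := (hC.isInnerNormal_normal ω.isOpen_tube).1
  set n := normal ω.tube x
  have hpos : 0 < |n 1| := abs_pos.2 hn1
  set C : ℝ := 1 + 4 / |n 1| with hCdef
  have hCpos : 0 < C := by positivity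
  set c := min (|n 1| / 2) (η * s * |n 1| / C) with hc
  have hcpos : 0 < c := by positivity
  obtain ⟨δ, hδ, h⟩ := hC.exists_abs_inner_le ω.isOpen_tube ω.regular' c hcpos
  refine ⟨δ, hδ, fun y hy z hz => ?_⟩
  have h1 := h y hy.1 z hz.1 hy.2 hz.2
  have h2 := abs_one_le_of_flat hn hn1 (min_le_left _ _) h1
  set v := y - z with hv
  have hnorm : ‖v‖ ≤ C * |v 0| := by
    rw [hCdef, add_mul, one_mul]
    exact (norm_le_abs_add_abs v).trans (by gcongr)
  have h3 : (crossing p s y - crossing p s z) * (s * n 1) = v 0 * (n 0 + s * n 1) - ⟪v, n⟫ := by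
    rw [inner_eq]
    simp only [crossing, hv, PiLp.sub_apply]
    field_simp
    ring
  have h4 : |crossing p s y - crossing p s z| * (s * |n 1|) ≤
      |v 0| * |n 0 + s * n 1| + η * s * |n 1| * |v 0| := by
    calc |crossing p s y - crossing p s z| * (s * |n 1|)
        = |(crossing p s y - crossing p s z) * (s * n 1)| := by
          rw [abs_mul, abs_mul s, abs_of_pos hs]
      _ = |v 0 * (n 0 + s * n 1) - ⟪v, n⟫| := by rw [h3]
      _ ≤ |v 0| * |n 0 + s * n 1| + |⟪v, n⟫| := (abs_sub _ _).trans (by rw [abs_mul])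
      _ ≤ |v 0| * |n 0 + s * n 1| + (η * s * |n 1| / C) * (C * |v 0|) := by
          gcongr
          refine h1.trans (mul_le_mul (min_le_right _ _) hnorm (norm_nonneg _) (by positivity))
      _ = _ := by field_simp
  have hsn : 0 < s * |n 1| := by positivity
  have h5 : |v 0| = |y 0 - z 0| := by rw [hv, PiLp.sub_apply]
  rw [← h5, ← mul_le_mul_iff_left₀ hsn]
  refine h4.trans (le_of_eq ?_)
  field_simp

theorem exists_lipschitzWith_crossing (p : ℝ) {s : ℝ} (hs : 0 < s) :
    ∃ K, LipschitzWith K (crossing p s) := by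
  refine ⟨Real.toNNReal (1 + 1 / s), LipschitzWith.of_dist_le_mul fun y z => ?_⟩
  rw [Real.coe_toNNReal _ (by positivity), Real.dist_eq, dist_eq_norm y z]
  have h0 := abs_zero_le_norm (y - z)
  have h1 := abs_one_le_norm (y - z)
  have h2 : crossing p s y - crossing p s z = (y - z) 0 - (y - z) 1 * (1 / s) := by
    simp only [crossing, PiLp.sub_apply]; ring
  rw [h2]
  calc _ ≤ |(y - z) 0| + |(y - z) 1 * (1 / s)| := abs_sub _ _
    _ = |(y - z) 0| + |(y - z) 1| * (1 / s) := by
        rw [abs_mul, abs_of_pos (show 0 < 1 / s by positivity)]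
    _ ≤ ‖y - z‖ + ‖y - z‖ * (1 / s) := by gcongr
    _ = _ := by ring

/-- The law of the starting points is absolutely continuous. -/
theorem absolutelyContinuous_startCoord {ω : Env M} {p s : ℝ} (hs : 0 < s)
    (hp : ∀ a, pt a p ∈ ω.tube)
    (hR : boundaryMeasure ω (frontier ω.tube \ regularPoints ω) = 0) :
    (volume : Measure ℝ).map (startCoord p s ω) ≪ volume := by
  rw [boundaryMeasure_apply_frontier_diff] at hR
  refine Measure.AbsolutelyContinuous.mk fun N hN hN0 => ?_
  rw [Measure.map_apply (measurable_startCoord_right p s ω) hN]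
  set E : Set Plane := {y | y ∈ regularPoints ω ∧ y 0 ∈ N} with hE
  -- Each t is recovered as the crossing abscissa of its starting point. Crossings of irregular
  -- points are null, and near a regular point the crossing is a Lipschitz function of the abscissa,
  -- because the normal is not horizontal.
  have hsub : startCoord p s ω ⁻¹' N ⊆
      crossing p s '' (frontier ω.tube \ regularPoints ω) ∪ crossing p s '' E := by
    intro t ht
    rw [← image_union]
    refine ⟨startPt p s ω t, ?_, crossing_startPt hs ω t⟩
    by_cases hreg : startPt p s ω t ∈ regularPoints ω
    · exact Or.inr ⟨hreg, ht⟩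
    · exact Or.inl ⟨startPt_mem_frontier hs hp t, hreg⟩
  refine measure_mono_null hsub (measure_union_null ?_ ?_)
  · obtain ⟨K, hK⟩ := exists_lipschitzWith_crossing p hs
    refine le_antisymm ((volume_image_le_mul_hausdorffMeasure hK.lipschitzOnWith).trans ?_) zero_le
    rw [hR, mul_zero]
  · refine volume_image_eq_zero_of_locally fun x hx => ?_
    obtain ⟨δ, hδ, h⟩ := exists_abs_crossing_sub_le hx.1 p hs one_pos
    refine ⟨Metric.ball x δ, Metric.ball_mem_nhds x hδ, ?_⟩
    set K : ℝ := |normal ω.tube x 0 + s * normal ω.tube x 1| / (s * |normal ω.tube x 1|) + 1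
    have hK : 0 ≤ K := by positivity
    refine le_antisymm ((volume_image_le_of_dist_le (f := crossing p s) (g := fun y : Plane => y 0)
      (C := K.toNNReal) fun y hy z hz => ?_).trans ?_) zero_le
    · rw [Real.coe_toNNReal _ hK]
      exact h y ⟨hy.1.1.1, hy.2⟩ z ⟨hz.1.1.1, hz.2⟩
    · rw [measure_mono_null (t := N) (by rintro _ ⟨y, hy, rfl⟩; exact hy.1.2) hN0, mul_zero]

/-- By Lebesgue differentiation the density seen from the shifted environment is almost everywhere
the Radon–Nikodym derivative of the law of starting points; absolute continuity ensures that
integrating it loses no mass. -/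
theorem lintegral_startDensity_shift {ω : Env M} {p s : ℝ} (hs : 0 < s)
    (hp : ∀ a, pt a p ∈ ω.tube)
    (hR : boundaryMeasure ω (frontier ω.tube \ regularPoints ω) = 0) :
    ∫⁻ a in Ioo (0 : ℝ) 1, startDensity p s (shift a ω) =
      volume (startCoord p s ω ⁻¹' Ioo 0 1) := by
  have hm := measurable_startCoord_right p s ω
  set lam := (volume : Measure ℝ).map (startCoord p s ω) with hlam
  have hac : lam ≪ volume := absolutelyContinuous_startCoord hs hp hR
  have : IsLocallyFiniteMeasure lam := by
    refine ⟨fun x => ⟨Icc (x - 1) (x + 1), Icc_mem_nhds (by linarith) (by linarith), ?_⟩⟩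
    rw [hlam, Measure.map_apply hm measurableSet_Icc]
    refine (measure_mono (t := Icc (x - 1) (x + 1 + max ((p + M) / s) 0)) fun t ht => ?_).trans_lt
      measure_Icc_lt_top
    have h1 := startCoord_mem_Icc (p := p) hs ω t
    exact ⟨ht.1.trans h1.2, by linarith [ht.2, h1.1]⟩
  have hvol : ∀ (a : ℝ) (k : ℕ),
      volume {t | startCoord p s (shift a ω) t ∈ Icc (0 : ℝ) (1 / ((k : ℝ) + 1))} =
        lam (Icc a (a + 1 / ((k : ℝ) + 1))) := by
    intro a k
    rw [hlam, Measure.map_apply hm measurableSet_Icc]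
    have : {t | startCoord p s (shift a ω) t ∈ Icc (0 : ℝ) (1 / ((k : ℝ) + 1))} =
        (fun t => t + a) ⁻¹' (startCoord p s ω ⁻¹' Icc a (a + 1 / ((k : ℝ) + 1))) := by
      ext t
      simp only [mem_ofPred_eq, mem_preimage, startCoord_shift, mem_Icc]
      constructor <;> rintro ⟨h1, h2⟩ <;> constructor <;> linarith
    rw [this, measure_preimage_add_right]
  have hlim : ∀ᵐ a : ℝ, startDensity p s (shift a ω) = lam.rnDeriv volume a := by
    filter_upwards [(IsUnifLocDoublingMeasure.vitaliFamily (volume : Measure ℝ) 1).ae_tendsto_rnDeriv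
      lam] with a ha
    have hseq : Tendsto (fun k : ℕ => a + 1 / ((k : ℝ) + 1)) atTop (𝓝[>] a) := by
      refine tendsto_nhdsWithin_iff.2 ⟨?_, Eventually.of_forall fun k => ?_⟩
      · simpa using (tendsto_one_div_add_atTop_nhds_zero_nat (𝕜 := ℝ)).const_add a
      · have : (0 : ℝ) < 1 / ((k : ℝ) + 1) := by positivity
        exact lt_add_of_pos_right a this
    have := ha.comp ((Real.tendsto_Icc_vitaliFamily_right a).comp hseq)
    refine Tendsto.limsup_eq (this.congr fun k => ?_)
    simp only [Function.comp_apply]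
    rw [hvol, Real.volume_Icc, add_sub_cancel_left, ENNReal.div_eq_inv_mul, one_div,
      ENNReal.ofReal_inv_of_pos (by positivity), inv_inv, ENNReal.ofReal_add (by positivity)
      zero_le_one, ENNReal.ofReal_natCast, ENNReal.ofReal_one]
  rw [lintegral_congr_ae (ae_restrict_of_ae hlim), Measure.setLIntegral_rnDeriv hac, hlam,
    Measure.map_apply hm measurableSet_Ioo]

attribute [irreducible] startDensity

/-- Per unit length of the tube, the starting points of chords have mean density one. -/
theorem lintegral_startDensity {P : Measure (Env M)} [IsProbabilityMeasure P]
    (hstat : IsStationary P) (hR : ConditionR P) {p s : ℝ} (hs : 0 < s)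
    (hp : ∀ᵐ ω ∂P, ∀ a, pt a p ∈ ω.tube) : ∫⁻ ω, startDensity p s ω ∂P = 1 := by
  have hpair : Measurable fun ω : Env M => (s, ω) := measurable_const.prodMk measurable_id
  have hD : Measurable fun ω : Env M => startDensity p s ω :=
    Measurable.comp (g := fun z : ℝ × Env M => startDensity p z.1 z.2)
      (measurable_startDensity p) hpair
  have hτ : Measurable fun ω : Env M => (travel p s ω).toReal :=
    (Measurable.comp (g := fun z : ℝ × Env M => travel p z.1 z.2)
      (measurable_travel p) hpair).ennreal_toReal
  have htriple : Measurable fun z : Env M × ℝ => (((s, z.1), z.2) : (ℝ × Env M) × ℝ) :=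
    (measurable_const.prodMk measurable_fst).prodMk measurable_snd
  have hset : MeasurableSet {z : Env M × ℝ | startCoord p s z.1 z.2 ∈ Ioo (0 : ℝ) 1} :=
    (Measurable.comp (g := fun z : (ℝ × Env M) × ℝ => startCoord p z.1.1 z.1.2 z.2)
      (measurable_startCoord p) htriple) measurableSet_Ioo
  have hset' : MeasurableSet {z : Env M × ℝ | z.2 - (travel p s z.1).toReal ∈ Ioo (0 : ℝ) 1} :=
    (Measurable.sub measurable_snd (Measurable.comp (g := fun ω : Env M => (travel p s ω).toReal)
      hτ measurable_fst)) measurableSet_Ioo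
  have hpre : ∀ t : ℝ, {ω : Env M | startCoord p s ω t ∈ Ioo (0 : ℝ) 1} =
      shift t ⁻¹' {ω : Env M | t - (travel p s ω).toReal ∈ Ioo (0 : ℝ) 1} := fun t => rfl
  have hmeas : ∀ t : ℝ, MeasurableSet {ω : Env M | t - (travel p s ω).toReal ∈ Ioo (0 : ℝ) 1} :=
    fun t => (Measurable.sub measurable_const hτ) measurableSet_Ioo
  calc ∫⁻ ω, startDensity p s ω ∂P
      = ∫⁻ ω, (∫⁻ a in Ioo (0 : ℝ) 1, startDensity p s (shift a ω)) ∂P :=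
        lintegral_eq_lintegral_shift hstat hD
    _ = ∫⁻ ω, volume (startCoord p s ω ⁻¹' Ioo 0 1) ∂P := by
        refine lintegral_congr_ae ?_
        filter_upwards [hR, hp] with ω hω hpω using lintegral_startDensity_shift hs hpω hω
    _ = (P.prod volume) {z : Env M × ℝ | startCoord p s z.1 z.2 ∈ Ioo (0 : ℝ) 1} :=
        (Measure.prod_apply hset).symm
    _ = ∫⁻ t : ℝ, P {ω | startCoord p s ω t ∈ Ioo (0 : ℝ) 1} := Measure.prod_apply_symm hset
    -- The mass transport step: for each fixed t, the displacement seen at t has the same law as the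
    -- one seen at 0. After exchanging the integrals, each environment contributes a translate of
    -- (0,1).
    _ = ∫⁻ t : ℝ, P {ω | t - (travel p s ω).toReal ∈ Ioo (0 : ℝ) 1} := by
        refine lintegral_congr fun t => ?_
        rw [hpre, (hstat t).measure_preimage (hmeas t).nullMeasurableSet]
    _ = (P.prod volume) {z : Env M × ℝ | z.2 - (travel p s z.1).toReal ∈ Ioo (0 : ℝ) 1} :=
        (Measure.prod_apply_symm hset').symm
    _ = ∫⁻ ω, volume ((fun t : ℝ => t - (travel p s ω).toReal) ⁻¹' Ioo 0 1) ∂P :=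
        Measure.prod_apply hset'
    _ = 1 := by
        simp [sub_eq_add_neg]


/-! ### Starting points near the vertical axis -/

theorem mem_frontier_slice_of_regular {ω : Env M} {y : Plane} (hy : y ∈ regularPoints ω) :
    y 1 ∈ frontier (ω.slice (y 0)) := by
  obtain ⟨hC, hn1⟩ := mem_regularPoints_iff.1 hy
  have hfr := hy.1
  rw [ω.isOpen_tube.frontier_eq] at hfr
  rw [(show IsOpen (ω.slice (y 0)) from (ω.sec (y 0)).isOpen).frontier_eq]
  refine ⟨?_, hfr.2⟩
  set n := normal ω.tube y with hn
  have hpos : 0 < ⟪pt 0 (n 1), n⟫ := by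
    rw [inner_eq]; simp only [pt_zero, pt_one, zero_mul, zero_add]
    exact mul_self_pos.2 hn1
  have hc : Tendsto (fun t : ℝ => y 1 + t * n 1) (𝓝[>] 0) (𝓝 (y 1)) := by
    have : Continuous fun t : ℝ => y 1 + t * n 1 := by fun_prop
    simpa using (this.tendsto 0).mono_left nhdsWithin_le_nhds
  refine mem_closure_of_tendsto hc ?_
  filter_upwards [(hC.isInnerNormal_normal ω.isOpen_tube).eventually_mem hpos] with t ht
  have : (y + t • pt 0 (n 1)) 1 ∈ ω.slice ((y + t • pt 0 (n 1)) 0) := ht.1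
  simpa using this

/-- By compactness, the boundary over a thin slab to the right of the axis lies in arbitrarily small
balls around the boundary points on the axis. -/
theorem eventually_exists_mem_ball {ω : Env M}
    (hreg : ∀ y ∈ frontier ω.tube, y 0 = 0 → y ∈ regularPoints ω) {δ : ℝ → ℝ}
    (hδ : ∀ u ∈ frontier (ω.slice 0), 0 < δ u) :
    ∀ᶠ k : ℕ in atTop, ∀ y ∈ frontier ω.tube, y 0 ∈ Icc (0 : ℝ) (1 / ((k : ℝ) + 1)) →
      ∃ u ∈ frontier (ω.slice 0), y ∈ Metric.ball (pt 0 u) (δ u) := by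
  set C : Set Plane := frontier ω.tube ∩ {y | |y 0| ≤ 1} ∩
    (⋃ u ∈ frontier (ω.slice 0), Metric.ball (pt 0 u) (δ u))ᶜ with hC
  have hclosed : IsClosed C := (isClosed_frontier.inter
    (isClosed_le (by fun_prop) continuous_const)).inter
      (isOpen_biUnion fun _ _ => Metric.isOpen_ball).isClosed_compl
  have hcl : IsClosed {x : Plane | |x 1| ≤ M} := isClosed_le (by fun_prop) continuous_const
  have hbdd : C ⊆ Metric.closedBall 0 (1 + M) := by
    intro y hy
    have hM : |y 1| ≤ M := closure_minimal (fun x hx => ω.abs_le_of_mem_tube hx) hcl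
      (frontier_subset_closure hy.1.1)
    rw [mem_closedBall_zero_iff]
    refine (norm_le_abs_add_abs _).trans ?_
    have : |y 0| ≤ 1 := hy.1.2
    linarith
  have hcomp : IsCompact C := (isCompact_closedBall _ _).of_isClosed_subset hclosed hbdd
  obtain ⟨m, hm, hmC⟩ : ∃ m > 0, ∀ y ∈ C, m ≤ |y 0| := by
    rcases C.eq_empty_or_nonempty with h0 | hne
    · exact ⟨1, one_pos, by simp [h0]⟩
    · obtain ⟨y, hy, hmin⟩ := hcomp.exists_isMinOn hne
        (by fun_prop : Continuous fun y : Plane => |y 0|).continuousOn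
      refine ⟨|y 0|, abs_pos.2 fun h0 => ?_, fun z hz => hmin hz⟩
      have hyr := hreg y hy.1.1 h0
      have hu := mem_frontier_slice_of_regular hyr
      rw [h0] at hu
      refine hy.2 (mem_iUnion₂.2 ⟨y 1, hu, ?_⟩)
      rw [show pt 0 (y 1) = y from plane_ext h0.symm rfl]
      exact Metric.mem_ball_self (hδ _ hu)
  filter_upwards [(tendsto_one_div_add_atTop_nhds_zero_nat (𝕜 := ℝ)).eventually_lt_const
    (lt_min hm one_pos)] with k hk y hy hyk
  rw [lt_min_iff] at hk
  by_contra! hnot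
  have hy0 : |y 0| ≤ 1 / ((k : ℝ) + 1) := by rw [abs_of_nonneg hyk.1]; exact hyk.2
  have hyC : y ∈ C := ⟨⟨hy, hy0.trans hk.2.le⟩, fun h => by
    obtain ⟨u, hu, hyu⟩ := mem_iUnion₂.1 h
    exact hnot u hu hyu⟩
  linarith [hmC y hyC]

theorem inner_pt_one (s : ℝ) (n : Plane) : ⟪pt 1 s, n⟫ = n 0 + s * n 1 := by
  rw [inner_eq, pt_zero, pt_one, one_mul]

/-- Chords of slope `s` start near a boundary point only if the ray with that slope is tangential
there or ends in a far point. -/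
theorem exists_startPt_notMem_ball {ω : Env M} {R : Set Plane} (hRreg : R ⊆ regularPoints ω)
    {u s p q : ℝ} (hs : s ∈ Ioo (0 : ℝ) 1) (hpq : p < q)
    (hstrip : ∀ a, ∀ u ∈ Icc p q, pt a u ∈ ω.tube)
    (hx : pt 0 u ∈ regularPoints ω) (hbad : s ∉ slopeTo u '' badPoints ω R u)
    (hne : ⟪pt 1 s, normal ω.tube (pt 0 u)⟫ ≠ 0)
    (hfar : s ∉ slopeTo u '' farPoints ω R (q - p) u) :
    ∃ δ > 0, ∀ t, startPt p s ω t ∉ Metric.ball (pt 0 u) δ := by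
  by_contra! hcon
  have hmem : pt 0 u ∈ closure (range (startPt p s ω)) := by
    rw [Metric.mem_closure_iff]
    intro δ hδ
    obtain ⟨t, ht⟩ := hcon δ hδ
    exact ⟨_, mem_range_self t, by rwa [dist_comm]⟩
  have hup : u ≤ p := by
    have hcl : IsClosed {y : Plane | y 1 ≤ p} := isClosed_le (by fun_prop) continuous_const
    exact closure_minimal (by rintro _ ⟨t, rfl⟩; exact startPt_one_le hs.1 ω t) hcl hmem
  -- Rays from starting points accumulating at (0,u) converge to the ray from (0,u), which is
  -- therefore in the closure of the tube up to height q.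
  have hray : ∀ r ∈ Ioo 0 ((q - u) / s), pt 0 u + r • pt 1 s ∈ closure ω.tube := by
    intro r hr
    rw [mem_closure_iff_frequently] at hmem ⊢
    have hc : Continuous fun y : Plane => y + r • pt 1 s := by fun_prop
    refine (hc.tendsto (pt 0 u)).frequently ?_
    have hc2 : Continuous fun y : Plane => (q - y 1) / s := by fun_prop
    have hev := (hc2.tendsto (pt 0 u)).eventually_const_lt (u := r) (by simpa using hr.2)
    refine (hmem.and_eventually hev).mono ?_
    rintro _ ⟨⟨t, rfl⟩, ht⟩
    exact startPt_ray hs.1 hstrip t r ⟨hr.1, ht⟩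
  rcases lt_or_gt_of_ne hne with hneg | hpos
  · have hnor := hx.2.1.isInnerNormal_normal ω.isOpen_tube
    have hlen : 0 < (q - u) / s := div_pos (by linarith) hs.1
    have hev : ∀ᶠ t in 𝓝[>] (0 : ℝ), t < (q - u) / s :=
      mem_nhdsWithin_of_mem_nhds (Iio_mem_nhds hlen)
    have hpos' : 0 < ⟪-pt 1 s, normal ω.tube (pt 0 u)⟫ := by rw [inner_neg_left]; linarith
    obtain ⟨t, ⟨ht1, ht2⟩, ht3⟩ := ((hnor.eventually_notMem_closure hpos').and hev).and
      self_mem_nhdsWithin |>.exists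
    refine ht1 ?_
    rw [smul_neg, sub_neg_eq_add]
    exact hray t ⟨ht3, ht2⟩
  · exact hfar (mem_slopeTo_farPoints hRreg hs hup hpq hbad hpos hray)

/-- The density, at a boundary point on the vertical axis, of the chords of slope `s` with respect
to the first coordinate of the starting point. -/
noncomputable def chordWeight (ω : Env M) (u s : ℝ) : ℝ :=
  (normal ω.tube (pt 0 u) 0 + s * normal ω.tube (pt 0 u) 1) / (s * |normal ω.tube (pt 0 u) 1|)

/-- The set of t is an image under `crossing`, which along the boundary changes at rate
|n·(1,s)|/(s|n 1|) relative to the abscissa. If the ray from (0,u) does not reach a far point,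
either this rate is zero or no chord starts nearby. -/
theorem exists_volume_startCoord_le {ω : Env M} {R : Set Plane} (hRreg : R ⊆ regularPoints ω)
    {u s p q : ℝ} (hs : s ∈ Ioo (0 : ℝ) 1) (hpq : p < q)
    (hstrip : ∀ a, ∀ u ∈ Icc p q, pt a u ∈ ω.tube)
    (hx : pt 0 u ∈ regularPoints ω) (hbad : s ∉ slopeTo u '' badPoints ω R u)
    {c : ℝ≥0} (hc : 0 < c) :
    ∃ δ > 0, ∀ k : ℕ, ((k : ℝ≥0∞) + 1) *
      volume {t | startCoord p s ω t ∈ Icc (0 : ℝ) (1 / ((k : ℝ) + 1)) ∧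
        startPt p s ω t ∈ Metric.ball (pt 0 u) δ} ≤
      (slopeTo u '' farPoints ω R (q - p) u).indicator
        (fun s => ENNReal.ofReal (chordWeight ω u s)) s + c := by
  set n := normal ω.tube (pt 0 u) with hn
  obtain ⟨δ, hδ, h⟩ := exists_abs_crossing_sub_le hx p hs.1 (η := c) (by exact_mod_cast hc)
  rw [← hn] at h
  have hn1 : 0 < |n 1| := abs_pos.2 (mem_regularPoints_iff.1 hx).2
  set J : ℝ := |n 0 + s * n 1| / (s * |n 1|) with hJ
  have hs0 := hs.1
  have hJ0 : 0 ≤ J := by positivity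
  have hmain : ∀ k : ℕ, ((k : ℝ≥0∞) + 1) *
      volume {t | startCoord p s ω t ∈ Icc (0 : ℝ) (1 / ((k : ℝ) + 1)) ∧
        startPt p s ω t ∈ Metric.ball (pt 0 u) δ} ≤ ENNReal.ofReal J + c := by
    intro k
    set E : Set Plane := frontier ω.tube ∩ Metric.ball (pt 0 u) δ ∩
      {y | y 0 ∈ Icc (0 : ℝ) (1 / ((k : ℝ) + 1))} with hE
    have hsub : {t | startCoord p s ω t ∈ Icc (0 : ℝ) (1 / ((k : ℝ) + 1)) ∧
        startPt p s ω t ∈ Metric.ball (pt 0 u) δ} ⊆ crossing p s '' E := by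
      rintro t ⟨ht, htb⟩
      exact ⟨startPt p s ω t, ⟨⟨startPt_mem_frontier hs.1
        (fun a => hstrip a p ⟨le_rfl, hpq.le⟩) t, htb⟩, ht⟩, crossing_startPt hs.1 ω t⟩
    have hle : volume (crossing p s '' E) ≤ ((J + c).toNNReal : ℝ≥0∞) *
        volume ((fun y : Plane => y 0) '' E) := by
      refine volume_image_le_of_dist_le fun y hy z hz => ?_
      rw [Real.coe_toNNReal _ (by positivity)]
      exact h y hy.1 z hz.1
    have hle2 : volume ((fun y : Plane => y 0) '' E) ≤ ((k : ℝ≥0∞) + 1)⁻¹ := by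
      refine (measure_mono (t := Icc (0 : ℝ) (1 / ((k : ℝ) + 1)))
        (by rintro _ ⟨y, hy, rfl⟩; exact hy.2)).trans (le_of_eq ?_)
      rw [Real.volume_Icc, sub_zero, one_div, ENNReal.ofReal_inv_of_pos (by positivity),
        ENNReal.ofReal_add (by positivity) zero_le_one, ENNReal.ofReal_natCast,
        ENNReal.ofReal_one]
    calc _ ≤ ((k : ℝ≥0∞) + 1) * (((J + c).toNNReal : ℝ≥0∞) * ((k : ℝ≥0∞) + 1)⁻¹) := by
          gcongr
          exact (measure_mono hsub).trans (hle.trans (by gcongr))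
      _ = ((J + c).toNNReal : ℝ≥0∞) := by
          rw [mul_left_comm, ENNReal.mul_inv_cancel (by simp) (by finiteness), mul_one]
      _ = _ := by
          rw [← ENNReal.ofReal_coe_nnreal (p := c), ← ENNReal.ofReal_add hJ0 c.coe_nonneg, ENNReal.ofReal]
  by_cases hfar : s ∈ slopeTo u '' farPoints ω R (q - p) u
  · refine ⟨δ, hδ, fun k => (hmain k).trans (le_of_eq ?_)⟩
    rw [indicator_of_mem hfar]
    obtain ⟨y, ⟨-, hy0, -, -, hyn, -⟩, hys⟩ := hfar
    have hyx1 : y 1 - u = s * y 0 := by rw [← hys, slopeTo, div_mul_cancel₀ _ hy0.ne']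
    have hyxn : ⟪y - pt 0 u, n⟫ = y 0 * (n 0 + s * n 1) := by
      rw [inner_eq]
      simp only [PiLp.sub_apply, pt_zero, pt_one, sub_zero]
      rw [hyx1]; ring
    rw [hyxn] at hyn
    rw [hJ, abs_of_pos (pos_of_mul_pos_right hyn hy0.le), chordWeight]
  · rw [indicator_of_notMem hfar, zero_add]
    by_cases hne : ⟪pt 1 s, n⟫ = 0
    · refine ⟨δ, hδ, fun k => (hmain k).trans (le_of_eq ?_)⟩
      rw [hJ, ← inner_pt_one, hne]
      simp
    · obtain ⟨δ', hδ', hno⟩ := exists_startPt_notMem_ball hRreg hs hpq hstrip hx hbad hne hfar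
      refine ⟨δ', hδ', fun k => ?_⟩
      simp [hno]

/-- Starting points with small abscissa cluster at the finitely many boundary points on the axis,
whose local bounds add up; the error c per point then tends to zero. -/
theorem startDensity_le {ω : Env M} {R : Set Plane} (hRreg : R ⊆ regularPoints ω)
    (hreg : ∀ y ∈ frontier ω.tube, y 0 = 0 → y ∈ regularPoints ω)
    {s p q : ℝ} (hs : s ∈ Ioo (0 : ℝ) 1) (hpq : p < q)
    (hstrip : ∀ a, ∀ u ∈ Icc p q, pt a u ∈ ω.tube)
    (hbad : ∀ u ∈ frontier (ω.slice 0), s ∉ slopeTo u '' badPoints ω R u) :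
    startDensity p s ω ≤ ∑ u ∈ (ω.finite_frontier_slice 0).toFinset,
      (slopeTo u '' farPoints ω R (q - p) u).indicator
        (fun s => ENNReal.ofReal (chordWeight ω u s)) s := by
  set F := (ω.finite_frontier_slice 0).toFinset with hF
  set W := ∑ u ∈ F, (slopeTo u '' farPoints ω R (q - p) u).indicator
    (fun s => ENNReal.ofReal (chordWeight ω u s)) s with hW
  have hFmem : ∀ u, u ∈ F ↔ u ∈ frontier (ω.slice 0) := fun u => by simp [hF]
  have key : ∀ c : ℝ≥0, 0 < c → startDensity p s ω ≤ W + F.card * (c : ℝ≥0∞) := by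
    intro c hc
    have hex : ∀ u, ∃ δ : ℝ, u ∈ frontier (ω.slice 0) → 0 < δ ∧ ∀ k : ℕ, ((k : ℝ≥0∞) + 1) *
        volume {t | startCoord p s ω t ∈ Icc (0 : ℝ) (1 / ((k : ℝ) + 1)) ∧
          startPt p s ω t ∈ Metric.ball (pt 0 u) δ} ≤
        (slopeTo u '' farPoints ω R (q - p) u).indicator
          (fun s => ENNReal.ofReal (chordWeight ω u s)) s + c := by
      intro u
      by_cases hu : u ∈ frontier (ω.slice 0)
      · obtain ⟨δ, h⟩ := exists_volume_startCoord_le hRreg hs hpq hstrip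
          (hreg _ (ω.mem_frontier_tube_of_slice hu) rfl) (hbad u hu) hc
        exact ⟨δ, fun _ => h⟩
      · exact ⟨0, fun h => absurd h hu⟩
    choose δ hδ using hex
    rw [startDensity]
    refine limsup_le_of_le (by isBoundedDefault) ?_
    filter_upwards [eventually_exists_mem_ball hreg fun u hu => (hδ u hu).1] with k hk
    have hsub : {t | startCoord p s ω t ∈ Icc (0 : ℝ) (1 / ((k : ℝ) + 1))} ⊆
        ⋃ u ∈ F, {t | startCoord p s ω t ∈ Icc (0 : ℝ) (1 / ((k : ℝ) + 1)) ∧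
          startPt p s ω t ∈ Metric.ball (pt 0 u) (δ u)} := by
      intro t ht
      obtain ⟨u, hu, hb⟩ := hk _ (startPt_mem_frontier hs.1
        (fun a => hstrip a p ⟨le_rfl, hpq.le⟩) t) ht
      exact mem_iUnion₂.2 ⟨u, (hFmem u).2 hu, ht, hb⟩
    calc _ ≤ ((k : ℝ≥0∞) + 1) * ∑ u ∈ F, volume {t | startCoord p s ω t ∈
            Icc (0 : ℝ) (1 / ((k : ℝ) + 1)) ∧ startPt p s ω t ∈ Metric.ball (pt 0 u) (δ u)} := by
          gcongr
          exact (measure_mono hsub).trans (measure_biUnion_finset_le _ _)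
      _ ≤ ∑ u ∈ F, ((slopeTo u '' farPoints ω R (q - p) u).indicator
            (fun s => ENNReal.ofReal (chordWeight ω u s)) s + c) := by
          rw [Finset.mul_sum]
          exact Finset.sum_le_sum fun u hu => (hδ u ((hFmem u).1 hu)).2 k
      _ = _ := by rw [Finset.sum_add_distrib, Finset.sum_const, nsmul_eq_mul]
  have hlim : Tendsto (fun c : ℝ≥0 => W + F.card * (c : ℝ≥0∞)) (𝓝[>] 0) (𝓝 (W + F.card * 0)) := by
    refine Tendsto.mono_left ?_ nhdsWithin_le_nhds
    have h1 : Tendsto (fun c : ℝ≥0 => (c : ℝ≥0∞)) (𝓝 0) (𝓝 0) := by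
      exact_mod_cast ENNReal.continuous_coe.tendsto (0 : ℝ≥0)
    exact (ENNReal.Tendsto.const_mul h1 (Or.inr (by finiteness))).const_add W
  rw [mul_zero, add_zero] at hlim
  refine ge_of_tendsto hlim ?_
  filter_upwards [self_mem_nhdsWithin] with c hc using key c hc

/-! ### The second moment -/

/-- The central comparison, for one environment: κ⁻¹ ((q - p)/s)² (n 0 + s n 1) equals (q - p)²/s
times `chordWeight`, so that the bounds of `le_b` and `startDensity_le` match term by term. -/
theorem lintegral_startDensity_le {ω : Env M} {ε : ℝ} {L : ℝ≥0} (hε : 0 < ε)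
    (hL : HasLipschitzBoundary ε L ω.tube)
    (hR : boundaryMeasure ω (frontier ω.tube \ regularPoints ω) = 0)
    (hflat : SectionFlat ω.tube) {p q : ℝ} (hpq : p < q)
    (hstrip : ∀ a, ∀ u ∈ Icc p q, pt a u ∈ ω.tube) :
    ∫⁻ s in Ioo (0 : ℝ) 1, ENNReal.ofReal (gammaTwo / 3 * (q - p) ^ 2 / s) * startDensity p s ω ≤
      ∫⁻ u, ENNReal.ofReal (kappa ω (pt 0 u))⁻¹ * b ω u ∂(sectionMeasure ω 0) := by
  obtain ⟨R, hRm, hRreg, hR0⟩ := exists_measurable_regular hR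
  have hreg : ∀ y ∈ frontier ω.tube, y 0 = 0 → y ∈ regularPoints ω := fun y hy hy0 =>
    mem_regularPoints_iff.2
      (regular_of_sectionFlat hε hL ω.isOpen_tube ω.regular' hflat hy hy0)
  have hbad : ∀ᵐ s ∂(volume.restrict (Ioo (0 : ℝ) 1)), ∀ u ∈ frontier (ω.slice 0),
      s ∉ slopeTo u '' badPoints ω R u := by
    refine ae_restrict_of_ae ((ae_ball_iff (ω.finite_frontier_slice 0).countable).2 fun u _ => ?_)
    exact measure_eq_zero_iff_ae_notMem.1 (volume_slopeTo_badPoints hε hL hRreg hR0 u)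
  set G : ℝ → ℝ → ℝ≥0∞ := fun u s => ENNReal.ofReal (gammaTwo / 3 * (q - p) ^ 2 / s) *
    ENNReal.ofReal (chordWeight ω u s) with hG
  have hGm : ∀ u, Measurable (G u) := fun u => by
    unfold G chordWeight; fun_prop
  set D : ℝ → Set ℝ := fun u => slopeTo u '' farPoints ω R (q - p) u with hD
  have hDm : ∀ u, MeasurableSet (toMeasurable volume (D u)) := fun u => measurableSet_toMeasurable _ _
  have hγ := gammaTwo_pos
  rw [lintegral_sectionMeasure]
  calc _ ≤ ∫⁻ s in Ioo (0 : ℝ) 1, ∑ u ∈ (ω.finite_frontier_slice 0).toFinset,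
        (toMeasurable volume (D u)).indicator (G u) s := by
        refine lintegral_mono_ae ?_
        filter_upwards [hbad, ae_restrict_mem measurableSet_Ioo] with s hbs hs
        refine (mul_le_mul_right (startDensity_le hRreg hreg hs hpq hstrip hbs) _).trans ?_
        rw [Finset.mul_sum]
        refine Finset.sum_le_sum fun u _ => ?_
        by_cases hsD : s ∈ D u
        · rw [indicator_of_mem hsD, indicator_of_mem (subset_toMeasurable _ _ hsD)]
        · rw [indicator_of_notMem hsD, mul_zero]; exact zero_le
    _ = ∑ u ∈ (ω.finite_frontier_slice 0).toFinset,
          ∫⁻ s in Ioo (0 : ℝ) 1, (toMeasurable volume (D u)).indicator (G u) s :=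
        lintegral_finsetSum _ fun u _ => (hGm u).indicator (hDm u)
    _ ≤ _ := by
        refine Finset.sum_le_sum fun u hu => ?_
        have hx : pt 0 u ∈ regularPoints ω :=
          hreg _ (ω.mem_frontier_tube_of_slice (by simpa using hu)) rfl
        have hn1 : 0 < |normal ω.tube (pt 0 u) 1| := abs_pos.2 (mem_regularPoints_iff.1 hx).2
        have hDfin : volume (D u) ≠ ∞ := by
          refine ne_top_of_le_ne_top (measure_Ioo_lt_top (a := (0 : ℝ)) (b := 1)).ne (measure_mono ?_)
          rintro _ ⟨y, hy, rfl⟩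
          exact hy.2.2.1
        rw [kappa_eq]
        calc _ ≤ ∫⁻ s in D u, G u s := by
              refine (setLIntegral_le_lintegral _ _).trans ?_
              rw [lintegral_indicator (hDm u), Measure.restrict_toMeasurable hDfin]
          _ ≤ ∫⁻ s in D u, ENNReal.ofReal |normal ω.tube (pt 0 u) 1|⁻¹ *
              ENNReal.ofReal (gammaTwo / 3 * ((q - p) / s) ^ 2 *
                (normal ω.tube (pt 0 u) 0 + s * normal ω.tube (pt 0 u) 1)) := by
              rw [← Measure.restrict_toMeasurable hDfin]
              refine lintegral_mono fun s => ?_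
              -- The comparison is made for all real s. For negative s the left side is zero by
              -- truncation, and at s = 0 both sides vanish by the convention on division by zero.
              rcases lt_or_ge s 0 with hs | hs
              · have : gammaTwo / 3 * (q - p) ^ 2 / s ≤ 0 :=
                  div_nonpos_of_nonneg_of_nonpos (by positivity) hs.le
                simp [G, ENNReal.ofReal_of_nonpos this]
              · simp only [G]
                rw [← ENNReal.ofReal_mul (by positivity), ← ENNReal.ofReal_mul (by positivity),
                  chordWeight]
                refine ENNReal.ofReal_le_ofReal (le_of_eq ?_)
                rcases hs.eq_or_lt with rfl | hs
                · simp
                · field_simp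
          _ = ENNReal.ofReal |normal ω.tube (pt 0 u) 1|⁻¹ * _ :=
              lintegral_const_mul _ (by fun_prop)
          _ ≤ _ := by
              gcongr
              exact le_b hε hL hRm hRreg (by linarith) hx

theorem lintegral_ofReal_div_eq_top {C : ℝ} (hC : 0 < C) :
    ∫⁻ s in Ioo (0 : ℝ) 1, ENNReal.ofReal (C / s) = ∞ := by
  by_contra hne
  have hm : Measurable fun s : ℝ => C / s := by fun_prop
  have h1 : IntegrableOn (fun s : ℝ => C / s) (Ioo 0 1) := by
    refine ⟨hm.aestronglyMeasurable, ?_⟩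
    rw [hasFiniteIntegral_iff_ofReal]
    · exact lt_top_iff_ne_top.2 hne
    · filter_upwards [ae_restrict_mem measurableSet_Ioo] with s hs
      exact (div_pos hC hs.1).le
  have h2 : IntegrableOn (fun s : ℝ => s ^ (-1 : ℝ)) (Ioo 0 1) := by
    refine IntegrableOn.congr_fun (h1.const_mul C⁻¹) (fun s hs => ?_) measurableSet_Ioo
    simp only [Real.rpow_neg_one]
    field_simp
  rw [intervalIntegral.integrableOn_Ioo_rpow_iff one_pos] at h2
  exact lt_irrefl _ h2

/-- Tonelli's theorem in slope and environment. For each slope the mean of `startDensity` is one, so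
the lower bound becomes the divergent integral of C/s. -/
theorem lintegral_second_moment_eq_top {P : Measure (Env M)} [IsProbabilityMeasure P]
    (hstat : IsStationary P) (hL : ConditionL P) (hR : ConditionR P) {p q : ℝ} (hpq : p < q)
    (hstrip : ∀ᵐ ω ∂P, ∀ a, ∀ u ∈ Icc p q, pt a u ∈ ω.tube) :
    ∫⁻ ω, ∫⁻ u, ENNReal.ofReal (kappa ω (pt 0 u))⁻¹ * b ω u ∂(sectionMeasure ω 0) ∂P = ∞ := by
  obtain ⟨ε, L, hε, hL⟩ := hL
  have hγ := gammaTwo_pos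
  have hpq' : 0 < q - p := by linarith
  have hp : ∀ᵐ ω ∂P, ∀ a, pt a p ∈ ω.tube := by
    filter_upwards [hstrip] with ω h a using h a p ⟨le_rfl, hpq.le⟩
  rw [eq_top_iff]
  calc ∞ = ∫⁻ s in Ioo (0 : ℝ) 1, ENNReal.ofReal (gammaTwo / 3 * (q - p) ^ 2 / s) :=
        (lintegral_ofReal_div_eq_top (by positivity)).symm
    _ = ∫⁻ s in Ioo (0 : ℝ) 1, (∫⁻ ω, ENNReal.ofReal (gammaTwo / 3 * (q - p) ^ 2 / s) *
          startDensity p s ω ∂P) := by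
        refine setLIntegral_congr_fun measurableSet_Ioo fun s hs => ?_
        have hm : Measurable fun ω : Env M => startDensity p s ω := by
          exact Measurable.comp (g := fun z : ℝ × Env M => startDensity p z.1 z.2)
            (measurable_startDensity p) (measurable_const.prodMk measurable_id)
        rw [lintegral_const_mul _ hm, lintegral_startDensity hstat hR hs.1 hp, mul_one]
    _ = ∫⁻ ω, (∫⁻ s in Ioo (0 : ℝ) 1, ENNReal.ofReal (gammaTwo / 3 * (q - p) ^ 2 / s) *
          startDensity p s ω) ∂P := by
        refine lintegral_lintegral_swap (Measurable.aemeasurable ?_)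
        refine Measurable.mul ?_ (measurable_startDensity p)
        exact ENNReal.measurable_ofReal.comp (measurable_const.div measurable_fst)
    _ ≤ _ := by
        refine lintegral_mono_ae ?_
        filter_upwards [hL, hR, ae_sectionFlat P hstat hR, hstrip] with ω h1 h2 h3 h4
        exact lintegral_startDensity_le hε h1 h2 h3 hpq h4

end RandomTube

/-! ### The proposition. -/

theorem proposition2p4 (M : ℝ) (hM : 0 < M)
    (P : MeasureTheory.Measure (RandomTube.Env M)) [MeasureTheory.IsProbabilityMeasure P]
    (hstat : RandomTube.IsStationary P) (herg : RandomTube.IsShiftErgodic P)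
    (hconn : ∀ᵐ ω ∂P, IsConnected ω.tube)
    (hL : RandomTube.ConditionL P) (hR : RandomTube.ConditionR P)
    (S : Set ℝ) (hS : S.OrdConnected) (hSnt : S.Nontrivial) (hSsub : S ⊆ RandomTube.Lam M)
    (hstrip : ∀ᵐ ω ∂P, ∀ α : ℝ, ∀ u ∈ S, RandomTube.pt α u ∈ ω.tube) :
    RandomTube.expQ P (fun ω u => RandomTube.b ω u) = ⊤ := by
  obtain ⟨p, hp, q, hq, hpq⟩ := hSnt.exists_lt
  have hstrip' : ∀ᵐ ω ∂P, ∀ α, ∀ u ∈ Set.Icc p q, RandomTube.pt α u ∈ ω.tube := by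
    filter_upwards [hstrip] with ω h α u hu using h α u (hS.out hp hq hu)
  rw [RandomTube.expQ, RandomTube.lintegral_second_moment_eq_top hstat hL hR hpq hstrip']
  -- Finiteness of `Z` is what keeps its inverse from being zero; no lower bound on `Z` is required.
  exact ENNReal.mul_top (ENNReal.inv_ne_zero.2 (RandomTube.Z_ne_top hstat hL hR))
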